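/- Let $\kappa>0$ and let $v_0,u_0:\mathbb R\to\mathbb R$ be measurable and locally bounded (bounded on bounded sets), with $v_0(x)>0$ for every $x$. Consider the droplet model $$v_t+(vu)_x=0,\qquad (vu)_t+(vu^2)_x=\frac1{t+\kappa}\Bigl(\frac x{t+\kappa}-u\Bigr)v,\qquad (v,u)|_{t=0}=(v_0,u_0).$$ For $x,y\in\mathbb R$, $t>0$ put $$F(y,x,t)=\int_0^y\Bigl(\bigl(\tfrac{\eta}{2\kappa}+\tfrac{u_0(\eta)}2\bigr)(t+\kappa)+\bigl(\tfrac\eta2-\tfrac{\kappa u_0(\eta)}2\bigr)\tfrac{\kappa}{t+\kappa}-x\Bigr)v_0(\eta)\,d\eta .$$ **(a)** If $\liminf_{|y|\to\infty}u_0(y)/y\ge-1/\kappa$ (in particular if $u_0$ is bounded), then $\min_{y\in\mathbb R}F(y,x,t)$ is attained for all $x\in\mathbb R$, $t>0$. **(b)** Suppose that $\min_{y\in\mathbb R}F(y,x,t)$ is attained for all $x\in\mathbb R$, $t>0$. Then $F(\cdot,x,t)$ has a leftmost minimizer $y_*=y_*(x,t)$ and a rightmost minimizer $y^*=y^*(x,t)$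 for all such $(x,t)$. Define $m(x,t)=\int_0^{y_*(x,t)}v_0(\eta)\,d\eta$ and $$u(x,t)=\frac{1+\frac{\kappa^2}{(t+\kappa)^2}}{(t+\kappa)-\frac{\kappa^2}{t+\kappa}}\Bigl[x-\tfrac12\Bigl(\tfrac{t+\kappa}\kappa+\tfrac\kappa{t+\kappa}\Bigr)y_*\Bigr]+\frac{y_*}2\Bigl(\tfrac1\kappa-\tfrac\kappa{(t+\kappa)^2}\Bigr)\quad\text{if }y_*=y^*,$$ $$u(x,t)=\frac{1}{\int_{y_*}^{y^*}v_0\,d\eta}\int_{y_*}^{y^*}\Bigl[\bigl(\tfrac\eta{2\kappa}+\tfrac{u_0(\eta)}2\bigr)-\bigl(\tfrac\eta2-\tfrac{\kappa u_0(\eta)}2\bigr)\tfrac{\kappa}{(t+\kappa)^2}\Bigr]v_0(\eta)\,d\eta\quad\text{if }y_*\ne y^*.$$ Then: 1. $(m,u)$ is a global weak solution: $m$ and $u$ are Borel measurable and locally bounded on $\mathbb R\times(0,\infty)$; for every $t>0$ the function $m(\cdot,t)$ is nondecreasing, and its Lebesgue–Stieltjes measure $dm$ is its distributional derivative $v=m_x$;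 and for every $\varphi\in C_c^\infty(\mathbb R\times(0,\infty))$ the following integrals converge and $$\iint\varphi_t\,m\,dx\,dt-\iint\varphi\,u\,dm\,dt=0,$$ $$\iint\Bigl[\varphi_t\,u+\varphi_x\,u^2+\frac1{t+\kappa}\Bigl(\frac x{t+\kappa}-u\Bigr)\varphi\Bigr]dm\,dt=0 .$$ 2. (Entropy condition) For all $t>0$ and $x$ the one-sided limits $u(x\pm0,t)$ exist and $u(x+0,t)\le u(x,t)\le u(x-0,t)$; and for all $t>0$ and $x_1\ne x_2$, $$\frac{u(x_2,t)-u(x_1,t)}{x_2-x_1}\le\frac{(t+\kappa)^2+\kappa^2}{(t+\kappa)\bigl((t+\kappa)^2-\kappa^2\bigr)} .$$ 3. (Initial data) As $t\to0+$, $m(x,t)\to\int_0^xv_0(\eta)\,d\eta$ for every $x$, and $u(x,t)\to u_0(x)$ at every common Lebesgue point $x$ of $u_0$ and $v_0$, hence for almost every $x$. -/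

import Mathlib

open MeasureTheory Set Filter Topology
open scoped ContDiff

namespace Droplet

/-- `f` is bounded on every bounded subset of the line. -/
def LocallyBounded (f : ℝ → ℝ) : Prop :=
  ∀ R : ℝ, ∃ C : ℝ, ∀ x ∈ Icc (-R) R, |f x| ≤ C

/-- Position at time `t` of the characteristic issued from `η` with initial velocity `u₀ η`. -/
noncomputable def charPos (κ : ℝ) (u₀ : ℝ → ℝ) (η t : ℝ) : ℝ :=
  (η / (2 * κ) + u₀ η / 2) * (t + κ) + (η / 2 - u₀ η * κ / 2) * (κ / (t + κ))

/-- Velocity at time `t` of the characteristic issued from `η`. -/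
noncomputable def charVel (κ : ℝ) (u₀ : ℝ → ℝ) (η t : ℝ) : ℝ :=
  (η / (2 * κ) + u₀ η / 2) - (η / 2 - u₀ η * κ / 2) * (κ / (t + κ) ^ 2)

/-- The generalized potential `F(y, x, t)`. -/
noncomputable def potential (κ : ℝ) (v₀ u₀ : ℝ → ℝ) (y x t : ℝ) : ℝ :=
  ∫ η in (0 : ℝ)..y, (charPos κ u₀ η t - x) * v₀ η

/-- The set of minimizers of `y ↦ F(y, x, t)` over the whole line. -/
def minimizers (κ : ℝ) (v₀ u₀ : ℝ → ℝ) (x t : ℝ) : Set ℝ :=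
  {y | ∀ z, potential κ v₀ u₀ y x t ≤ potential κ v₀ u₀ z x t}

/-- The minimum of `F(·, x, t)` is attained, for every `x` and every `t > 0`. -/
def MinimumAttained (κ : ℝ) (v₀ u₀ : ℝ → ℝ) : Prop :=
  ∀ x t : ℝ, 0 < t → (minimizers κ v₀ u₀ x t).Nonempty

/-- The leftmost minimizer `y_*(x, t)`. -/
noncomputable def yLeft (κ : ℝ) (v₀ u₀ : ℝ → ℝ) (x t : ℝ) : ℝ :=
  sInf (minimizers κ v₀ u₀ x t)

/-- The rightmost minimizer `y^*(x, t)`. -/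
noncomputable def yRight (κ : ℝ) (v₀ u₀ : ℝ → ℝ) (x t : ℝ) : ℝ :=
  sSup (minimizers κ v₀ u₀ x t)

/-- The cumulative mass `m(x, t)`. -/
noncomputable def mass (κ : ℝ) (v₀ u₀ : ℝ → ℝ) (x t : ℝ) : ℝ :=
  ∫ η in (0 : ℝ)..(yLeft κ v₀ u₀ x t), v₀ η

/-- The velocity `u(x, t)`: the slope of the characteristic through `(x, t)` if the minimizer is
unique, and otherwise the `v₀`-average of the characteristic velocities between `y_*` and `y^*`. -/
noncomputable def velocity (κ : ℝ) (v₀ u₀ : ℝ → ℝ) (x t : ℝ) : ℝ :=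
  if yLeft κ v₀ u₀ x t = yRight κ v₀ u₀ x t then
    (1 + κ ^ 2 / (t + κ) ^ 2) / ((t + κ) - κ ^ 2 / (t + κ)) *
        (x - 1 / 2 * ((t + κ) / κ + κ / (t + κ)) * yLeft κ v₀ u₀ x t)
      + yLeft κ v₀ u₀ x t / 2 * (1 / κ - κ / (t + κ) ^ 2)
  else
    (∫ η in (yLeft κ v₀ u₀ x t)..(yRight κ v₀ u₀ x t), charVel κ u₀ η t * v₀ η) /
      (∫ η in (yLeft κ v₀ u₀ x t)..(yRight κ v₀ u₀ x t), v₀ η)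

open Classical in
/-- The Lebesgue–Stieltjes measure `dg` of a nondecreasing function `g`
(only ever used for nondecreasing `g`; set to `0` otherwise). -/
noncomputable def stieltjesMeasure (g : ℝ → ℝ) : Measure ℝ :=
  if h : Monotone g then h.stieltjesFunction.measure else 0

/-- `φ` belongs to `C_c^∞(ℝ × (0, ∞))`; points are written `(x, t)`. -/
def IsTestFunction (φ : ℝ × ℝ → ℝ) : Prop :=
  ContDiff ℝ ∞ φ ∧ HasCompactSupport φ ∧ tsupport φ ⊆ univ ×ˢ Ioi (0 : ℝ)

/-- The partial derivative in `x`. -/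
noncomputable def partialX (φ : ℝ × ℝ → ℝ) (x t : ℝ) : ℝ := deriv (fun z => φ (z, t)) x

/-- The partial derivative in `t`. -/
noncomputable def partialT (φ : ℝ × ℝ → ℝ) (x t : ℝ) : ℝ := deriv (fun s => φ (x, s)) t

/-- `w` is bounded on every compact subset of `ℝ × (0, ∞)`. -/
def LocallyBoundedUpperHalf (w : ℝ → ℝ → ℝ) : Prop :=
  ∀ R a b : ℝ, 0 < a → ∃ C : ℝ, ∀ x ∈ Icc (-R) R, ∀ t ∈ Icc a b, |w x t| ≤ C

/-- The integrand `φ_t u + φ_x u² + (1/(t+κ)) (x/(t+κ) - u) φ` of the momentum identity. -/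
noncomputable def momentumIntegrand (κ : ℝ) (u : ℝ → ℝ → ℝ) (φ : ℝ × ℝ → ℝ) (x t : ℝ) : ℝ :=
  partialT φ x t * u x t + partialX φ x t * u x t ^ 2
    + 1 / (t + κ) * (x / (t + κ) - u x t) * φ (x, t)

/-- `(m, u)`, with `v = m_x`, is a generalized solution on `ℝ × (0, ∞)` of
`v_t + (v u)_x = 0`, `(v u)_t + (v u²)_x = (1/(t+κ)) (x/(t+κ) - u) v`.
Here `dm` is the Lebesgue–Stieltjes measure of `m(·, t)`, which is the distributional
`x`-derivative of `m(·, t)`, and all integrals converge. -/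
structure IsGeneralizedSolution (κ : ℝ) (m u : ℝ → ℝ → ℝ) : Prop where
  measurable_m : Measurable fun p : ℝ × Ioi (0 : ℝ) => m p.1 p.2
  measurable_u : Measurable fun p : ℝ × Ioi (0 : ℝ) => u p.1 p.2
  locallyBounded_m : LocallyBoundedUpperHalf m
  locallyBounded_u : LocallyBoundedUpperHalf u
  monotone_m : ∀ t, 0 < t → Monotone fun x => m x t
  distributional_derivative : ∀ t, 0 < t → ∀ ψ : ℝ → ℝ, ContDiff ℝ ∞ ψ → HasCompactSupport ψ →
    -∫ x, deriv ψ x * m x t = ∫ x, ψ x ∂(stieltjesMeasure fun x => m x t)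
  integrable_mass_left : ∀ φ, IsTestFunction φ →
    IntegrableOn (fun p : ℝ × ℝ => partialT φ p.1 p.2 * m p.1 p.2) (univ ×ˢ Ioi (0 : ℝ))
  integrable_mass_inner : ∀ φ, IsTestFunction φ → ∀ t, 0 < t →
    Integrable (fun x => φ (x, t) * u x t) (stieltjesMeasure fun x => m x t)
  integrable_mass_outer : ∀ φ, IsTestFunction φ →
    IntegrableOn (fun t => ∫ x, φ (x, t) * u x t ∂(stieltjesMeasure fun x => m x t))
      (Ioi (0 : ℝ))
  mass_identity : ∀ φ, IsTestFunction φ →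
    (∫ t in Ioi (0 : ℝ), ∫ x, partialT φ x t * m x t)
      - (∫ t in Ioi (0 : ℝ), ∫ x, φ (x, t) * u x t ∂(stieltjesMeasure fun x => m x t)) = 0
  integrable_momentum_inner : ∀ φ, IsTestFunction φ → ∀ t, 0 < t →
    Integrable (fun x => momentumIntegrand κ u φ x t) (stieltjesMeasure fun x => m x t)
  integrable_momentum_outer : ∀ φ, IsTestFunction φ →
    IntegrableOn
      (fun t => ∫ x, momentumIntegrand κ u φ x t ∂(stieltjesMeasure fun x => m x t))
      (Ioi (0 : ℝ))
  momentum_identity : ∀ φ, IsTestFunction φ →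
    ∫ t in Ioi (0 : ℝ), ∫ x, momentumIntegrand κ u φ x t ∂(stieltjesMeasure fun x => m x t) = 0

/-- The Oleinik-type entropy condition: one-sided limits exist with
`u(x+0, t) ≤ u(x, t) ≤ u(x-0, t)`, and the difference quotients of `u(·, t)` are bounded above. -/
def OleinikEntropy (κ : ℝ) (u : ℝ → ℝ → ℝ) : Prop :=
  ∀ t, 0 < t →
    (∀ x, ∃ ul ur : ℝ,
      Tendsto (fun z => u z t) (𝓝[<] x) (𝓝 ul) ∧ Tendsto (fun z => u z t) (𝓝[>] x) (𝓝 ur) ∧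
      ur ≤ u x t ∧ u x t ≤ ul) ∧
    (∀ x₁ x₂, x₁ ≠ x₂ →
      (u x₂ t - u x₁ t) / (x₂ - x₁)
        ≤ ((t + κ) ^ 2 + κ ^ 2) / ((t + κ) * ((t + κ) ^ 2 - κ ^ 2)))

/-- `x` is a Lebesgue point of `f`. -/
def IsLebesguePoint (f : ℝ → ℝ) (x : ℝ) : Prop :=
  Tendsto (fun r : ℝ => (2 * r)⁻¹ * ∫ y in (x - r)..(x + r), |f y - f x|) (𝓝[>] 0) (𝓝 0)

/-- The initial data are attained as `t → 0+`: `m(x, t) → ∫₀ˣ v₀` for every `x`, and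
`u(x, t) → u₀(x)` at every common Lebesgue point of `u₀` and `v₀`, and for almost every `x`. -/
def AttainsInitialData (v₀ u₀ : ℝ → ℝ) (m u : ℝ → ℝ → ℝ) : Prop :=
  (∀ x, Tendsto (fun t => m x t) (𝓝[>] 0) (𝓝 (∫ η in (0 : ℝ)..x, v₀ η))) ∧
  (∀ x, IsLebesguePoint u₀ x → IsLebesguePoint v₀ x →
    Tendsto (fun t => u x t) (𝓝[>] 0) (𝓝 (u₀ x))) ∧
  (∀ᵐ x, Tendsto (fun t => u x t) (𝓝[>] 0) (𝓝 (u₀ x)))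

end Droplet

/-!
Write `a = posScale κ t` and `b = velScale κ t`. The characteristic issued from the label `η` is
`charPos = a η + b u₀(η)`, so the potential is `F(y, x, t) = a A(y) + b B(y) - x M(y)`, where `A`,
`B` and `M` are the primitives of `η v₀`, `u₀ v₀` and `v₀`. The theorem holds because the minimizers
of `F` describe sticky particles.

*Minimizers.* If `y` and `y'` minimize `F` at `(x, t)` and `(x', t')`, the combination of the two
potentials that eliminates `B` compares `y` with `y'` through an integral of an affine function
against `v₀`, whose slope is positive for `t < t'` because `a / b` decreases strictly
(`minimizers_comparison`). Hence minimizers are bounded locally uniformly up to `t = 0`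
(`exists_abs_minimizer_le`), and later minimizers avoid the gaps between the minimizers of an
earlier point (`not_mem_Ioo_of_mem_minimizers`).

*Particles.* The leftmost minimizer `y_*(·, t)` is nondecreasing and left-continuous; its
generalized inverse `X(η, t)` (`labelPos`) is the position of the particle with label `η`, and `dm`
is the image of `v₀ dη` under `X` (`stieltjesMeasure_mass`). The labels between `y_*` and `y^*` form
a cluster. Since all minimizers give the same value of `F`, averaging `charPos` over a cluster gives
its position, and averaging `charVel` gives `u` by definition: position and velocity are conditional
expectations of the characteristic ones given `X` (`integral_comp_labelPos_charPos`,
`integral_comp_labelPos_charVel`). For almost every label the path satisfies `X' = u(X, t)` from the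
right, with at most one exceptional time (`exists_hasDerivWithinAt_labelPos`): before the collision
it is a characteristic, and afterwards adding the minimality at two times squeezes the difference
quotients between averages that converge to the velocity of the cluster.

*Weak formulation.* Both identities follow by integrating a total derivative along each path and
exchanging the order of integration. For the mass the quantity is `∫_X^∞ φ dx`. For the momentum it
is `φ(X, t) charVel`, where `charVel' = (charPos / (t + κ) - charVel) / (t + κ)`; the conditional
expectations then replace `charPos` and `charVel` by `x` and `u`.

*Entropy.* Both branches of the definition of `u` give the velocity at `(x, t)` of the
characteristic issued from the barycenter `c(x, t)` of the cluster (`velocity_eq_barycenter`). Hence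
`u = (b'/b) x - κ / ((t + κ) b) c` with `c` nondecreasing in `x`, which is the one-sided Lipschitz
bound and gives the one-sided limits.

*Initial data.* Comparing a minimizer `y` at `(x, t)` with `y ± ε b` shows at a common Lebesgue
point that `(x - a y) / b` tends to `u₀(x)` as `t → 0` (`tendsto_velocity`).
-/

namespace Droplet

/-! ### The two scale functions of the characteristic flow -/

/-- The coefficient of `η` in `charPos κ u₀ η t`. -/
noncomputable def posScale (κ t : ℝ) : ℝ := ((t + κ) / κ + κ / (t + κ)) / 2

/-- The coefficient of `u₀ η` in `charPos κ u₀ η t`. -/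
noncomputable def velScale (κ t : ℝ) : ℝ := ((t + κ) - κ ^ 2 / (t + κ)) / 2

/-- The time derivative of `posScale κ`. -/
noncomputable def posRate (κ t : ℝ) : ℝ := (1 / κ - κ / (t + κ) ^ 2) / 2

/-- The time derivative of `velScale κ`. -/
noncomputable def velRate (κ t : ℝ) : ℝ := (1 + κ ^ 2 / (t + κ) ^ 2) / 2

section Scales

variable {κ t t' : ℝ}

theorem charPos_eq (hκ : 0 < κ) (ht : 0 ≤ t) (u₀ : ℝ → ℝ) (η : ℝ) :
    charPos κ u₀ η t = posScale κ t * η + velScale κ t * u₀ η := by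
  have : t + κ ≠ 0 := by positivity
  unfold charPos posScale velScale
  field_simp
  ring

theorem charVel_eq (κ t : ℝ) (u₀ : ℝ → ℝ) (η : ℝ) :
    charVel κ u₀ η t = posRate κ t * η + velRate κ t * u₀ η := by
  unfold charVel posRate velRate
  ring

theorem one_le_posScale (hκ : 0 < κ) (ht : 0 ≤ t) : 1 ≤ posScale κ t := by
  have h1 : 0 < t + κ := by positivity
  have : posScale κ t - 1 = t ^ 2 / (2 * κ * (t + κ)) := by
    unfold posScale; field_simp; ring
  have h2 : 0 ≤ t ^ 2 / (2 * κ * (t + κ)) := by positivity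
  linarith

theorem velScale_eq (hκ : 0 < κ) (ht : 0 ≤ t) :
    velScale κ t = t * (t + 2 * κ) / (2 * (t + κ)) := by
  have h1 : t + κ ≠ 0 := by positivity
  unfold velScale; field_simp; ring

theorem velScale_pos (hκ : 0 < κ) (ht : 0 < t) : 0 < velScale κ t := by
  rw [velScale_eq hκ ht.le]; positivity

theorem posScale_sub_one_le (hκ : 0 < κ) (ht : 0 ≤ t) :
    posScale κ t - 1 ≤ velScale κ t / κ := by
  have h1 : 0 < t + κ := by positivity
  have : velScale κ t / κ - (posScale κ t - 1) = t / (t + κ) := by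
    rw [velScale_eq hκ ht]; unfold posScale; field_simp; ring
  have h2 : 0 ≤ t / (t + κ) := by positivity
  linarith

theorem posScale_zero (hκ : 0 < κ) : posScale κ 0 = 1 := by
  unfold posScale; field_simp; ring

theorem velScale_zero (hκ : 0 < κ) : velScale κ 0 = 0 := by
  rw [velScale_eq hκ le_rfl]; simp

theorem hasDerivAt_posScale (hκ : 0 < κ) (ht : 0 ≤ t) :
    HasDerivAt (posScale κ) (posRate κ t) t := by
  have h1 : t + κ ≠ 0 := by positivity
  have h := (hasDerivAt_id t).add_const κ
  have h2 := ((h.div_const κ).add ((hasDerivAt_const t κ).div h h1)).div_const 2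
  refine h2.congr_deriv ?_
  unfold posRate
  simp only [id]
  ring

theorem hasDerivAt_velScale (hκ : 0 < κ) (ht : 0 ≤ t) :
    HasDerivAt (velScale κ) (velRate κ t) t := by
  have h1 : t + κ ≠ 0 := by positivity
  have h := (hasDerivAt_id t).add_const κ
  have h2 := (h.sub ((hasDerivAt_const t (κ ^ 2)).div h h1)).div_const 2
  refine h2.congr_deriv ?_
  unfold velRate
  simp only [id]
  ring

theorem hasDerivAt_posRate (hκ : 0 < κ) (ht : 0 ≤ t) :
    HasDerivAt (posRate κ) (1 / (t + κ) * (posScale κ t / (t + κ) - posRate κ t)) t := by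
  have h1 : t + κ ≠ 0 := by positivity
  have h := (hasDerivAt_id t).add_const κ
  have h2 := ((hasDerivAt_const t (1 / κ)).sub
    ((hasDerivAt_const t κ).div (h.pow 2) (pow_ne_zero 2 h1))).div_const 2
  refine h2.congr_deriv ?_
  unfold posRate posScale
  simp only [id]
  field_simp
  norm_num
  field_simp
  ring

theorem hasDerivAt_velRate (hκ : 0 < κ) (ht : 0 ≤ t) :
    HasDerivAt (velRate κ) (1 / (t + κ) * (velScale κ t / (t + κ) - velRate κ t)) t := by
  have h1 : t + κ ≠ 0 := by positivity
  have h := (hasDerivAt_id t).add_const κ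
  have h2 := ((hasDerivAt_const t (1 : ℝ)).add
    ((hasDerivAt_const t (κ ^ 2)).div (h.pow 2) (pow_ne_zero 2 h1))).div_const 2
  refine h2.congr_deriv ?_
  unfold velRate velScale
  simp only [id]
  field_simp
  norm_num
  field_simp
  ring

/-- The Wronskian of the two scale functions. -/
theorem posScale_mul_velRate_sub (hκ : 0 < κ) (ht : 0 ≤ t) :
    posScale κ t * velRate κ t - posRate κ t * velScale κ t = κ / (t + κ) := by
  have h1 : t + κ ≠ 0 := by positivity
  unfold posScale velRate posRate velScale
  field_simp
  ring

theorem velScale_mul_posScale_sub (hκ : 0 < κ) (ht : 0 ≤ t) (ht' : 0 ≤ t') :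
    velScale κ t' * posScale κ t - velScale κ t * posScale κ t'
      = κ / 2 * ((t' + κ) / (t + κ) - (t + κ) / (t' + κ)) := by
  have h1 : t + κ ≠ 0 := by positivity
  have h2 : t' + κ ≠ 0 := by positivity
  unfold posScale velScale
  field_simp
  ring

/-- The quotient `posScale / velScale` is strictly decreasing; this is what makes clusters of
minimizers stick together. -/
theorem velScale_mul_posScale_lt (hκ : 0 < κ) (ht : 0 ≤ t) (htt' : t < t') :
    0 < velScale κ t' * posScale κ t - velScale κ t * posScale κ t' := by
  have ht' : 0 ≤ t' := ht.trans htt'.le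
  rw [velScale_mul_posScale_sub hκ ht ht']
  have h1 : 0 < t + κ := by positivity
  have h2 : 0 < t' + κ := by positivity
  have h3 : 1 < (t' + κ) / (t + κ) := by rw [lt_div_iff₀ h1]; linarith
  have h4 : (t + κ) / (t' + κ) < 1 := by rw [div_lt_iff₀ h2]; linarith
  have : 0 < (t' + κ) / (t + κ) - (t + κ) / (t' + κ) := by linarith
  positivity

theorem velScale_mul_posScale_anti (hκ : 0 < κ) {T : ℝ} (ht : 0 ≤ t) (htT : t ≤ T)
    (hT : T ≤ t') :
    velScale κ t' * posScale κ T - velScale κ T * posScale κ t'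
      ≤ velScale κ t' * posScale κ t - velScale κ t * posScale κ t' := by
  have h0T : 0 ≤ T := ht.trans htT
  have ht' : 0 ≤ t' := h0T.trans hT
  rw [velScale_mul_posScale_sub hκ ht ht', velScale_mul_posScale_sub hκ h0T ht']
  have h1 : 0 < t + κ := by positivity
  have h2 : 0 < t' + κ := by positivity
  gcongr

theorem velScale_mono (hκ : 0 < κ) (ht : 0 ≤ t) (h : t ≤ t') : velScale κ t ≤ velScale κ t' := by
  unfold velScale
  have h1 : 0 < t + κ := by positivity
  gcongr

theorem posScale_le (hκ : 0 < κ) (ht : 0 ≤ t) (h : t ≤ t') :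
    posScale κ t ≤ 1 + velScale κ t' / κ := by
  have h1 := posScale_sub_one_le hκ ht
  have h2 := velScale_mono hκ ht h
  have : velScale κ t / κ ≤ velScale κ t' / κ := by gcongr
  linarith

end Scales

/-! ### Initial data and their primitives -/

/-- The standing assumptions on the parameter and on the initial data. -/
structure InitialData (κ : ℝ) (v₀ u₀ : ℝ → ℝ) : Prop where
  kappa_pos : 0 < κ
  measurable_density : Measurable v₀
  measurable_velocity : Measurable u₀
  bounded_density : LocallyBounded v₀
  bounded_velocity : LocallyBounded u₀
  density_pos : ∀ x, 0 < v₀ x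

/-- The primitive `∫₀^y v₀`. -/
noncomputable def cumMass (v₀ : ℝ → ℝ) (y : ℝ) : ℝ := ∫ η in (0 : ℝ)..y, v₀ η

/-- The primitive `∫₀^y f v₀`, used for `f = id` and `f = u₀`. -/
noncomputable def cumWeighted (v₀ f : ℝ → ℝ) (y : ℝ) : ℝ := ∫ η in (0 : ℝ)..y, f η * v₀ η

theorem LocallyBounded.mul {f g : ℝ → ℝ} (hf : LocallyBounded f) (hg : LocallyBounded g) :
    LocallyBounded fun x => f x * g x := by
  intro R
  obtain ⟨C, hC⟩ := hf R
  obtain ⟨D, hD⟩ := hg R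
  refine ⟨C * D, fun x hx => ?_⟩
  rw [abs_mul]
  exact mul_le_mul (hC x hx) (hD x hx) (abs_nonneg _) ((abs_nonneg _).trans (hC x hx))

theorem locallyBounded_of_continuous {f : ℝ → ℝ} (hf : Continuous f) : LocallyBounded f := by
  intro R
  obtain ⟨C, hC⟩ := isCompact_Icc.exists_bound_of_continuousOn (s := Icc (-R) R) hf.continuousOn
  exact ⟨C, fun x hx => hC x hx⟩

theorem LocallyBounded.locallyIntegrable {f : ℝ → ℝ} (hf : LocallyBounded f)
    (hm : Measurable f) : LocallyIntegrable f := by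
  rw [locallyIntegrable_iff]
  intro k hk
  obtain ⟨R, hR⟩ := hk.isBounded.subset_closedBall 0
  rw [Real.closedBall_eq_Icc] at hR
  obtain ⟨C, hC⟩ := hf R
  refine Measure.integrableOn_of_bounded (M := C) hk.measure_lt_top.ne
    hm.aestronglyMeasurable ?_
  filter_upwards [ae_restrict_mem hk.measurableSet] with x hx
  exact hC x (by simpa using hR hx)

theorem LocallyBounded.intervalIntegrable {f : ℝ → ℝ} (hf : LocallyBounded f)
    (hm : Measurable f) (a b : ℝ) : IntervalIntegrable f volume a b :=
  intervalIntegrable_iff.mpr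
    (((hf.locallyIntegrable hm).integrableOn_isCompact isCompact_uIcc).mono_set
      uIoc_subset_uIcc)

namespace InitialData

variable {κ : ℝ} {v₀ u₀ : ℝ → ℝ}

theorem intervalIntegrable_density (h : InitialData κ v₀ u₀) (y z : ℝ) :
    IntervalIntegrable v₀ volume y z :=
  h.bounded_density.intervalIntegrable h.measurable_density y z

theorem intervalIntegrable_weighted (h : InitialData κ v₀ u₀) {f : ℝ → ℝ}
    (hf : LocallyBounded f) (hm : Measurable f) (y z : ℝ) :
    IntervalIntegrable (fun η => f η * v₀ η) volume y z :=
  (hf.mul h.bounded_density).intervalIntegrable (hm.mul h.measurable_density) y z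

theorem intervalIntegrable_moment (h : InitialData κ v₀ u₀) (y z : ℝ) :
    IntervalIntegrable (fun η => id η * v₀ η) volume y z :=
  h.intervalIntegrable_weighted (locallyBounded_of_continuous continuous_id) measurable_id y z

theorem intervalIntegrable_momentum (h : InitialData κ v₀ u₀) (y z : ℝ) :
    IntervalIntegrable (fun η => u₀ η * v₀ η) volume y z :=
  h.intervalIntegrable_weighted h.bounded_velocity h.measurable_velocity y z

theorem integral_density (h : InitialData κ v₀ u₀) (y z : ℝ) :
    ∫ η in y..z, v₀ η = cumMass v₀ z - cumMass v₀ y :=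
  (intervalIntegral.integral_interval_sub_left (h.intervalIntegrable_density 0 z)
    (h.intervalIntegrable_density 0 y)).symm

theorem integral_moment (h : InitialData κ v₀ u₀) (y z : ℝ) :
    ∫ η in y..z, id η * v₀ η = cumWeighted v₀ id z - cumWeighted v₀ id y :=
  (intervalIntegral.integral_interval_sub_left (h.intervalIntegrable_moment 0 z)
    (h.intervalIntegrable_moment 0 y)).symm

theorem integral_momentum (h : InitialData κ v₀ u₀) (y z : ℝ) :
    ∫ η in y..z, u₀ η * v₀ η = cumWeighted v₀ u₀ z - cumWeighted v₀ u₀ y :=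
  (intervalIntegral.integral_interval_sub_left (h.intervalIntegrable_momentum 0 z)
    (h.intervalIntegrable_momentum 0 y)).symm

theorem continuous_cumMass (h : InitialData κ v₀ u₀) : Continuous (cumMass v₀) :=
  intervalIntegral.continuous_primitive h.intervalIntegrable_density 0

theorem continuous_cumMoment (h : InitialData κ v₀ u₀) : Continuous (cumWeighted v₀ id) :=
  intervalIntegral.continuous_primitive h.intervalIntegrable_moment 0

theorem continuous_cumMomentum (h : InitialData κ v₀ u₀) : Continuous (cumWeighted v₀ u₀) :=
  intervalIntegral.continuous_primitive h.intervalIntegrable_momentum 0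

theorem strictMono_cumMass (h : InitialData κ v₀ u₀) : StrictMono (cumMass v₀) := by
  intro y z hyz
  have := intervalIntegral.intervalIntegral_pos_of_pos_on (h.intervalIntegrable_density y z)
    (fun x _ => h.density_pos x) hyz
  rw [h.integral_density] at this
  linarith

theorem cumMass_sub_pos (h : InitialData κ v₀ u₀) {y z : ℝ} (hyz : y < z) :
    0 < cumMass v₀ z - cumMass v₀ y := sub_pos.2 (h.strictMono_cumMass hyz)

theorem mul_lt_cumMoment_sub (h : InitialData κ v₀ u₀) {y z : ℝ} (hyz : y < z) :
    y * (cumMass v₀ z - cumMass v₀ y) < cumWeighted v₀ id z - cumWeighted v₀ id y := by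
  rw [← h.integral_moment, ← h.integral_density, ← intervalIntegral.integral_const_mul, ← sub_pos,
    ← intervalIntegral.integral_sub (h.intervalIntegrable_moment y z)
      ((h.intervalIntegrable_density y z).const_mul y)]
  refine intervalIntegral.intervalIntegral_pos_of_pos_on
    ((h.intervalIntegrable_moment y z).sub ((h.intervalIntegrable_density y z).const_mul y))
    (fun x hx => ?_) hyz
  have := mul_lt_mul_of_pos_right hx.1 (h.density_pos x)
  simp only [id]
  linarith

theorem cumMoment_sub_lt (h : InitialData κ v₀ u₀) {y z : ℝ} (hyz : y < z) :
    cumWeighted v₀ id z - cumWeighted v₀ id y < z * (cumMass v₀ z - cumMass v₀ y) := by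
  rw [← h.integral_moment, ← h.integral_density, ← intervalIntegral.integral_const_mul, ← sub_pos,
    ← intervalIntegral.integral_sub ((h.intervalIntegrable_density y z).const_mul z)
      (h.intervalIntegrable_moment y z)]
  refine intervalIntegral.intervalIntegral_pos_of_pos_on
    (((h.intervalIntegrable_density y z).const_mul z).sub (h.intervalIntegrable_moment y z))
    (fun x hx => ?_) hyz
  have := mul_lt_mul_of_pos_right hx.2 (h.density_pos x)
  simp only [id]
  linarith

theorem abs_cumMomentum_sub_le (h : InitialData κ v₀ u₀) {y z c ε : ℝ} (hyz : y ≤ z)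
    (hC : ∀ η ∈ Icc y z, |u₀ η - c| ≤ ε) :
    |cumWeighted v₀ u₀ z - cumWeighted v₀ u₀ y - c * (cumMass v₀ z - cumMass v₀ y)|
      ≤ ε * (cumMass v₀ z - cumMass v₀ y) := by
  have hu := h.intervalIntegrable_momentum y z
  have hv := h.intervalIntegrable_density y z
  rw [← h.integral_momentum, ← h.integral_density, ← intervalIntegral.integral_const_mul,
    ← intervalIntegral.integral_sub hu (hv.const_mul c), ← intervalIntegral.integral_const_mul,
    abs_le, ← intervalIntegral.integral_neg]
  constructor
  · refine intervalIntegral.integral_mono_on hyz (hv.const_mul ε).neg (hu.sub (hv.const_mul c))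
      fun x hx => ?_
    have := mul_le_mul_of_nonneg_right (neg_le_of_abs_le (hC x hx)) (h.density_pos x).le
    linarith
  · refine intervalIntegral.integral_mono_on hyz (hu.sub (hv.const_mul c)) (hv.const_mul ε)
      fun x hx => ?_
    have := mul_le_mul_of_nonneg_right (le_of_abs_le (hC x hx)) (h.density_pos x).le
    linarith

/-- On a bounded set of labels the momentum increment is controlled by the mass increment. -/
theorem exists_abs_cumMomentum_sub_le (h : InitialData κ v₀ u₀) (K : ℝ) :
    ∃ C, 0 ≤ C ∧ ∀ y z, -K ≤ y → y ≤ z → z ≤ K →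
      |cumWeighted v₀ u₀ z - cumWeighted v₀ u₀ y| ≤ C * (cumMass v₀ z - cumMass v₀ y) := by
  obtain ⟨C, hC⟩ := h.bounded_velocity K
  refine ⟨max C 0, le_max_right _ _, fun y z hy hyz hz => ?_⟩
  have := h.abs_cumMomentum_sub_le (c := 0) (ε := max C 0) hyz fun η hη => by
    rw [sub_zero]
    exact (hC η ⟨hy.trans hη.1, hη.2.trans hz⟩).trans (le_max_left _ _)
  simpa using this

theorem potential_eq (h : InitialData κ v₀ u₀) {t : ℝ} (ht : 0 ≤ t) (y x : ℝ) :
    potential κ v₀ u₀ y x t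
      = posScale κ t * cumWeighted v₀ id y + velScale κ t * cumWeighted v₀ u₀ y
        - x * cumMass v₀ y := by
  have hA := (h.intervalIntegrable_moment 0 y).const_mul (posScale κ t)
  have hB := (h.intervalIntegrable_momentum 0 y).const_mul (velScale κ t)
  have hM := (h.intervalIntegrable_density 0 y).const_mul x
  unfold potential cumWeighted cumMass
  rw [← intervalIntegral.integral_const_mul, ← intervalIntegral.integral_const_mul,
    ← intervalIntegral.integral_const_mul, ← intervalIntegral.integral_add hA hB,
    ← intervalIntegral.integral_sub (hA.add hB) hM]
  refine intervalIntegral.integral_congr fun η _ => ?_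
  simp only [charPos_eq h.kappa_pos ht, id]
  ring

theorem continuous_potential (h : InitialData κ v₀ u₀) {t : ℝ} (ht : 0 ≤ t) :
    Continuous fun p : ℝ × ℝ => potential κ v₀ u₀ p.1 p.2 t := by
  simp only [h.potential_eq ht]
  have := h.continuous_cumMass
  have := h.continuous_cumMoment
  have := h.continuous_cumMomentum
  fun_prop

theorem mem_minimizers (h : InitialData κ v₀ u₀) {t x y : ℝ} (ht : 0 ≤ t) :
    y ∈ minimizers κ v₀ u₀ x t ↔ ∀ z,
      posScale κ t * cumWeighted v₀ id y + velScale κ t * cumWeighted v₀ u₀ y - x * cumMass v₀ y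
      ≤ posScale κ t * cumWeighted v₀ id z + velScale κ t * cumWeighted v₀ u₀ z
        - x * cumMass v₀ z := by
  simp only [minimizers, mem_ofPred_eq, h.potential_eq ht]

/-! ### Comparison of minimizers -/

theorem minimizers_mono (h : InitialData κ v₀ u₀) {t x x' y y' : ℝ} (ht : 0 ≤ t) (hx : x < x')
    (hy : y ∈ minimizers κ v₀ u₀ x t) (hy' : y' ∈ minimizers κ v₀ u₀ x' t) : y ≤ y' := by
  by_contra hlt
  push Not at hlt
  have h1 := (h.mem_minimizers ht).1 hy y'
  have h2 := (h.mem_minimizers ht).1 hy' y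
  have h3 := h.cumMass_sub_pos hlt
  nlinarith

/-- Limits of minimizers are minimizers. -/
theorem mem_minimizers_of_tendsto (h : InitialData κ v₀ u₀) {t x y : ℝ} (ht : 0 ≤ t) {ι : Type*}
    {l : Filter ι} [l.NeBot] {f g : ι → ℝ} (hf : Tendsto f l (𝓝 x)) (hg : Tendsto g l (𝓝 y))
    (hmem : ∀ᶠ i in l, g i ∈ minimizers κ v₀ u₀ (f i) t) : y ∈ minimizers κ v₀ u₀ x t := by
  intro z
  have hc := h.continuous_potential ht
  have h1 : Tendsto (fun i => potential κ v₀ u₀ (g i) (f i) t) l (𝓝 (potential κ v₀ u₀ y x t)) :=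
    (hc.tendsto (y, x)).comp (hg.prodMk_nhds hf)
  have h2 : Tendsto (fun i => potential κ v₀ u₀ z (f i) t) l (𝓝 (potential κ v₀ u₀ z x t)) :=
    (hc.tendsto (z, x)).comp (tendsto_const_nhds.prodMk_nhds hf)
  exact le_of_tendsto_of_tendsto h1 h2 (hmem.mono fun i hi => hi z)

/-- The two-point inequality: adding the minimality of `y` at `(x, t)` to that of `y'` at
`(x', t')`. -/
theorem minimizers_two_point (h : InitialData κ v₀ u₀) {t t' x x' y y' : ℝ}
    (ht : 0 ≤ t) (ht' : 0 ≤ t')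
    (hy : y ∈ minimizers κ v₀ u₀ x t) (hy' : y' ∈ minimizers κ v₀ u₀ x' t') :
    (x' - x) * (cumMass v₀ y - cumMass v₀ y')
      ≤ (posScale κ t' - posScale κ t) * (cumWeighted v₀ id y - cumWeighted v₀ id y')
        + (velScale κ t' - velScale κ t) * (cumWeighted v₀ u₀ y - cumWeighted v₀ u₀ y') := by
  have h1 := (h.mem_minimizers ht).1 hy y'
  have h2 := (h.mem_minimizers ht').1 hy' y
  linarith

/-- Comparison of minimizers at two times: the combination of the two potentials which eliminates
`u₀` is the integral of an affine function against `v₀`, increasing if `t < t'`. -/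
theorem minimizers_comparison (h : InitialData κ v₀ u₀) {t t' x x' y y' : ℝ}
    (ht : 0 ≤ t) (ht' : 0 < t')
    (hy : y ∈ minimizers κ v₀ u₀ x t) (hy' : y' ∈ minimizers κ v₀ u₀ x' t') :
    (velScale κ t' * posScale κ t - velScale κ t * posScale κ t')
        * (cumWeighted v₀ id y - cumWeighted v₀ id y')
      ≤ (velScale κ t' * x - velScale κ t * x') * (cumMass v₀ y - cumMass v₀ y') := by
  have h1 := mul_le_mul_of_nonneg_left ((h.mem_minimizers ht).1 hy y')
    (velScale_pos h.kappa_pos ht').le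
  have hb : 0 ≤ velScale κ t := by
    simpa [velScale_zero h.kappa_pos] using velScale_mono h.kappa_pos le_rfl ht
  have h2 := mul_le_mul_of_nonneg_left ((h.mem_minimizers ht'.le).1 hy' y) hb
  linarith

theorem comparison_of_lt (h : InitialData κ v₀ u₀) {t t' x x' y y' : ℝ} (ht : 0 ≤ t)
    (htt' : t < t') (hy : y ∈ minimizers κ v₀ u₀ x t) (hy' : y' ∈ minimizers κ v₀ u₀ x' t')
    (hlt : y' < y) :
    (velScale κ t' * posScale κ t - velScale κ t * posScale κ t') * y'
      < velScale κ t' * x - velScale κ t * x' := by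
  have h1 := h.minimizers_comparison ht (ht.trans_lt htt') hy hy'
  have h2 := h.cumMass_sub_pos hlt
  have h3 := mul_lt_mul_of_pos_left (h.mul_lt_cumMoment_sub hlt)
    (velScale_mul_posScale_lt h.kappa_pos ht htt')
  refine lt_of_mul_lt_mul_right ?_ h2.le
  linarith

theorem comparison_of_gt (h : InitialData κ v₀ u₀) {t t' x x' y y' : ℝ} (ht : 0 ≤ t)
    (htt' : t < t') (hy : y ∈ minimizers κ v₀ u₀ x t) (hy' : y' ∈ minimizers κ v₀ u₀ x' t')
    (hlt : y < y') :
    velScale κ t' * x - velScale κ t * x'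
      < (velScale κ t' * posScale κ t - velScale κ t * posScale κ t') * y' := by
  have h1 := h.minimizers_comparison ht (ht.trans_lt htt') hy hy'
  have h2 := h.cumMass_sub_pos hlt
  have h3 := mul_lt_mul_of_pos_left (h.cumMoment_sub_lt hlt)
    (velScale_mul_posScale_lt h.kappa_pos ht htt')
  refine lt_of_mul_lt_mul_right ?_ h2.le
  linarith

/-- Stickiness: a minimizer at a later time never lies strictly between two minimizers belonging
to a single point at an earlier time. -/
theorem not_mem_Ioo_of_mem_minimizers (h : InitialData κ v₀ u₀) {t t' x x' y₁ y₂ y' : ℝ}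
    (ht : 0 ≤ t) (htt' : t < t') (h₁ : y₁ ∈ minimizers κ v₀ u₀ x t)
    (h₂ : y₂ ∈ minimizers κ v₀ u₀ x t) (hy' : y' ∈ minimizers κ v₀ u₀ x' t') :
    y' ∉ Ioo y₁ y₂ := fun hmem =>
  lt_asymm (h.comparison_of_lt ht htt' h₂ hy' hmem.2) (h.comparison_of_gt ht htt' h₁ hy' hmem.1)

/-! ### Existence and boundedness of minimizers -/

/-- If `u₀` does not fall below the critical slope `-1/κ`, then `F(·, x, t)` increases
for large labels and decreases for very negative ones, so that it attains its minimum. -/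
theorem minimumAttained (h : InitialData κ v₀ u₀)
    (hlim : ∀ ε > 0, ∀ᶠ y in cocompact ℝ, -(1 / κ) - ε ≤ u₀ y / y) :
    MinimumAttained κ v₀ u₀ := by
  intro x t ht
  have hκ := h.kappa_pos
  have hb := velScale_pos hκ ht
  have hs : 0 < t + κ := by positivity
  -- `posScale - velScale / κ = κ / (t + κ)`, half of which is left as a margin
  set ε := κ / (t + κ) / (2 * velScale κ t) with hε
  have hεpos : 0 < ε := by positivity
  have hmargin : posScale κ t + velScale κ t * (-(1 / κ) - ε) = κ / (t + κ) / 2 := by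
    have : velScale κ t * ε = κ / (t + κ) / 2 := by rw [hε]; field_simp
    rw [mul_sub, this]
    unfold posScale velScale
    field_simp
    ring
  have hc : 0 < κ / (t + κ) / 2 := by positivity
  have hev := hlim ε hεpos
  rw [cocompact_eq_atBot_atTop, eventually_sup] at hev
  obtain ⟨Y₁, hY₁⟩ := eventually_atBot.1 hev.1
  obtain ⟨Y₂, hY₂⟩ := eventually_atTop.1 hev.2
  set c := κ / (t + κ) / 2
  have hge : ∀ η, max (max Y₂ 1) (|x| / c) ≤ η → 0 ≤ charPos κ u₀ η t - x := by
    intro η hη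
    simp only [max_le_iff] at hη
    have h1 := hY₂ η hη.1.1
    have hη0 : 0 < η := by linarith [hη.1.2]
    rw [le_div_iff₀ hη0] at h1
    have h2 := mul_le_mul_of_nonneg_left h1 hb.le
    have h3 := (div_le_iff₀ hc).1 hη.2
    rw [charPos_eq hκ ht.le]
    have h4 : (posScale κ t + velScale κ t * (-(1 / κ) - ε)) * η = c * η := by rw [hmargin]
    have := le_abs_self x
    nlinarith
  have hle : ∀ η, η ≤ min (min Y₁ (-1)) (-(|x| / c)) → charPos κ u₀ η t - x ≤ 0 := by
    intro η hη
    simp only [le_min_iff] at hη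
    have h1 := hY₁ η hη.1.1
    have hη0 : η < 0 := by linarith [hη.1.2]
    rw [le_div_iff_of_neg hη0] at h1
    have h2 := mul_le_mul_of_nonneg_left h1 hb.le
    have h3 := (div_le_iff₀ hc).1 (le_neg.1 hη.2)
    rw [charPos_eq hκ ht.le]
    have h4 : (posScale κ t + velScale κ t * (-(1 / κ) - ε)) * η = c * η := by rw [hmargin]
    have := neg_abs_le x
    nlinarith
  set Y := max (max Y₂ 1) (|x| / c)
  set Z := min (min Y₁ (-1)) (-(|x| / c))
  have hZY : Z ≤ Y :=
    (show Z ≤ -1 from (min_le_left _ _).trans (min_le_right _ _)).trans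
      ((by norm_num : (-1 : ℝ) ≤ 1).trans ((le_max_right _ _).trans (le_max_left _ _)))
  have hcont : Continuous fun y => potential κ v₀ u₀ y x t :=
    (h.continuous_potential ht.le).comp (continuous_id.prodMk continuous_const)
  obtain ⟨y, -, hy⟩ := isCompact_Icc.exists_isMinOn (nonempty_Icc.2 hZY) hcont.continuousOn
  have hint : ∀ p q, IntervalIntegrable (fun η => (charPos κ u₀ η t - x) * v₀ η) volume p q := by
    intro p q
    have := (((h.intervalIntegrable_moment p q).const_mul (posScale κ t)).add
      ((h.intervalIntegrable_momentum p q).const_mul (velScale κ t))).sub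
      ((h.intervalIntegrable_density p q).const_mul x)
    refine this.congr fun η _ => ?_
    simp only [charPos_eq hκ ht.le, id]
    ring
  refine ⟨y, fun z => ?_⟩
  rcases lt_or_ge z Z with hz | hz
  · refine (hy (left_mem_Icc.2 hZY)).trans ?_
    have h1 := intervalIntegral.integral_interval_sub_left (hint 0 Z) (hint 0 z)
    have h2 : ∫ η in z..Z, (charPos κ u₀ η t - x) * v₀ η ≤ 0 := by
      rw [intervalIntegral.integral_of_le hz.le]
      refine setIntegral_nonpos measurableSet_Ioc fun η hη => ?_
      exact mul_nonpos_of_nonpos_of_nonneg (hle η hη.2) (h.density_pos η).le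
    simp only [potential]
    linarith
  rcases le_or_gt z Y with hz' | hz'
  · exact hy ⟨hz, hz'⟩
  · refine (hy (right_mem_Icc.2 hZY)).trans ?_
    have h1 := intervalIntegral.integral_interval_sub_left (hint 0 z) (hint 0 Y)
    have h2 : 0 ≤ ∫ η in Y..z, (charPos κ u₀ η t - x) * v₀ η := by
      refine intervalIntegral.integral_nonneg hz'.le fun η hη => ?_
      exact mul_nonneg (hge η hη.1) (h.density_pos η).le
    simp only [potential]
    linarith

/-- Minimizers `≥ -Y` exceed `K` once `x` is large, uniformly in `t ≤ T`: otherwise the label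
`K + 1` would give a smaller value. -/
theorem lt_minimizer_of_large (h : InitialData κ v₀ u₀) (T K Y : ℝ) :
    ∃ R, ∀ t, 0 < t → t ≤ T → ∀ x, R ≤ x → ∀ y ∈ minimizers κ v₀ u₀ x t, -Y ≤ y → K < y := by
  have hκ := h.kappa_pos
  obtain ⟨C, hC0, hC⟩ := h.exists_abs_cumMomentum_sub_le (max Y (|K| + 1))
  refine ⟨(1 + velScale κ T / κ) * (|K| + 1) + velScale κ T * C, fun t ht htT x hx y hy hyY => ?_⟩
  by_contra hyK
  push Not at hyK
  have hlt : y < K + 1 := by linarith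
  have h1 := (h.mem_minimizers ht.le).1 hy (K + 1)
  have hM := h.cumMass_sub_pos hlt
  have hA := h.cumMoment_sub_lt hlt
  have hB := hC y (K + 1) (by linarith [le_max_left Y (|K| + 1)]) hlt.le
    (by linarith [le_max_right Y (|K| + 1), le_abs_self K])
  have ha := one_le_posScale hκ ht.le
  have ha' := posScale_le hκ ht.le htT
  have hb := velScale_pos hκ ht
  have hb' := velScale_mono hκ ht.le htT
  have hB' := mul_le_mul_of_nonneg_left (le_of_abs_le hB) hb.le
  have hA' := mul_lt_mul_of_pos_left hA (by linarith : 0 < posScale κ t)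
  have h2 : posScale κ t * (K + 1) ≤ (1 + velScale κ T / κ) * (|K| + 1) :=
    (mul_le_mul_of_nonneg_left (by linarith [le_abs_self K] : K + 1 ≤ |K| + 1)
      (by linarith : 0 ≤ posScale κ t)).trans (mul_le_mul_of_nonneg_right ha' (by positivity))
  have h3 : velScale κ t * C ≤ velScale κ T * C := mul_le_mul_of_nonneg_right hb' hC0
  have h4 := mul_le_mul_of_nonneg_right (show posScale κ t * (K + 1) + velScale κ t * C ≤ x by
    linarith) hM.le
  linarith

theorem minimizer_lt_of_small (h : InitialData κ v₀ u₀) (T K Y : ℝ) :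
    ∃ R, ∀ t, 0 < t → t ≤ T → ∀ x, x ≤ -R → ∀ y ∈ minimizers κ v₀ u₀ x t, y ≤ Y → y < -K := by
  have hκ := h.kappa_pos
  obtain ⟨C, hC0, hC⟩ := h.exists_abs_cumMomentum_sub_le (max Y (|K| + 1))
  refine ⟨(1 + velScale κ T / κ) * (|K| + 1) + velScale κ T * C, fun t ht htT x hx y hy hyY => ?_⟩
  by_contra hyK
  push Not at hyK
  have hlt : -K - 1 < y := by linarith
  have h1 := (h.mem_minimizers ht.le).1 hy (-K - 1)
  have hM := h.cumMass_sub_pos hlt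
  have hA := h.mul_lt_cumMoment_sub hlt
  have hB := hC (-K - 1) y (by linarith [le_max_right Y (|K| + 1), le_abs_self K]) hlt.le
    (by linarith [le_max_left Y (|K| + 1)])
  have ha := one_le_posScale hκ ht.le
  have ha' := posScale_le hκ ht.le htT
  have hb := velScale_pos hκ ht
  have hb' := velScale_mono hκ ht.le htT
  have hB' := mul_le_mul_of_nonneg_left (neg_le_of_abs_le hB) hb.le
  have hA' := mul_lt_mul_of_pos_left hA (by linarith : 0 < posScale κ t)
  have h2 : posScale κ t * (K + 1) ≤ (1 + velScale κ T / κ) * (|K| + 1) :=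
    (mul_le_mul_of_nonneg_left (by linarith [le_abs_self K] : K + 1 ≤ |K| + 1)
      (by linarith : 0 ≤ posScale κ t)).trans (mul_le_mul_of_nonneg_right ha' (by positivity))
  have h3 : velScale κ t * C ≤ velScale κ T * C := mul_le_mul_of_nonneg_right hb' hC0
  have h4 := mul_le_mul_of_nonneg_right (show posScale κ t * (K + 1) + velScale κ t * C ≤ -x by
    linarith) hM.le
  linarith

/-- Minimizers are bounded, locally uniformly in `(x, t)` and up to `t = 0`: they are compared
with minimizers at the single later time `T + 1`. -/
theorem exists_abs_minimizer_le (h : InitialData κ v₀ u₀) (hA : MinimumAttained κ v₀ u₀)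
    (T R : ℝ) : ∃ K, ∀ t, 0 < t → t ≤ T → ∀ x, |x| ≤ R → ∀ y ∈ minimizers κ v₀ u₀ x t,
      |y| ≤ K := by
  rcases le_or_gt T 0 with hT | hT
  · exact ⟨0, fun t ht htT => absurd (ht.trans_le (htT.trans hT)) (lt_irrefl _)⟩
  have hκ := h.kappa_pos
  have hT1 : 0 < T + 1 := by linarith
  have hD0 := velScale_mul_posScale_lt hκ hT.le (lt_add_one T)
  have hb1 := velScale_pos hκ hT1
  set D₀ := velScale κ (T + 1) * posScale κ T - velScale κ T * posScale κ (T + 1) with hD₀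
  set c := velScale κ (T + 1) * |R| / D₀ with hc
  have hc0 : 0 ≤ c := by positivity
  have hcD : D₀ * c = velScale κ (T + 1) * |R| := by rw [hc]; field_simp
  obtain ⟨y₀, hy₀⟩ := hA 0 (T + 1) hT1
  obtain ⟨R₁, hR₁⟩ := h.lt_minimizer_of_large (T + 1) c (-y₀)
  obtain ⟨R₂, hR₂⟩ := h.minimizer_lt_of_small (T + 1) c y₀
  obtain ⟨y₁, hy₁⟩ := hA (max R₁ 1) (T + 1) hT1
  obtain ⟨y₂, hy₂⟩ := hA (-max R₂ 1) (T + 1) hT1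
  have hm₁ : 0 < max R₁ 1 := lt_max_of_lt_right one_pos
  have hm₂ : 0 < max R₂ 1 := lt_max_of_lt_right one_pos
  have hcy₁ : c < y₁ := hR₁ _ hT1 le_rfl _ (le_max_left _ _) _ hy₁
    (by rw [neg_neg]; exact h.minimizers_mono hT1.le hm₁ hy₀ hy₁)
  have hcy₂ : y₂ < -c := hR₂ _ hT1 le_rfl _ (neg_le_neg (le_max_left _ _)) _ hy₂
    (h.minimizers_mono hT1.le (neg_lt_zero.2 hm₂) hy₂ hy₀)
  refine ⟨max |y₁| |y₂|, fun t ht htT x hx y hy => ?_⟩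
  have htT1 : t < T + 1 := by linarith
  have hD := velScale_mul_posScale_anti hκ ht.le htT (by linarith : T ≤ T + 1)
  rw [← hD₀] at hD
  have hb := velScale_pos hκ ht
  have hxR : |x| ≤ |R| := hx.trans (le_abs_self R)
  have hle : y ≤ y₁ := by
    by_contra hlt
    push Not at hlt
    have h1 := h.comparison_of_lt ht.le htT1 hy hy₁ hlt
    have h2 := mul_le_mul hD hcy₁.le hc0 (hD0.le.trans hD)
    have h3 := mul_le_mul_of_nonneg_left ((le_abs_self x).trans hxR) hb1.le
    have h4 := mul_pos hb hm₁
    linarith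
  have hge : y₂ ≤ y := by
    by_contra hlt
    push Not at hlt
    have h1 := h.comparison_of_gt ht.le htT1 hy hy₂ hlt
    have h2 := mul_le_mul hD (le_neg.1 hcy₂.le) hc0 (hD0.le.trans hD)
    have h3 := mul_le_mul_of_nonneg_left (neg_le.1 (neg_le_of_abs_le hxR)) hb1.le
    have h4 := mul_pos hb hm₂
    linarith
  exact abs_le_max_abs_abs hge hle |>.trans (by rw [max_comm])

theorem exists_lt_minimizer (h : InitialData κ v₀ u₀) (hA : MinimumAttained κ v₀ u₀) (T K : ℝ) :
    ∃ R, 0 < R ∧ ∀ t, 0 < t → t ≤ T →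
      (∀ x, R ≤ x → ∀ y ∈ minimizers κ v₀ u₀ x t, K < y) ∧
      ∀ x, x ≤ -R → ∀ y ∈ minimizers κ v₀ u₀ x t, y < -K := by
  obtain ⟨Y, hY⟩ := h.exists_abs_minimizer_le hA T 0
  obtain ⟨R₁, hR₁⟩ := h.lt_minimizer_of_large T K Y
  obtain ⟨R₂, hR₂⟩ := h.minimizer_lt_of_small T K Y
  refine ⟨max (max R₁ R₂) 1, lt_max_of_lt_right one_pos, fun t ht htT => ?_⟩
  obtain ⟨y₀, hy₀⟩ := hA 0 t ht
  have hy₀Y := abs_le.1 (hY t ht htT 0 (by simp) y₀ hy₀)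
  have hone := le_max_right (max R₁ R₂) 1
  have hle₁ : R₁ ≤ max (max R₁ R₂) 1 := (le_max_left _ _).trans (le_max_left _ _)
  have hle₂ : R₂ ≤ max (max R₁ R₂) 1 := (le_max_right _ _).trans (le_max_left _ _)
  refine ⟨fun x hx y hy => hR₁ t ht htT x (hle₁.trans hx) y hy ?_,
    fun x hx y hy => hR₂ t ht htT x (hx.trans (neg_le_neg hle₂)) y hy ?_⟩
  · exact hy₀Y.1.trans (h.minimizers_mono ht.le (by linarith) hy₀ hy)
  · exact (h.minimizers_mono ht.le (by linarith) hy hy₀).trans hy₀Y.2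

/-! ### The leftmost and the rightmost minimizer -/

theorem isCompact_minimizers (h : InitialData κ v₀ u₀) (hA : MinimumAttained κ v₀ u₀) {t : ℝ}
    (ht : 0 < t) (x : ℝ) : IsCompact (minimizers κ v₀ u₀ x t) := by
  obtain ⟨K, hK⟩ := h.exists_abs_minimizer_le hA t |x|
  refine (isCompact_Icc (a := -K) (b := K)).of_isClosed_subset ?_
    fun y hy => abs_le.1 (hK t ht le_rfl x le_rfl y hy)
  rw [← isSeqClosed_iff_isClosed]
  intro s y hs hlim
  exact h.mem_minimizers_of_tendsto ht.le tendsto_const_nhds hlim (Eventually.of_forall hs)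

theorem isLeast_yLeft (h : InitialData κ v₀ u₀) (hA : MinimumAttained κ v₀ u₀) {t : ℝ}
    (ht : 0 < t) (x : ℝ) : IsLeast (minimizers κ v₀ u₀ x t) (yLeft κ v₀ u₀ x t) :=
  (h.isCompact_minimizers hA ht x).isLeast_sInf (hA x t ht)

theorem isGreatest_yRight (h : InitialData κ v₀ u₀) (hA : MinimumAttained κ v₀ u₀) {t : ℝ}
    (ht : 0 < t) (x : ℝ) : IsGreatest (minimizers κ v₀ u₀ x t) (yRight κ v₀ u₀ x t) :=
  (h.isCompact_minimizers hA ht x).isGreatest_sSup (hA x t ht)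

theorem yLeft_le_yRight (h : InitialData κ v₀ u₀) (hA : MinimumAttained κ v₀ u₀) {t : ℝ}
    (ht : 0 < t) (x : ℝ) : yLeft κ v₀ u₀ x t ≤ yRight κ v₀ u₀ x t :=
  (h.isLeast_yLeft hA ht x).2 (h.isGreatest_yRight hA ht x).1

theorem yRight_le_yLeft (h : InitialData κ v₀ u₀) (hA : MinimumAttained κ v₀ u₀) {t x x' : ℝ}
    (ht : 0 < t) (hx : x < x') : yRight κ v₀ u₀ x t ≤ yLeft κ v₀ u₀ x' t :=
  h.minimizers_mono ht.le hx (h.isGreatest_yRight hA ht x).1 (h.isLeast_yLeft hA ht x').1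

theorem monotone_yLeft (h : InitialData κ v₀ u₀) (hA : MinimumAttained κ v₀ u₀) {t : ℝ}
    (ht : 0 < t) : Monotone fun x => yLeft κ v₀ u₀ x t := by
  intro x x' hx
  rcases hx.eq_or_lt with rfl | hx
  · exact le_rfl
  · exact (h.yLeft_le_yRight hA ht x).trans (h.yRight_le_yLeft hA ht hx)

theorem tendsto_yLeft_left (h : InitialData κ v₀ u₀) (hA : MinimumAttained κ v₀ u₀) {t : ℝ}
    (ht : 0 < t) (x : ℝ) :
    Tendsto (fun z => yLeft κ v₀ u₀ z t) (𝓝[<] x) (𝓝 (yLeft κ v₀ u₀ x t)) := by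
  have hm := h.monotone_yLeft hA ht
  have hlim := hm.tendsto_leftLim x
  have hmem : Function.leftLim (fun z => yLeft κ v₀ u₀ z t) x ∈ minimizers κ v₀ u₀ x t :=
    h.mem_minimizers_of_tendsto ht.le (tendsto_id.mono_left nhdsWithin_le_nhds) hlim
      (Eventually.of_forall fun z => (h.isLeast_yLeft hA ht z).1)
  have := le_antisymm (hm.leftLim_le le_rfl) ((h.isLeast_yLeft hA ht x).2 hmem)
  rwa [this] at hlim

theorem tendsto_yLeft_right (h : InitialData κ v₀ u₀) (hA : MinimumAttained κ v₀ u₀) {t : ℝ}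
    (ht : 0 < t) (x : ℝ) :
    Tendsto (fun z => yLeft κ v₀ u₀ z t) (𝓝[>] x) (𝓝 (yRight κ v₀ u₀ x t)) := by
  have hm := h.monotone_yLeft hA ht
  have hlim := hm.tendsto_rightLim x
  have hmem : Function.rightLim (fun z => yLeft κ v₀ u₀ z t) x ∈ minimizers κ v₀ u₀ x t :=
    h.mem_minimizers_of_tendsto ht.le (tendsto_id.mono_left nhdsWithin_le_nhds) hlim
      (Eventually.of_forall fun z => (h.isLeast_yLeft hA ht z).1)
  have hge : yRight κ v₀ u₀ x t ≤ Function.rightLim (fun z => yLeft κ v₀ u₀ z t) x := by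
    refine ge_of_tendsto hlim ?_
    filter_upwards [self_mem_nhdsWithin] with z hz using h.yRight_le_yLeft hA ht hz
  have := le_antisymm ((h.isGreatest_yRight hA ht x).2 hmem) hge
  rwa [this] at hlim

theorem tendsto_yRight_right (h : InitialData κ v₀ u₀) (hA : MinimumAttained κ v₀ u₀) {t : ℝ}
    (ht : 0 < t) (x : ℝ) :
    Tendsto (fun z => yRight κ v₀ u₀ z t) (𝓝[>] x) (𝓝 (yRight κ v₀ u₀ x t)) := by
  rw [tendsto_order]
  refine ⟨fun c hc => ?_, fun c hc => ?_⟩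
  · filter_upwards [self_mem_nhdsWithin] with z hz
    exact hc.trans_le ((h.yRight_le_yLeft hA ht hz).trans (h.yLeft_le_yRight hA ht z))
  · obtain ⟨z, hzc, hz⟩ := (((h.tendsto_yLeft_right hA ht x).eventually_lt_const hc).and
      self_mem_nhdsWithin).exists
    filter_upwards [Ioo_mem_nhdsGT hz] with w hw
    exact (h.yRight_le_yLeft hA ht hw.2).trans_lt hzc

end InitialData

/-! ### The sticky particle flow -/

/-- The position at time `t` of the particle with label `η`: the generalized inverse of the
nondecreasing, left-continuous function `yLeft κ v₀ u₀ · t`. -/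
noncomputable def labelPos (κ : ℝ) (v₀ u₀ : ℝ → ℝ) (η t : ℝ) : ℝ :=
  sSup {x | yLeft κ v₀ u₀ x t ≤ η}

namespace InitialData

variable {κ : ℝ} {v₀ u₀ : ℝ → ℝ}

theorem le_labelPos_iff (h : InitialData κ v₀ u₀) (hA : MinimumAttained κ v₀ u₀) {t : ℝ}
    (ht : 0 < t) {x η : ℝ} : x ≤ labelPos κ v₀ u₀ η t ↔ yLeft κ v₀ u₀ x t ≤ η := by
  have hm := h.monotone_yLeft hA ht
  obtain ⟨R, -, hR⟩ := h.exists_lt_minimizer hA t |η|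
  have hne : {x | yLeft κ v₀ u₀ x t ≤ η}.Nonempty :=
    ⟨-R, ((hR t ht le_rfl).2 (-R) le_rfl _ (h.isLeast_yLeft hA ht _).1).le.trans (neg_abs_le η)⟩
  have hbdd : BddAbove {x | yLeft κ v₀ u₀ x t ≤ η} := by
    refine ⟨R, fun z hz => ?_⟩
    by_contra hlt
    push Not at hlt
    have h1 := (hR t ht le_rfl).1 z hlt.le _ (h.isLeast_yLeft hA ht _).1
    exact absurd (hz : yLeft κ v₀ u₀ z t ≤ η) (not_le.2 ((le_abs_self η).trans_lt h1))
  refine ⟨fun hx => ?_, fun hx => le_csSup hbdd hx⟩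
  refine (hm hx).trans (le_of_tendsto (h.tendsto_yLeft_left hA ht _) ?_)
  filter_upwards [self_mem_nhdsWithin] with z hz
  obtain ⟨w, hw, hzw⟩ := exists_lt_of_lt_csSup hne hz
  exact (hm hzw.le).trans hw

theorem labelPos_lt_iff (h : InitialData κ v₀ u₀) (hA : MinimumAttained κ v₀ u₀) {t : ℝ}
    (ht : 0 < t) {x η : ℝ} : labelPos κ v₀ u₀ η t < x ↔ η < yLeft κ v₀ u₀ x t := by
  rw [← not_le, h.le_labelPos_iff hA ht, not_le]

theorem monotone_labelPos (h : InitialData κ v₀ u₀) (hA : MinimumAttained κ v₀ u₀) {t : ℝ}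
    (ht : 0 < t) : Monotone fun η => labelPos κ v₀ u₀ η t := fun _ _ hη =>
  (h.le_labelPos_iff hA ht).2 (((h.le_labelPos_iff hA ht).1 le_rfl).trans hη)

theorem yLeft_labelPos_le (h : InitialData κ v₀ u₀) (hA : MinimumAttained κ v₀ u₀) {t : ℝ}
    (ht : 0 < t) (η : ℝ) : yLeft κ v₀ u₀ (labelPos κ v₀ u₀ η t) t ≤ η :=
  (h.le_labelPos_iff hA ht).1 le_rfl

theorem le_yRight_labelPos (h : InitialData κ v₀ u₀) (hA : MinimumAttained κ v₀ u₀) {t : ℝ}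
    (ht : 0 < t) (η : ℝ) : η ≤ yRight κ v₀ u₀ (labelPos κ v₀ u₀ η t) t := by
  refine ge_of_tendsto (h.tendsto_yLeft_right hA ht _) ?_
  filter_upwards [self_mem_nhdsWithin] with z hz
  exact ((h.labelPos_lt_iff hA ht).1 hz).le

theorem labelPos_eq_of_mem_Ico (h : InitialData κ v₀ u₀) (hA : MinimumAttained κ v₀ u₀) {t : ℝ}
    (ht : 0 < t) {x η : ℝ} (hη : η ∈ Ico (yLeft κ v₀ u₀ x t) (yRight κ v₀ u₀ x t)) :
    labelPos κ v₀ u₀ η t = x := by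
  refine le_antisymm (le_of_forall_gt fun z hz => ?_) ((h.le_labelPos_iff hA ht).2 hη.1)
  exact (h.labelPos_lt_iff hA ht).2 (hη.2.trans_le (h.yRight_le_yLeft hA ht hz))

theorem exists_abs_labelPos_le (h : InitialData κ v₀ u₀) (hA : MinimumAttained κ v₀ u₀)
    (T K : ℝ) : ∃ R, ∀ t, 0 < t → t ≤ T → ∀ η, |η| ≤ K → |labelPos κ v₀ u₀ η t| ≤ R := by
  obtain ⟨R, -, hR⟩ := h.exists_lt_minimizer hA T K
  refine ⟨R, fun t ht htT η hη => abs_le.2 ⟨?_, ?_⟩⟩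
  · rw [h.le_labelPos_iff hA ht]
    exact ((hR t ht htT).2 _ le_rfl _ (h.isLeast_yLeft hA ht _).1).le.trans (neg_le_of_abs_le hη)
  · refine ((h.labelPos_lt_iff hA ht).2 ?_).le
    exact (le_of_abs_le hη).trans_lt ((hR t ht htT).1 _ le_rfl _ (h.isLeast_yLeft hA ht _).1)

/-- Particles found in a bounded set have labels in a bounded set. -/
theorem exists_abs_label_le (h : InitialData κ v₀ u₀) (hA : MinimumAttained κ v₀ u₀)
    (T R : ℝ) : ∃ K, 0 < K ∧ ∀ t, 0 < t → t ≤ T →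
      (∀ x, |x| ≤ R → ∀ y ∈ minimizers κ v₀ u₀ x t, |y| ≤ K) ∧
      ∀ η, |labelPos κ v₀ u₀ η t| ≤ R → |η| ≤ K := by
  obtain ⟨K, hK⟩ := h.exists_abs_minimizer_le hA T R
  refine ⟨max K 1, lt_max_of_lt_right one_pos, fun t ht htT =>
    ⟨fun x hx y hy => (hK t ht htT x hx y hy).trans (le_max_left _ _), fun η hη => ?_⟩⟩
  have h1 := hK t ht htT _ hη _ (h.isLeast_yLeft hA ht _).1
  have h2 := hK t ht htT _ hη _ (h.isGreatest_yRight hA ht _).1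
  refine (abs_le.2 ⟨?_, ?_⟩).trans (le_max_left K 1)
  · exact (neg_le_of_abs_le h1).trans (h.yLeft_labelPos_le hA ht η)
  · exact (h.le_yRight_labelPos hA ht η).trans (le_of_abs_le h2)

/-- A modulus of continuity in time for the particle paths, uniform for bounded labels. -/
theorem exists_abs_labelPos_sub_le (h : InitialData κ v₀ u₀) (hA : MinimumAttained κ v₀ u₀)
    (T K : ℝ) : ∃ C, ∀ t t', 0 < t → t ≤ T → 0 < t' → t' ≤ T → ∀ η, |η| ≤ K →
      |labelPos κ v₀ u₀ η t' - labelPos κ v₀ u₀ η t|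
        ≤ C * (|posScale κ t' - posScale κ t| + |velScale κ t' - velScale κ t|) := by
  obtain ⟨R, hR⟩ := h.exists_abs_labelPos_le hA T (K + 1)
  obtain ⟨L, hL0, hL⟩ := h.exists_abs_label_le hA T R
  obtain ⟨C, hC0, hC⟩ := h.exists_abs_cumMomentum_sub_le L
  -- compare the label `η` at time `t'` with the label `η + δ` at time `t`
  have key : ∀ t t', 0 < t → t ≤ T → 0 < t' → t' ≤ T → ∀ η, |η| ≤ K →
      labelPos κ v₀ u₀ η t' ≤ labelPos κ v₀ u₀ η t
        + (L + C) * (|posScale κ t' - posScale κ t| + |velScale κ t' - velScale κ t|) := by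
    intro t t' ht htT ht' htT' η hη
    set w := (L + C) * (|posScale κ t' - posScale κ t| + |velScale κ t' - velScale κ t|)
    have step : ∀ δ ∈ Ioo (0 : ℝ) 1,
        labelPos κ v₀ u₀ η t' - w ≤ labelPos κ v₀ u₀ (η + δ) t := by
      intro δ hδ
      have hηδ : |η + δ| ≤ K + 1 := (abs_add_le _ _).trans
        (add_le_add hη (by rw [abs_of_pos hδ.1]; exact hδ.2.le))
      have hy := (h.isGreatest_yRight hA ht (labelPos κ v₀ u₀ (η + δ) t)).1
      have hy' := (h.isLeast_yLeft hA ht' (labelPos κ v₀ u₀ η t')).1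
      have hle := h.le_yRight_labelPos hA ht (η + δ)
      have hle' := h.yLeft_labelPos_le hA ht' η
      have hyL := abs_le.1 ((hL t ht htT).1 _ (hR t ht htT _ hηδ) _ hy)
      have hyL' := abs_le.1 ((hL t' ht' htT').1 _ (hR t' ht' htT' _ (by linarith)) _ hy')
      have htp := h.minimizers_two_point ht.le ht'.le hy hy'
      set y := yRight κ v₀ u₀ (labelPos κ v₀ u₀ (η + δ) t) t
      set y' := yLeft κ v₀ u₀ (labelPos κ v₀ u₀ η t') t'
      have hlt : y' < y := by linarith [hδ.1]
      have hM := h.cumMass_sub_pos hlt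
      have hA₁ := h.mul_lt_cumMoment_sub hlt
      have hA₂ := h.cumMoment_sub_lt hlt
      have hAabs : |cumWeighted v₀ id y - cumWeighted v₀ id y'|
          ≤ L * (cumMass v₀ y - cumMass v₀ y') := by
        rw [abs_le]
        constructor
        · have := mul_le_mul_of_nonneg_right hyL'.1 hM.le
          linarith
        · have := mul_le_mul_of_nonneg_right hyL.2 hM.le
          linarith
      have hBabs := hC y' y hyL'.1 hlt.le hyL.2
      have h1 := (le_abs_self _).trans ((abs_mul _ _).le.trans
        (mul_le_mul_of_nonneg_left hAabs (abs_nonneg (posScale κ t' - posScale κ t))))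
      have h2 := (le_abs_self _).trans ((abs_mul _ _).le.trans
        (mul_le_mul_of_nonneg_left hBabs (abs_nonneg (velScale κ t' - velScale κ t))))
      have h3 : 0 ≤ |posScale κ t' - posScale κ t| := abs_nonneg _
      have h4 : 0 ≤ |velScale κ t' - velScale κ t| := abs_nonneg _
      have h5 : 0 ≤ C * |posScale κ t' - posScale κ t| := by positivity
      have h6 : 0 ≤ L * |velScale κ t' - velScale κ t| := by positivity
      have h7 : labelPos κ v₀ u₀ η t' - labelPos κ v₀ u₀ (η + δ) t
          ≤ |posScale κ t' - posScale κ t| * L + |velScale κ t' - velScale κ t| * C := by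
        refine le_of_mul_le_mul_right ?_ hM
        linarith
      have h8 : w = |posScale κ t' - posScale κ t| * L + |velScale κ t' - velScale κ t| * C
          + C * |posScale κ t' - posScale κ t| + L * |velScale κ t' - velScale κ t| := by ring
      linarith
    have : labelPos κ v₀ u₀ η t' - w ≤ labelPos κ v₀ u₀ η t := by
      rw [h.le_labelPos_iff hA ht]
      refine le_of_forall_pos_lt_add fun δ hδ => ?_
      have hm : min (δ / 2) (1 / 2) ∈ Ioo (0 : ℝ) 1 :=
        ⟨by positivity, (min_le_right _ _).trans_lt (by norm_num)⟩
      have := (h.le_labelPos_iff hA ht).1 (step _ hm)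
      have := min_le_left (δ / 2) (1 / 2)
      linarith
    linarith
  refine ⟨L + C, fun t t' ht htT ht' htT' η hη => abs_le.2 ⟨?_, ?_⟩⟩
  · have := key t' t ht' htT' ht htT η hη
    rw [abs_sub_comm (posScale κ t), abs_sub_comm (velScale κ t)] at this
    linarith
  · have := key t t' ht htT ht' htT' η hη
    linarith

theorem continuousAt_labelPos (h : InitialData κ v₀ u₀) (hA : MinimumAttained κ v₀ u₀) {t : ℝ}
    (ht : 0 < t) (η : ℝ) : ContinuousAt (fun s => labelPos κ v₀ u₀ η s) t := by
  obtain ⟨C, hC⟩ := h.exists_abs_labelPos_sub_le hA (t + 1) |η|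
  have ha := (hasDerivAt_posScale h.kappa_pos ht.le).continuousAt
  have hb := (hasDerivAt_velScale h.kappa_pos ht.le).continuousAt
  have hw : Tendsto (fun s => C * (|posScale κ s - posScale κ t| + |velScale κ s - velScale κ t|))
      (𝓝 t) (𝓝 0) := by
    have h1 := ((ha.sub (continuousAt_const (y := posScale κ t))).abs.add
      (hb.sub (continuousAt_const (y := velScale κ t))).abs).const_mul C
    simpa [ContinuousAt] using h1.tendsto
  rw [ContinuousAt, tendsto_iff_norm_sub_tendsto_zero]
  refine squeeze_zero' (Eventually.of_forall fun _ => norm_nonneg _) ?_ hw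
  filter_upwards [Ioo_mem_nhds ht (lt_add_one t)] with s hs
  exact hC t s ht (by linarith) hs.1 hs.2.le η le_rfl

theorem eventually_lt_yLeft (h : InitialData κ v₀ u₀) (hA : MinimumAttained κ v₀ u₀) {t x c : ℝ}
    (ht : 0 < t) (hc : c < yLeft κ v₀ u₀ x t) {f : ℝ → ℝ} (hf : Tendsto f (𝓝 t) (𝓝 x)) :
    ∀ᶠ s in 𝓝 t, c < yLeft κ v₀ u₀ (f s) s := by
  have h1 := (h.labelPos_lt_iff hA ht).2 hc
  filter_upwards [(h.continuousAt_labelPos hA ht c).tendsto.eventually_lt hf h1, lt_mem_nhds ht]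
    with s hs hs0
  exact (h.labelPos_lt_iff hA hs0).1 hs

theorem eventually_yRight_lt (h : InitialData κ v₀ u₀) (hA : MinimumAttained κ v₀ u₀) {t x c : ℝ}
    (ht : 0 < t) (hc : yRight κ v₀ u₀ x t < c) {f : ℝ → ℝ} (hf : Tendsto f (𝓝 t) (𝓝 x)) :
    ∀ᶠ s in 𝓝 t, yRight κ v₀ u₀ (f s) s < c := by
  obtain ⟨c', hc', hc'c⟩ := exists_between hc
  obtain ⟨z, hz, hzc⟩ : ∃ z, yLeft κ v₀ u₀ z t < c' ∧ x < z := by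
    have h1 := (h.tendsto_yLeft_right hA ht x).eventually_lt_const hc'
    exact (h1.and self_mem_nhdsWithin).exists
  have h1 : x < labelPos κ v₀ u₀ c' t := hzc.trans_le ((h.le_labelPos_iff hA ht).2 hz.le)
  filter_upwards [hf.eventually_lt (h.continuousAt_labelPos hA ht c').tendsto h1, lt_mem_nhds ht]
    with s hs hs0
  exact ((h.yRight_le_yLeft hA hs0 hs).trans (h.yLeft_labelPos_le hA hs0 c')).trans_lt hc'c

end InitialData

/-! ### The velocity field and the entropy condition -/

/-- The centre of mass of the labels between the extreme minimizers at `(x, t)`; it is the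
minimizer itself if there is only one. -/
noncomputable def barycenter (κ : ℝ) (v₀ u₀ : ℝ → ℝ) (x t : ℝ) : ℝ :=
  if yLeft κ v₀ u₀ x t = yRight κ v₀ u₀ x t then yLeft κ v₀ u₀ x t
  else (cumWeighted v₀ id (yRight κ v₀ u₀ x t) - cumWeighted v₀ id (yLeft κ v₀ u₀ x t))
    / (cumMass v₀ (yRight κ v₀ u₀ x t) - cumMass v₀ (yLeft κ v₀ u₀ x t))

namespace InitialData

variable {κ : ℝ} {v₀ u₀ : ℝ → ℝ}

theorem barycenter_mem_Icc (h : InitialData κ v₀ u₀) (hA : MinimumAttained κ v₀ u₀) {t : ℝ}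
    (ht : 0 < t) (x : ℝ) :
    barycenter κ v₀ u₀ x t ∈ Icc (yLeft κ v₀ u₀ x t) (yRight κ v₀ u₀ x t) := by
  have hle := h.yLeft_le_yRight hA ht x
  unfold barycenter
  split_ifs with heq
  · exact ⟨le_rfl, hle⟩
  · have hlt := hle.lt_of_ne heq
    have hM := h.cumMass_sub_pos hlt
    exact ⟨(le_div_iff₀ hM).2 (h.mul_lt_cumMoment_sub hlt).le,
      (div_le_iff₀ hM).2 (h.cumMoment_sub_lt hlt).le⟩

theorem integral_charVel (h : InitialData κ v₀ u₀) (t y z : ℝ) :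
    ∫ η in y..z, charVel κ u₀ η t * v₀ η
      = posRate κ t * (cumWeighted v₀ id z - cumWeighted v₀ id y)
        + velRate κ t * (cumWeighted v₀ u₀ z - cumWeighted v₀ u₀ y) := by
  rw [← h.integral_moment, ← h.integral_momentum, ← intervalIntegral.integral_const_mul,
    ← intervalIntegral.integral_const_mul, ← intervalIntegral.integral_add
      ((h.intervalIntegrable_moment y z).const_mul _)
      ((h.intervalIntegrable_momentum y z).const_mul _)]
  refine intervalIntegral.integral_congr fun η _ => ?_
  simp only [charVel_eq, id]
  ring

/-- The momentum of the labels collected at `(x, t)` is their mass times the velocity. -/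
theorem velocity_mul_cumMass (h : InitialData κ v₀ u₀) (hA : MinimumAttained κ v₀ u₀) {t : ℝ}
    (ht : 0 < t) (x : ℝ) :
    velocity κ v₀ u₀ x t
        * (cumMass v₀ (yRight κ v₀ u₀ x t) - cumMass v₀ (yLeft κ v₀ u₀ x t))
      = posRate κ t
          * (cumWeighted v₀ id (yRight κ v₀ u₀ x t) - cumWeighted v₀ id (yLeft κ v₀ u₀ x t))
        + velRate κ t
          * (cumWeighted v₀ u₀ (yRight κ v₀ u₀ x t) - cumWeighted v₀ u₀ (yLeft κ v₀ u₀ x t)) := by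
  rcases (h.yLeft_le_yRight hA ht x).eq_or_lt with heq | hlt
  · rw [heq]; ring
  · rw [velocity, if_neg hlt.ne, h.integral_charVel, h.integral_density,
      div_mul_cancel₀ _ (h.cumMass_sub_pos hlt).ne']

/-- All minimizers at `(x, t)` give the same value of the potential. -/
theorem minimizers_balance (h : InitialData κ v₀ u₀) {t x y z : ℝ} (ht : 0 ≤ t)
    (hy : y ∈ minimizers κ v₀ u₀ x t) (hz : z ∈ minimizers κ v₀ u₀ x t) :
    posScale κ t * (cumWeighted v₀ id z - cumWeighted v₀ id y)
      + velScale κ t * (cumWeighted v₀ u₀ z - cumWeighted v₀ u₀ y)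
      = x * (cumMass v₀ z - cumMass v₀ y) := by
  have h1 := (h.mem_minimizers ht).1 hy z
  have h2 := (h.mem_minimizers ht).1 hz y
  linarith

/-- Both branches of the definition of the velocity are the velocity at `(x, t)` of the
characteristic issued from the barycenter. -/
theorem velocity_eq_barycenter (h : InitialData κ v₀ u₀) (hA : MinimumAttained κ v₀ u₀) {t : ℝ}
    (ht : 0 < t) (x : ℝ) :
    velocity κ v₀ u₀ x t
      = velRate κ t * ((x - posScale κ t * barycenter κ v₀ u₀ x t) / velScale κ t)
        + posRate κ t * barycenter κ v₀ u₀ x t := by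
  have hκ := h.kappa_pos
  have hb := velScale_pos hκ ht
  have hs : 0 < t + κ := by positivity
  rcases (h.yLeft_le_yRight hA ht x).eq_or_lt with heq | hlt
  · have hq : (1 + κ ^ 2 / (t + κ) ^ 2) / ((t + κ) - κ ^ 2 / (t + κ))
        = velRate κ t / velScale κ t := by
      unfold velRate velScale
      rw [div_div_div_cancel_right₀ two_ne_zero]
    have hp : 1 / 2 * ((t + κ) / κ + κ / (t + κ)) = posScale κ t := by unfold posScale; ring
    rw [velocity, if_pos heq, barycenter, if_pos heq, hq, hp, posRate]
    ring
  · have hM := h.cumMass_sub_pos hlt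
    have h1 := h.velocity_mul_cumMass hA ht x
    have h2 := h.minimizers_balance ht.le (h.isLeast_yLeft hA ht x).1
      (h.isGreatest_yRight hA ht x).1
    rw [barycenter, if_neg hlt.ne]
    set ΔM := cumMass v₀ (yRight κ v₀ u₀ x t) - cumMass v₀ (yLeft κ v₀ u₀ x t)
    set ΔA := cumWeighted v₀ id (yRight κ v₀ u₀ x t) - cumWeighted v₀ id (yLeft κ v₀ u₀ x t)
    set ΔB := cumWeighted v₀ u₀ (yRight κ v₀ u₀ x t) - cumWeighted v₀ u₀ (yLeft κ v₀ u₀ x t)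
    rw [eq_div_of_mul_eq hM.ne' h1,
      show ΔB = (x * ΔM - posScale κ t * ΔA) / velScale κ t by field_simp; linarith]
    field_simp
    ring

theorem velocity_eq (h : InitialData κ v₀ u₀) (hA : MinimumAttained κ v₀ u₀) {t : ℝ}
    (ht : 0 < t) (x : ℝ) :
    velocity κ v₀ u₀ x t
      = velRate κ t / velScale κ t * x
        - κ / ((t + κ) * velScale κ t) * barycenter κ v₀ u₀ x t := by
  have hκ := h.kappa_pos
  have hb := velScale_pos hκ ht
  have hs : 0 < t + κ := by positivity
  have hw := posScale_mul_velRate_sub hκ ht.le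
  rw [h.velocity_eq_barycenter hA ht, ← div_div, ← hw]
  field_simp
  ring

theorem oleinikEntropy (h : InitialData κ v₀ u₀) (hA : MinimumAttained κ v₀ u₀) :
    OleinikEntropy κ (velocity κ v₀ u₀) := by
  intro t ht
  have hκ := h.kappa_pos
  have hb := velScale_pos hκ ht
  have hs : 0 < t + κ := by positivity
  have hc : 0 < κ / ((t + κ) * velScale κ t) := by positivity
  simp only [h.velocity_eq hA ht]
  have hlin : ∀ (x : ℝ) (S : Set ℝ), Tendsto (fun z => velRate κ t / velScale κ t * z) (𝓝[S] x)
      (𝓝 (velRate κ t / velScale κ t * x)) := fun x S =>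
    (tendsto_id.mono_left nhdsWithin_le_nhds).const_mul _
  refine ⟨fun x => ⟨_, _, (hlin x _).sub (Tendsto.const_mul _ (?_ : Tendsto _ _
    (𝓝 (yLeft κ v₀ u₀ x t)))), (hlin x _).sub (Tendsto.const_mul _ (?_ : Tendsto _ _
    (𝓝 (yRight κ v₀ u₀ x t)))), ?_, ?_⟩, fun x₁ x₂ hne => ?_⟩
  · refine tendsto_of_tendsto_of_tendsto_of_le_of_le' (h.tendsto_yLeft_left hA ht x)
      tendsto_const_nhds (Eventually.of_forall fun z => (h.barycenter_mem_Icc hA ht z).1) ?_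
    filter_upwards [self_mem_nhdsWithin] with z hz
    exact (h.barycenter_mem_Icc hA ht z).2.trans (h.yRight_le_yLeft hA ht hz)
  · refine tendsto_of_tendsto_of_tendsto_of_le_of_le' tendsto_const_nhds
      (h.tendsto_yRight_right hA ht x) ?_
      (Eventually.of_forall fun z => (h.barycenter_mem_Icc hA ht z).2)
    filter_upwards [self_mem_nhdsWithin] with z hz
    exact (h.yRight_le_yLeft hA ht hz).trans (h.barycenter_mem_Icc hA ht z).1
  · have := mul_le_mul_of_nonneg_left (h.barycenter_mem_Icc hA ht x).2 hc.le
    linarith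
  · have := mul_le_mul_of_nonneg_left (h.barycenter_mem_Icc hA ht x).1 hc.le
    linarith
  · have hq : ((t + κ) ^ 2 + κ ^ 2) / ((t + κ) * ((t + κ) ^ 2 - κ ^ 2))
        = velRate κ t / velScale κ t := by
      have h1 : (t + κ) ^ 2 - κ ^ 2 ≠ 0 := by nlinarith
      have h2 : t + 2 * κ ≠ 0 := by positivity
      rw [velScale_eq hκ ht.le, show (t + κ) ^ 2 - κ ^ 2 = t * (t + 2 * κ) by ring]
      unfold velRate
      field_simp
    have hmono : ∀ {a b : ℝ}, a < b → barycenter κ v₀ u₀ a t ≤ barycenter κ v₀ u₀ b t :=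
      fun hab => (h.barycenter_mem_Icc hA ht _).2.trans
        ((h.yRight_le_yLeft hA ht hab).trans (h.barycenter_mem_Icc hA ht _).1)
    rw [hq]
    rcases hne.lt_or_gt with hlt | hlt
    · rw [div_le_iff₀ (sub_pos.2 hlt)]
      have := mul_le_mul_of_nonneg_left (hmono hlt) hc.le
      linarith
    · rw [div_le_iff_of_neg (sub_neg.2 hlt)]
      have := mul_le_mul_of_nonneg_left (hmono hlt) hc.le
      linarith

/-! ### Measurability and local bounds -/

theorem measurable_yLeft (h : InitialData κ v₀ u₀) (hA : MinimumAttained κ v₀ u₀) :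
    Measurable fun p : ℝ × Ioi (0 : ℝ) => yLeft κ v₀ u₀ p.1 p.2 := by
  refine measurable_of_Iic fun η => ?_
  have hX : Continuous fun s : Ioi (0 : ℝ) => labelPos κ v₀ u₀ η s := by
    rw [continuous_iff_continuousAt]
    intro s
    exact ContinuousAt.comp (f := Subtype.val) (h.continuousAt_labelPos hA s.2 η)
      continuous_subtype_val.continuousAt
  have : (fun p : ℝ × Ioi (0 : ℝ) => yLeft κ v₀ u₀ p.1 p.2) ⁻¹' Iic η
      = {p | p.1 ≤ labelPos κ v₀ u₀ η p.2} := by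
    ext p
    exact (h.le_labelPos_iff hA p.2.2).symm
  rw [this]
  exact measurableSet_le measurable_fst (hX.measurable.comp measurable_snd)

theorem measurable_yRight (h : InitialData κ v₀ u₀) (hA : MinimumAttained κ v₀ u₀) :
    Measurable fun p : ℝ × Ioi (0 : ℝ) => yRight κ v₀ u₀ p.1 p.2 := by
  have hmeas : ∀ n : ℕ, Measurable fun p : ℝ × Ioi (0 : ℝ) =>
      yLeft κ v₀ u₀ (p.1 + 1 / ((n : ℝ) + 1)) p.2 := fun n =>
    Measurable.comp (g := fun p : ℝ × Ioi (0 : ℝ) => yLeft κ v₀ u₀ p.1 p.2)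
      (f := fun p : ℝ × Ioi (0 : ℝ) => (p.1 + 1 / ((n : ℝ) + 1), p.2))
      (h.measurable_yLeft hA)
      ((measurable_fst.add_const (1 / ((n : ℝ) + 1))).prodMk measurable_snd)
  refine measurable_of_tendsto_metrizable hmeas (tendsto_pi_nhds.2 fun p => ?_)
  have hlim : Tendsto (fun n : ℕ => p.1 + 1 / ((n : ℝ) + 1)) atTop (𝓝[>] p.1) := by
    refine tendsto_nhdsWithin_iff.2 ⟨?_, Eventually.of_forall fun n => ?_⟩
    · simpa using (tendsto_one_div_add_atTop_nhds_zero_nat (𝕜 := ℝ)).const_add p.1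
    · have : (0 : ℝ) < 1 / ((n : ℝ) + 1) := by positivity
      simpa using this
  exact (h.tendsto_yLeft_right hA p.2.2 p.1).comp hlim

theorem measurable_mass (h : InitialData κ v₀ u₀) (hA : MinimumAttained κ v₀ u₀) :
    Measurable fun p : ℝ × Ioi (0 : ℝ) => mass κ v₀ u₀ p.1 p.2 :=
  h.continuous_cumMass.measurable.comp (h.measurable_yLeft hA)

theorem measurable_velocityField (h : InitialData κ v₀ u₀) (hA : MinimumAttained κ v₀ u₀) :
    Measurable fun p : ℝ × Ioi (0 : ℝ) => velocity κ v₀ u₀ p.1 p.2 := by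
  have hl := h.measurable_yLeft hA
  have hr := h.measurable_yRight hA
  have hbar : Measurable fun p : ℝ × Ioi (0 : ℝ) => barycenter κ v₀ u₀ p.1 p.2 := by
    refine Measurable.ite (measurableSet_eq_fun hl hr) hl (Measurable.div ?_ ?_)
    · exact (h.continuous_cumMoment.measurable.comp hr).sub
        (h.continuous_cumMoment.measurable.comp hl)
    · exact (h.continuous_cumMass.measurable.comp hr).sub
        (h.continuous_cumMass.measurable.comp hl)
  have ht : Measurable fun p : ℝ × Ioi (0 : ℝ) => (p.2 : ℝ) :=
    measurable_subtype_coe.comp measurable_snd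
  have : (fun p : ℝ × Ioi (0 : ℝ) => velocity κ v₀ u₀ p.1 p.2) = fun p =>
      velRate κ p.2 / velScale κ p.2 * p.1
        - κ / (((p.2 : ℝ) + κ) * velScale κ p.2) * barycenter κ v₀ u₀ p.1 p.2 := by
    funext p
    exact h.velocity_eq hA p.2.2 p.1
  rw [this]
  unfold velRate velScale
  fun_prop

theorem measurable_labelPos (h : InitialData κ v₀ u₀) (hA : MinimumAttained κ v₀ u₀) :
    Measurable fun p : ℝ × Ioi (0 : ℝ) => labelPos κ v₀ u₀ p.1 p.2 := by
  have hcont : ∀ η, Continuous fun s : Ioi (0 : ℝ) => labelPos κ v₀ u₀ η s := fun η =>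
    continuous_iff_continuousAt.2 fun s => ContinuousAt.comp (f := Subtype.val)
      (h.continuousAt_labelPos hA s.2 η) continuous_subtype_val.continuousAt
  have hmeas : ∀ s : Ioi (0 : ℝ), Measurable fun η => labelPos κ v₀ u₀ η s := fun s =>
    (h.monotone_labelPos hA s.2).measurable
  exact Measurable.comp
    (g := Function.uncurry fun (s : Ioi (0 : ℝ)) (η : ℝ) => labelPos κ v₀ u₀ η s)
    (f := fun p : ℝ × Ioi (0 : ℝ) => (p.2, p.1))
    (measurable_uncurry_of_continuous_of_measurable hcont hmeas)
    (measurable_snd.prodMk measurable_fst)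

theorem locallyBounded_mass (h : InitialData κ v₀ u₀) (hA : MinimumAttained κ v₀ u₀) :
    LocallyBoundedUpperHalf (mass κ v₀ u₀) := by
  intro R a b ha
  obtain ⟨K, hK⟩ := h.exists_abs_minimizer_le hA b R
  obtain ⟨C, hC⟩ := locallyBounded_of_continuous h.continuous_cumMass K
  refine ⟨C, fun x hx t ht => hC _ (abs_le.1 ?_)⟩
  exact hK t (ha.trans_le ht.1) ht.2 x (abs_le.2 hx) _
    (h.isLeast_yLeft hA (ha.trans_le ht.1) x).1

theorem locallyBounded_velocity (h : InitialData κ v₀ u₀) (hA : MinimumAttained κ v₀ u₀) :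
    LocallyBoundedUpperHalf (velocity κ v₀ u₀) := by
  intro R a b ha
  have hκ := h.kappa_pos
  obtain ⟨K, hK⟩ := h.exists_abs_minimizer_le hA b R
  have hcont : ∀ t ∈ Icc a b, 0 < t := fun t ht => ha.trans_le ht.1
  have hcb : ContinuousOn (velScale κ) (Icc a b) := fun t ht =>
    (hasDerivAt_velScale hκ (hcont t ht).le).continuousAt.continuousWithinAt
  have hcr : ContinuousOn (velRate κ) (Icc a b) := fun t ht =>
    (hasDerivAt_velRate hκ (hcont t ht).le).continuousAt.continuousWithinAt
  have hne : ∀ t ∈ Icc a b, velScale κ t ≠ 0 := fun t ht => (velScale_pos hκ (hcont t ht)).ne'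
  have hne' : ∀ t ∈ Icc a b, (t + κ) * velScale κ t ≠ 0 := fun t ht =>
    mul_ne_zero (by linarith [hcont t ht]) (hne t ht)
  obtain ⟨C₁, hC₁⟩ := isCompact_Icc.exists_bound_of_continuousOn (hcr.div hcb hne)
  obtain ⟨C₂, hC₂⟩ := isCompact_Icc.exists_bound_of_continuousOn
    ((continuousOn_const (c := κ)).div ((continuousOn_id.add continuousOn_const).mul hcb) hne')
  refine ⟨C₁ * R + C₂ * K, fun x hx t ht => ?_⟩
  have ht0 := hcont t ht
  have hbar := h.barycenter_mem_Icc hA ht0 x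
  have h1 := abs_le.1 (hK t ht0 ht.2 x (abs_le.2 hx) _ (h.isLeast_yLeft hA ht0 x).1)
  have h2 := abs_le.1 (hK t ht0 ht.2 x (abs_le.2 hx) _ (h.isGreatest_yRight hA ht0 x).1)
  have hbK : |barycenter κ v₀ u₀ x t| ≤ K := abs_le.2 ⟨h1.1.trans hbar.1, hbar.2.trans h2.2⟩
  rw [h.velocity_eq hA ht0]
  refine (abs_sub _ _).trans ?_
  rw [abs_mul, abs_mul]
  have h3 := hC₁ t ht
  have h4 := hC₂ t ht
  exact add_le_add (mul_le_mul h3 (abs_le.2 hx) (abs_nonneg _) ((norm_nonneg _).trans h3))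
    (mul_le_mul h4 hbK (abs_nonneg _) ((norm_nonneg _).trans h4))

end InitialData

/-! ### The equation of motion of the particles -/

/-- A label at which the primitives of `v₀`, `η v₀` and `u₀ v₀` have the expected derivatives.
By Lebesgue's differentiation theorem almost every label is regular. -/
structure IsRegularLabel (v₀ u₀ : ℝ → ℝ) (η : ℝ) : Prop where
  cumMass : HasDerivAt (cumMass v₀) (v₀ η) η
  cumMoment : HasDerivAt (cumWeighted v₀ id) (id η * v₀ η) η
  cumMomentum : HasDerivAt (cumWeighted v₀ u₀) (u₀ η * v₀ η) η

/-- The fundamental theorem of calculus for a continuous function with a right derivative at all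
points but one. -/
theorem integral_eq_sub_of_hasDerivWithinAt_of_ne {f f' : ℝ → ℝ} {a b : ℝ} (τ : ℝ) (hab : a ≤ b)
    (hf : ContinuousOn f (Icc a b))
    (hd : ∀ t ∈ Ioo a b, t ≠ τ → HasDerivWithinAt f (f' t) (Ioi t) t)
    (hi : IntervalIntegrable f' volume a b) : ∫ t in a..b, f' t = f b - f a := by
  by_cases hτ : τ ∈ Ioo a b
  · have hi₁ : IntervalIntegrable f' volume a τ := hi.mono_set (by
      rw [uIcc_of_le hab, uIcc_of_le hτ.1.le]; exact Icc_subset_Icc_right hτ.2.le)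
    have hi₂ : IntervalIntegrable f' volume τ b := hi.mono_set (by
      rw [uIcc_of_le hab, uIcc_of_le hτ.2.le]; exact Icc_subset_Icc_left hτ.1.le)
    have h₁ := intervalIntegral.integral_eq_sub_of_hasDeriv_right_of_le hτ.1.le
      (hf.mono (Icc_subset_Icc_right hτ.2.le))
      (fun t ht => hd t ⟨ht.1, ht.2.trans hτ.2⟩ ht.2.ne) hi₁
    have h₂ := intervalIntegral.integral_eq_sub_of_hasDeriv_right_of_le hτ.2.le
      (hf.mono (Icc_subset_Icc_left hτ.1.le))
      (fun t ht => hd t ⟨hτ.1.trans ht.1, ht.2⟩ ht.1.ne') hi₂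
    rw [← intervalIntegral.integral_add_adjacent_intervals hi₁ hi₂, h₁, h₂]
    ring
  · exact intervalIntegral.integral_eq_sub_of_hasDeriv_right_of_le hab hf
      (fun t ht => hd t ht fun h => hτ (h ▸ ht)) hi

namespace InitialData

variable {κ : ℝ} {v₀ u₀ : ℝ → ℝ}

theorem ae_isRegularLabel (h : InitialData κ v₀ u₀) : ∀ᵐ η, IsRegularLabel v₀ u₀ η := by
  have h1 := _root_.LocallyIntegrable.ae_hasDerivAt_integral
    (h.bounded_density.locallyIntegrable h.measurable_density)
  have h2 := _root_.LocallyIntegrable.ae_hasDerivAt_integral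
    (((locallyBounded_of_continuous continuous_id).mul h.bounded_density).locallyIntegrable
      (measurable_id.mul h.measurable_density))
  have h3 := _root_.LocallyIntegrable.ae_hasDerivAt_integral
    ((h.bounded_velocity.mul h.bounded_density).locallyIntegrable
      (h.measurable_velocity.mul h.measurable_density))
  filter_upwards [h1, h2, h3] with η h1 h2 h3
  exact ⟨h1 0, h2 0, h3 0⟩

/-- At a regular label the first-order condition for a minimum holds: the minimum is attained
only along the characteristic issued from the label. -/
theorem eq_of_mem_minimizers (h : InitialData κ v₀ u₀) {η x t : ℝ} (ht : 0 ≤ t)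
    (hη : IsRegularLabel v₀ u₀ η) (hmem : η ∈ minimizers κ v₀ u₀ x t) :
    x = posScale κ t * η + velScale κ t * u₀ η := by
  have hd := ((hη.cumMoment.const_mul (posScale κ t)).add
    (hη.cumMomentum.const_mul (velScale κ t))).sub (hη.cumMass.const_mul x)
  have hmin : IsLocalMin (fun y => posScale κ t * cumWeighted v₀ id y
      + velScale κ t * cumWeighted v₀ u₀ y - x * cumMass v₀ y) η :=
    Eventually.of_forall ((h.mem_minimizers ht).1 hmem)
  have h0 := hmin.hasDerivAt_eq_zero hd
  have h1 : (posScale κ t * η + velScale κ t * u₀ η - x) * v₀ η = 0 := by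
    simp only [id] at h0
    linarith
  have := (mul_eq_zero.1 h1).resolve_right (h.density_pos η).ne'
  linarith

/-- A regular label that is still a minimizer at a later time has not collided before. -/
theorem minimizers_subset_of_regular (h : InitialData κ v₀ u₀) {η x x' t t' : ℝ} (ht : 0 ≤ t)
    (htt' : t < t') (hη : IsRegularLabel v₀ u₀ η) (hmem : η ∈ minimizers κ v₀ u₀ x t)
    (hmem' : η ∈ minimizers κ v₀ u₀ x' t') : minimizers κ v₀ u₀ x t ⊆ {η} := by
  intro y hy
  have hx := h.eq_of_mem_minimizers ht hη hmem
  have hx' := h.eq_of_mem_minimizers (ht.trans htt'.le) hη hmem'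
  rcases lt_trichotomy y η with hlt | heq | hgt
  · have := h.comparison_of_gt ht htt' hy hmem' hlt
    rw [hx, hx'] at this
    linarith
  · exact heq
  · have := h.comparison_of_lt ht htt' hy hmem' hgt
    rw [hx, hx'] at this
    linarith

theorem velocity_of_regular (h : InitialData κ v₀ u₀) (hA : MinimumAttained κ v₀ u₀)
    {η x t : ℝ} (ht : 0 < t) (hη : IsRegularLabel v₀ u₀ η) (hl : yLeft κ v₀ u₀ x t = η)
    (hr : yRight κ v₀ u₀ x t = η) : velocity κ v₀ u₀ x t = charVel κ u₀ η t := by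
  have hmem := (h.isLeast_yLeft hA ht x).1
  rw [hl] at hmem
  have hx := h.eq_of_mem_minimizers ht.le hη hmem
  have hb := velScale_pos h.kappa_pos ht
  rw [h.velocity_eq_barycenter hA ht, barycenter, if_pos (hl.trans hr.symm), hl, charVel_eq, hx,
    add_sub_cancel_left, mul_div_cancel_left₀ _ hb.ne']
  ring

theorem label_mem_Ioo_of_not_mem (h : InitialData κ v₀ u₀) (hA : MinimumAttained κ v₀ u₀) {η t : ℝ}
    (ht : 0 < t) (hη : η ∉ minimizers κ v₀ u₀ (labelPos κ v₀ u₀ η t) t) :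
    η ∈ Ioo (yLeft κ v₀ u₀ (labelPos κ v₀ u₀ η t) t)
      (yRight κ v₀ u₀ (labelPos κ v₀ u₀ η t) t) := by
  refine ⟨(h.yLeft_labelPos_le hA ht η).lt_of_ne fun heq => hη ?_,
    (h.le_yRight_labelPos hA ht η).lt_of_ne fun heq => hη ?_⟩
  · exact mem_of_eq_of_mem heq.symm (h.isLeast_yLeft hA ht _).1
  · exact mem_of_eq_of_mem heq (h.isGreatest_yRight hA ht _).1

/-- A label which is still a minimizer at some later time has been one all along. -/
theorem mem_minimizers_of_lt (h : InitialData κ v₀ u₀) (hA : MinimumAttained κ v₀ u₀)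
    {η t t' : ℝ} (ht : 0 < t) (htt' : t < t')
    (hmem' : η ∈ minimizers κ v₀ u₀ (labelPos κ v₀ u₀ η t') t') :
    η ∈ minimizers κ v₀ u₀ (labelPos κ v₀ u₀ η t) t := by
  by_contra hη
  exact h.not_mem_Ioo_of_mem_minimizers ht.le htt' (h.isLeast_yLeft hA ht _).1
    (h.isGreatest_yRight hA ht _).1 hmem' (h.label_mem_Ioo_of_not_mem hA ht hη)

/-- Before its collision a regular particle moves along its characteristic. -/
theorem hasDerivAt_labelPos_of_free (h : InitialData κ v₀ u₀) (hA : MinimumAttained κ v₀ u₀)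
    {η t t' : ℝ} (ht : 0 < t) (htt' : t < t') (hη : IsRegularLabel v₀ u₀ η)
    (hmem' : η ∈ minimizers κ v₀ u₀ (labelPos κ v₀ u₀ η t') t') :
    HasDerivAt (fun s => labelPos κ v₀ u₀ η s)
      (velocity κ v₀ u₀ (labelPos κ v₀ u₀ η t) t) t := by
  have hκ := h.kappa_pos
  have hmem := h.mem_minimizers_of_lt hA ht htt' hmem'
  have hsub := h.minimizers_subset_of_regular ht.le htt' hη hmem hmem'
  rw [h.velocity_of_regular hA ht hη (hsub (h.isLeast_yLeft hA ht _).1)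
    (hsub (h.isGreatest_yRight hA ht _).1), charVel_eq]
  refine (((hasDerivAt_posScale hκ ht.le).mul_const η).add
    ((hasDerivAt_velScale hκ ht.le).mul_const (u₀ η))).congr_of_eventuallyEq ?_
  filter_upwards [Ioo_mem_nhds ht htt'] with s hs
  exact h.eq_of_mem_minimizers hs.1.le hη (h.mem_minimizers_of_lt hA hs.1 hs.2 hmem')

/-- After its collision a particle moves, to the right in time, with the velocity of its cluster.
The increment of the position is squeezed between two averages by `minimizers_two_point`, where
stickiness ensures that the later cluster contains the earlier one. -/
theorem hasDerivWithinAt_labelPos_of_cluster (h : InitialData κ v₀ u₀)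
    (hA : MinimumAttained κ v₀ u₀) {η t : ℝ} (ht : 0 < t)
    (hη : η ∈ Ioo (yLeft κ v₀ u₀ (labelPos κ v₀ u₀ η t) t)
      (yRight κ v₀ u₀ (labelPos κ v₀ u₀ η t) t)) :
    HasDerivWithinAt (fun s => labelPos κ v₀ u₀ η s)
      (velocity κ v₀ u₀ (labelPos κ v₀ u₀ η t) t) (Ioi t) t := by
  have hκ := h.kappa_pos
  have hlt := hη.1.trans hη.2
  have hmem₁ := (h.isLeast_yLeft hA ht (labelPos κ v₀ u₀ η t)).1
  have hmem₂ := (h.isGreatest_yRight hA ht (labelPos κ v₀ u₀ η t)).1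
  have hvel := h.velocity_mul_cumMass hA ht (labelPos κ v₀ u₀ η t)
  have hX := (h.continuousAt_labelPos hA ht η).tendsto
  have hlow := fun c hc => h.eventually_lt_yLeft hA (c := c) ht hc hX
  have hupp := fun c hc => h.eventually_yRight_lt hA (c := c) ht hc hX
  set y₁ := yLeft κ v₀ u₀ (labelPos κ v₀ u₀ η t) t
  set y₂ := yRight κ v₀ u₀ (labelPos κ v₀ u₀ η t) t
  have hM := h.cumMass_sub_pos hlt
  have hl : ∀ s, t < s → yLeft κ v₀ u₀ (labelPos κ v₀ u₀ η s) s ≤ y₁ := by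
    intro s hs
    by_contra hcon
    exact h.not_mem_Ioo_of_mem_minimizers ht.le hs hmem₁ hmem₂
      (h.isLeast_yLeft hA (ht.trans hs) _).1 ⟨not_le.1 hcon,
        (h.yLeft_labelPos_le hA (ht.trans hs) η).trans_lt hη.2⟩
  have hr : ∀ s, t < s → y₂ ≤ yRight κ v₀ u₀ (labelPos κ v₀ u₀ η s) s := by
    intro s hs
    by_contra hcon
    exact h.not_mem_Ioo_of_mem_minimizers ht.le hs hmem₁ hmem₂
      (h.isGreatest_yRight hA (ht.trans hs) _).1 ⟨hη.1.trans_le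
        (h.le_yRight_labelPos hA (ht.trans hs) η), not_le.1 hcon⟩
  have hltend : Tendsto (fun s => yLeft κ v₀ u₀ (labelPos κ v₀ u₀ η s) s) (𝓝[>] t) (𝓝 y₁) := by
    refine tendsto_order.2 ⟨fun c hc => nhdsWithin_le_nhds (hlow c hc), fun c hc => ?_⟩
    filter_upwards [self_mem_nhdsWithin] with s hs using (hl s hs).trans_lt hc
  have hrtend : Tendsto (fun s => yRight κ v₀ u₀ (labelPos κ v₀ u₀ η s) s) (𝓝[>] t)
      (𝓝 y₂) := by
    refine tendsto_order.2 ⟨fun c hc => ?_, fun c hc => nhdsWithin_le_nhds (hupp c hc)⟩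
    filter_upwards [self_mem_nhdsWithin] with s hs using hc.trans_le (hr s hs)
  have ha := hasDerivWithinAt_iff_tendsto_slope' (self_notMem_Ioi) |>.1
    ((hasDerivAt_posScale hκ ht.le).hasDerivWithinAt (s := Ioi t))
  have hb := hasDerivWithinAt_iff_tendsto_slope' (self_notMem_Ioi) |>.1
    ((hasDerivAt_velScale hκ ht.le).hasDerivWithinAt (s := Ioi t))
  rw [hasDerivWithinAt_iff_tendsto_slope' self_notMem_Ioi]
  have hcA := h.continuous_cumMoment
  have hcB := h.continuous_cumMomentum
  have hcM := h.continuous_cumMass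
  -- the common limit of the two averages
  have hlimit : ∀ p q : ℝ → ℝ, Tendsto p (𝓝[>] t) (𝓝 y₁) → Tendsto q (𝓝[>] t) (𝓝 y₂) →
      Tendsto (fun s => (slope (posScale κ) t s
          * (cumWeighted v₀ id (q s) - cumWeighted v₀ id (p s))
        + slope (velScale κ) t s * (cumWeighted v₀ u₀ (q s) - cumWeighted v₀ u₀ (p s)))
        / (cumMass v₀ (q s) - cumMass v₀ (p s))) (𝓝[>] t)
        (𝓝 (velocity κ v₀ u₀ (labelPos κ v₀ u₀ η t) t)) := by
    intro p q hp hq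
    rw [eq_div_of_mul_eq hM.ne' hvel]
    exact ((ha.mul (((hcA.tendsto _).comp hq).sub ((hcA.tendsto _).comp hp))).add
      (hb.mul (((hcB.tendsto _).comp hq).sub ((hcB.tendsto _).comp hp)))).div
      (((hcM.tendsto _).comp hq).sub ((hcM.tendsto _).comp hp)) hM.ne'
  refine tendsto_of_tendsto_of_tendsto_of_le_of_le' (hlimit _ _ tendsto_const_nhds hrtend)
    (hlimit _ _ hltend tendsto_const_nhds) ?_ ?_
  · filter_upwards [self_mem_nhdsWithin] with s hs
    have hs0 : 0 < s := ht.trans hs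
    have htp := h.minimizers_two_point ht.le hs0.le hmem₁
      (h.isGreatest_yRight hA hs0 (labelPos κ v₀ u₀ η s)).1
    have hMs := h.cumMass_sub_pos (hlt.trans_le (hr s hs))
    have hinv : 0 < (s - t)⁻¹ := inv_pos.2 (sub_pos.2 hs)
    rw [div_le_iff₀ hMs]
    simp only [slope_def_field, div_eq_inv_mul]
    have := mul_le_mul_of_nonneg_left htp hinv.le
    linarith
  · filter_upwards [self_mem_nhdsWithin] with s hs
    have hs0 : 0 < s := ht.trans hs
    have htp := h.minimizers_two_point ht.le hs0.le hmem₂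
      (h.isLeast_yLeft hA hs0 (labelPos κ v₀ u₀ η s)).1
    have hMs := h.cumMass_sub_pos ((hl s hs).trans_lt hlt)
    have hinv : 0 < (s - t)⁻¹ := inv_pos.2 (sub_pos.2 hs)
    rw [le_div_iff₀ hMs]
    simp only [slope_def_field, div_eq_inv_mul]
    have := mul_le_mul_of_nonneg_left htp hinv.le
    linarith

/-- The path of a regular particle solves `dX/dt = u(X, t)`, in the sense of right derivatives and
with the possible exception of the time of its first collision. -/
theorem exists_hasDerivWithinAt_labelPos (h : InitialData κ v₀ u₀)
    (hA : MinimumAttained κ v₀ u₀) {η : ℝ} (hη : IsRegularLabel v₀ u₀ η) :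
    ∃ τ, ∀ t, 0 < t → t ≠ τ → HasDerivWithinAt (fun s => labelPos κ v₀ u₀ η s)
      (velocity κ v₀ u₀ (labelPos κ v₀ u₀ η t) t) (Ioi t) t := by
  have hlate : ∀ t, 0 < t → η ∉ minimizers κ v₀ u₀ (labelPos κ v₀ u₀ η t) t →
      HasDerivWithinAt (fun s => labelPos κ v₀ u₀ η s)
        (velocity κ v₀ u₀ (labelPos κ v₀ u₀ η t) t) (Ioi t) t := fun t ht hmem =>
    h.hasDerivWithinAt_labelPos_of_cluster hA ht (h.label_mem_Ioo_of_not_mem hA ht hmem)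
  by_cases hmax : ∃ τ, η ∈ minimizers κ v₀ u₀ (labelPos κ v₀ u₀ η τ) τ ∧
      ∀ t, τ < t → η ∉ minimizers κ v₀ u₀ (labelPos κ v₀ u₀ η t) t
  · obtain ⟨τ, hτ, hτ'⟩ := hmax
    refine ⟨τ, fun t ht hne => ?_⟩
    rcases hne.lt_or_gt with hlt | hgt
    · exact (h.hasDerivAt_labelPos_of_free hA ht hlt hη hτ).hasDerivWithinAt
    · exact hlate t ht (hτ' t hgt)
  · refine ⟨0, fun t ht _ => ?_⟩
    by_cases hmem : η ∈ minimizers κ v₀ u₀ (labelPos κ v₀ u₀ η t) t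
    · push Not at hmax
      obtain ⟨t', htt', hmem'⟩ := hmax t hmem
      exact (h.hasDerivAt_labelPos_of_free hA ht htt' hη hmem').hasDerivWithinAt
    · exact hlate t ht hmem

/-! ### The mass measure as the image of the initial mass -/

theorem monotone_mass (h : InitialData κ v₀ u₀) (hA : MinimumAttained κ v₀ u₀) {t : ℝ}
    (ht : 0 < t) : Monotone fun x => mass κ v₀ u₀ x t :=
  h.strictMono_cumMass.monotone.comp (h.monotone_yLeft hA ht)

/-- The measure `dm` is the image of the initial mass distribution `v₀ dη` under the flow. -/
theorem stieltjesMeasure_mass (h : InitialData κ v₀ u₀) (hA : MinimumAttained κ v₀ u₀) {t : ℝ}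
    (ht : 0 < t) :
    stieltjesMeasure (fun x => mass κ v₀ u₀ x t)
      = Measure.map (fun η => labelPos κ v₀ u₀ η t)
          (volume.withDensity fun η => ENNReal.ofReal (v₀ η)) := by
  have hmono := h.monotone_mass hA ht
  have hmeas : Measurable fun η => labelPos κ v₀ u₀ η t := (h.monotone_labelPos hA ht).measurable
  rw [stieltjesMeasure, dif_pos hmono]
  have hleft : ∀ x, Function.leftLim hmono.stieltjesFunction x = mass κ v₀ u₀ x t := by
    intro x
    refine leftLim_eq_of_tendsto ?_
    have hlim : Tendsto (fun z => mass κ v₀ u₀ z t) (𝓝[<] x) (𝓝 (mass κ v₀ u₀ x t)) :=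
      (h.continuous_cumMass.tendsto _).comp (h.tendsto_yLeft_left hA ht x)
    refine tendsto_of_tendsto_of_tendsto_of_le_of_le' hlim tendsto_const_nhds
      (Eventually.of_forall fun z => hmono.le_rightLim le_rfl) ?_
    filter_upwards [self_mem_nhdsWithin] with z hz using hmono.rightLim_le hz
  refine Measure.ext_of_Ico _ _ fun a b _ => ?_
  have hle : ∀ {a b}, a < b → yLeft κ v₀ u₀ a t ≤ yLeft κ v₀ u₀ b t := fun hab =>
    h.monotone_yLeft hA ht hab.le
  have hpre : (fun η => labelPos κ v₀ u₀ η t) ⁻¹' Ico a b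
      = Ico (yLeft κ v₀ u₀ a t) (yLeft κ v₀ u₀ b t) := by
    ext η
    exact and_congr (h.le_labelPos_iff hA ht) (h.labelPos_lt_iff hA ht)
  rw [StieltjesFunction.measure_Ico, hleft, hleft, Measure.map_apply hmeas measurableSet_Ico,
    hpre, withDensity_apply _ measurableSet_Ico,
    ← ofReal_integral_eq_lintegral_ofReal _ (ae_of_all _ fun η => (h.density_pos η).le)]
  · rw [integral_Ico_eq_integral_Ioc, ← intervalIntegral.integral_of_le (hle ‹a < b›),
      h.integral_density]
    rfl
  · exact ((h.bounded_density.locallyIntegrable h.measurable_density).integrableOn_isCompact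
      isCompact_Icc).mono_set Ico_subset_Icc_self

theorem integral_stieltjesMeasure (h : InitialData κ v₀ u₀) (hA : MinimumAttained κ v₀ u₀)
    {t : ℝ} (ht : 0 < t) {g : ℝ → ℝ} (hg : Measurable g) :
    ∫ x, g x ∂(stieltjesMeasure fun x => mass κ v₀ u₀ x t)
      = ∫ η, g (labelPos κ v₀ u₀ η t) * v₀ η := by
  have hmeas : Measurable fun η => labelPos κ v₀ u₀ η t := (h.monotone_labelPos hA ht).measurable
  rw [h.stieltjesMeasure_mass hA ht, integral_map hmeas.aemeasurable hg.aestronglyMeasurable,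
    integral_withDensity_eq_integral_toReal_smul h.measurable_density.ennreal_ofReal
      (ae_of_all _ fun _ => ENNReal.ofReal_lt_top)]
  refine integral_congr_ae (ae_of_all _ fun η => ?_)
  simp only [ENNReal.toReal_ofReal (h.density_pos η).le, smul_eq_mul]
  ring

theorem integrable_stieltjesMeasure (h : InitialData κ v₀ u₀) (hA : MinimumAttained κ v₀ u₀)
    {t : ℝ} (ht : 0 < t) {g : ℝ → ℝ} (hg : Measurable g)
    (hint : Integrable fun η => g (labelPos κ v₀ u₀ η t) * v₀ η) :
    Integrable g (stieltjesMeasure fun x => mass κ v₀ u₀ x t) := by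
  have hmeas : Measurable fun η => labelPos κ v₀ u₀ η t := (h.monotone_labelPos hA ht).measurable
  rw [h.stieltjesMeasure_mass hA ht,
    integrable_map_measure hg.aestronglyMeasurable hmeas.aemeasurable,
    integrable_withDensity_iff h.measurable_density.ennreal_ofReal
      (ae_of_all _ fun _ => ENNReal.ofReal_lt_top)]
  refine hint.congr (ae_of_all _ fun η => ?_)
  simp only [ENNReal.toReal_ofReal (h.density_pos η).le, Function.comp]

/-- Bounded measurable functions that vanish for large labels are integrable against `v₀`. -/
theorem integrable_mul_density (h : InitialData κ v₀ u₀) {f : ℝ → ℝ} (hf : Measurable f) {K C : ℝ}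
    (hbdd : ∀ η, |η| ≤ K → |f η| ≤ C) (hsupp : ∀ η, K < |η| → f η = 0) :
    Integrable fun η => f η * v₀ η := by
  have hon : IntegrableOn (fun η => f η * v₀ η) (Icc (-K) K) := by
    obtain ⟨D, hD⟩ := h.bounded_density K
    refine Measure.integrableOn_of_bounded (M := C * D) measure_Icc_lt_top.ne
      (hf.mul h.measurable_density).aestronglyMeasurable ?_
    filter_upwards [ae_restrict_mem measurableSet_Icc] with η hη
    have h1 := hbdd η (abs_le.2 hη)
    rw [norm_mul]
    exact mul_le_mul h1 (hD η hη) (norm_nonneg _) ((abs_nonneg _).trans h1)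
  refine (integrableOn_iff_integrable_of_support_subset ?_).1 hon
  intro η hη
  by_contra hcon
  refine hη ?_
  simp only [hsupp η (not_le.1 fun hle => hcon (abs_le.1 hle)), zero_mul]

/-! ### Averages over clusters -/

theorem countable_clusters (h : InitialData κ v₀ u₀) (hA : MinimumAttained κ v₀ u₀) {t : ℝ}
    (ht : 0 < t) : {x | yLeft κ v₀ u₀ x t < yRight κ v₀ u₀ x t}.Countable := by
  have hc := (h.monotone_yLeft hA ht).countable_not_continuousAt
  refine hc.mono ?_
  intro x hx hcont
  have h1 := tendsto_nhds_unique (hcont.tendsto.mono_left (nhdsWithin_le_nhds (s := Ioi x)))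
    (h.tendsto_yLeft_right hA ht x)
  exact (ne_of_lt hx) h1

/-- A density on the labels which vanishes on particles that have not collided and has mean zero
over each cluster is orthogonal to all functions of the position. -/
theorem integral_comp_labelPos_eq_zero (h : InitialData κ v₀ u₀) (hA : MinimumAttained κ v₀ u₀)
    {t : ℝ} (ht : 0 < t) {D g : ℝ → ℝ}
    (hfree : ∀ η, IsRegularLabel v₀ u₀ η → yLeft κ v₀ u₀ (labelPos κ v₀ u₀ η t) t = η →
      yRight κ v₀ u₀ (labelPos κ v₀ u₀ η t) t = η → D η = 0)
    (hcluster : ∀ x, yLeft κ v₀ u₀ x t < yRight κ v₀ u₀ x t →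
      ∫ η in Ico (yLeft κ v₀ u₀ x t) (yRight κ v₀ u₀ x t), D η * v₀ η = 0)
    (hint : Integrable fun η => g (labelPos κ v₀ u₀ η t) * D η * v₀ η) :
    ∫ η, g (labelPos κ v₀ u₀ η t) * D η * v₀ η = 0 := by
  set N := {x | yLeft κ v₀ u₀ x t < yRight κ v₀ u₀ x t}
  have hNc : N.Countable := h.countable_clusters hA ht
  have : Countable N := hNc.to_subtype
  set I : N → Set ℝ := fun x => Ico (yLeft κ v₀ u₀ x t) (yRight κ v₀ u₀ x t)
  have hImeas : ∀ x, MeasurableSet (I x) := fun x => measurableSet_Ico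
  have hdisj : Pairwise (Function.onFun Disjoint I) := by
    intro x x' hne
    refine Set.disjoint_left.2 fun η hη hη' => hne (Subtype.ext ?_)
    rw [← h.labelPos_eq_of_mem_Ico hA ht hη, ← h.labelPos_eq_of_mem_Ico hA ht hη']
  have hS : MeasurableSet (⋃ x, I x) := MeasurableSet.iUnion hImeas
  rw [← integral_add_compl hS hint, integral_iUnion hImeas hdisj hint.integrableOn]
  have h1 : ∀ x : N, ∫ η in I x, g (labelPos κ v₀ u₀ η t) * D η * v₀ η = 0 := by
    intro x
    have : ∫ η in I x, g (labelPos κ v₀ u₀ η t) * D η * v₀ η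
        = ∫ η in I x, g x * (D η * v₀ η) :=
      setIntegral_congr_fun (hImeas x) fun η hη => by
        simp only [h.labelPos_eq_of_mem_Ico hA ht hη]
        ring
    rw [this, integral_const_mul, hcluster x x.2, mul_zero]
  simp only [h1, tsum_zero, zero_add]
  refine integral_eq_zero_of_ae ?_
  -- the right endpoints of the clusters form a null set
  have hend : ∀ᵐ η, η ∉ (fun x => yRight κ v₀ u₀ x t) '' N :=
    (hNc.image _).ae_notMem volume
  filter_upwards [ae_restrict_mem hS.compl, ae_restrict_of_ae hend,
    ae_restrict_of_ae h.ae_isRegularLabel] with η hη hηend hreg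
  have hle := h.yLeft_labelPos_le hA ht η
  have hge := h.le_yRight_labelPos hA ht η
  have hnot : ¬ yLeft κ v₀ u₀ (labelPos κ v₀ u₀ η t) t
      < yRight κ v₀ u₀ (labelPos κ v₀ u₀ η t) t := by
    intro hlt
    rcases hge.eq_or_lt with heq | hlt'
    · exact hηend ⟨_, hlt, heq.symm⟩
    · exact hη (mem_iUnion.2 ⟨⟨_, hlt⟩, hle, hlt'⟩)
  have heq : yLeft κ v₀ u₀ (labelPos κ v₀ u₀ η t) t = η :=
    le_antisymm hle (hge.trans (not_lt.1 hnot))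
  have heq' : yRight κ v₀ u₀ (labelPos κ v₀ u₀ η t) t = η :=
    le_antisymm ((not_lt.1 hnot).trans hle) hge
  simp [hfree η hreg heq heq']

theorem intervalIntegrable_charVel (h : InitialData κ v₀ u₀) (t y z : ℝ) :
    IntervalIntegrable (fun η => charVel κ u₀ η t * v₀ η) volume y z := by
  refine (((h.intervalIntegrable_moment y z).const_mul (posRate κ t)).add
    ((h.intervalIntegrable_momentum y z).const_mul (velRate κ t))).congr fun η _ => ?_
  simp only [charVel_eq, id]
  ring

/-- The velocity is the conditional expectation of the characteristic velocities given the
position. -/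
theorem integral_comp_labelPos_charVel (h : InitialData κ v₀ u₀) (hA : MinimumAttained κ v₀ u₀)
    {t : ℝ} (ht : 0 < t) {g : ℝ → ℝ}
    (hint : Integrable fun η => g (labelPos κ v₀ u₀ η t)
      * (charVel κ u₀ η t - velocity κ v₀ u₀ (labelPos κ v₀ u₀ η t) t) * v₀ η) :
    ∫ η, g (labelPos κ v₀ u₀ η t)
      * (charVel κ u₀ η t - velocity κ v₀ u₀ (labelPos κ v₀ u₀ η t) t) * v₀ η = 0 := by
  refine h.integral_comp_labelPos_eq_zero hA ht (fun η hreg hl hr => ?_) (fun x hx => ?_) hint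
  · rw [h.velocity_of_regular hA ht hreg hl hr, sub_self]
  · have : ∫ η in Ico (yLeft κ v₀ u₀ x t) (yRight κ v₀ u₀ x t),
        (charVel κ u₀ η t - velocity κ v₀ u₀ (labelPos κ v₀ u₀ η t) t) * v₀ η
        = ∫ η in Ico (yLeft κ v₀ u₀ x t) (yRight κ v₀ u₀ x t),
        (charVel κ u₀ η t * v₀ η - velocity κ v₀ u₀ x t * v₀ η) :=
      setIntegral_congr_fun measurableSet_Ico fun η hη => by
        simp only [h.labelPos_eq_of_mem_Ico hA ht hη]
        ring
    rw [this, integral_Ico_eq_integral_Ioc, ← intervalIntegral.integral_of_le hx.le,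
      intervalIntegral.integral_sub (h.intervalIntegrable_charVel t _ _)
        ((h.intervalIntegrable_density _ _).const_mul _), h.integral_charVel,
      intervalIntegral.integral_const_mul, h.integral_density, h.velocity_mul_cumMass hA ht,
      sub_self]

/-- The position is the conditional expectation of the characteristic positions given the
position. -/
theorem integral_comp_labelPos_charPos (h : InitialData κ v₀ u₀) (hA : MinimumAttained κ v₀ u₀)
    {t : ℝ} (ht : 0 < t) {g : ℝ → ℝ}
    (hint : Integrable fun η => g (labelPos κ v₀ u₀ η t)
      * (charPos κ u₀ η t - labelPos κ v₀ u₀ η t) * v₀ η) :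
    ∫ η, g (labelPos κ v₀ u₀ η t)
      * (charPos κ u₀ η t - labelPos κ v₀ u₀ η t) * v₀ η = 0 := by
  refine h.integral_comp_labelPos_eq_zero hA ht (fun η hreg hl _ => ?_) (fun x hx => ?_) hint
  · have hmem := (h.isLeast_yLeft hA ht (labelPos κ v₀ u₀ η t)).1
    rw [hl] at hmem
    rw [charPos_eq h.kappa_pos ht.le, h.eq_of_mem_minimizers ht.le hreg hmem, sub_self]
  · have : ∫ η in Ico (yLeft κ v₀ u₀ x t) (yRight κ v₀ u₀ x t),
        (charPos κ u₀ η t - labelPos κ v₀ u₀ η t) * v₀ η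
        = ∫ η in Ico (yLeft κ v₀ u₀ x t) (yRight κ v₀ u₀ x t),
        (posScale κ t * (id η * v₀ η) + velScale κ t * (u₀ η * v₀ η) - x * v₀ η) :=
      setIntegral_congr_fun measurableSet_Ico fun η hη => by
        simp only [h.labelPos_eq_of_mem_Ico hA ht hη, charPos_eq h.kappa_pos ht.le, id]
        ring
    have hbal := h.minimizers_balance ht.le (h.isLeast_yLeft hA ht x).1
      (h.isGreatest_yRight hA ht x).1
    have hiA := (h.intervalIntegrable_moment (yLeft κ v₀ u₀ x t)
      (yRight κ v₀ u₀ x t)).const_mul (posScale κ t)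
    have hiB := (h.intervalIntegrable_momentum (yLeft κ v₀ u₀ x t)
      (yRight κ v₀ u₀ x t)).const_mul (velScale κ t)
    rw [this, integral_Ico_eq_integral_Ioc, ← intervalIntegral.integral_of_le hx.le,
      intervalIntegral.integral_sub (hiA.add hiB)
        ((h.intervalIntegrable_density _ _).const_mul _),
      intervalIntegral.integral_add hiA hiB, intervalIntegral.integral_const_mul,
      intervalIntegral.integral_const_mul, intervalIntegral.integral_const_mul,
      h.integral_density, h.integral_moment, h.integral_momentum, hbal, sub_self]

/-! ### The distributional derivative of the mass -/

/-- Integration by parts: the mass at `x` counts the labels whose particles lie to the left of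
`x`, so that its integral against `ρ` can be rewritten by Fubini's theorem. -/
theorem integral_mul_mass (h : InitialData κ v₀ u₀) (hA : MinimumAttained κ v₀ u₀)
    {t R K : ℝ} (ht : 0 < t) (hR : 0 ≤ R) (hK0 : 0 ≤ K)
    (hK : ∀ x, |x| ≤ R → ∀ y ∈ minimizers κ v₀ u₀ x t, |y| ≤ K)
    {ρ : ℝ → ℝ} (hρ : Continuous ρ) (hsupp : ∀ x, R ≤ |x| → ρ x = 0) :
    ∫ x, ρ x * mass κ v₀ u₀ x t
      = cumMass v₀ (-K) * (∫ x in (-R)..R, ρ x)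
        + ∫ η in Icc (-K) K, (∫ x in (labelPos κ v₀ u₀ η t)..R, ρ x) * v₀ η := by
  have hX : Measurable fun η => labelPos κ v₀ u₀ η t := (h.monotone_labelPos hA ht).measurable
  have hKK : -K ≤ K := by linarith
  have hint : ∀ S : Set ℝ, Integrable ρ (volume.restrict S) := fun S =>
    (hρ.integrable_of_hasCompactSupport
      (HasCompactSupport.intro (isCompact_Icc (a := -R) (b := R)) fun x hx => hsupp x
        (not_lt.1 fun hlt => hx (abs_le.1 hlt.le)))).restrict
  have hkey : ∀ x, ρ x * mass κ v₀ u₀ x t = cumMass v₀ (-K) * ρ x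
      + ∫ η in Icc (-K) K, ρ x * (Ioi (labelPos κ v₀ u₀ η t)).indicator 1 x * v₀ η := by
    intro x
    rcases le_or_gt R |x| with hx | hx
    · simp [hsupp x hx]
    have hy := abs_le.1 (hK x hx.le _ (h.isLeast_yLeft hA ht x).1)
    have h1 : ∀ η, ρ x * (Ioi (labelPos κ v₀ u₀ η t)).indicator 1 x * v₀ η
        = ρ x * (Iio (yLeft κ v₀ u₀ x t)).indicator v₀ η := by
      intro η
      by_cases hη : η < yLeft κ v₀ u₀ x t
      · rw [indicator_of_mem (show x ∈ Ioi _ from (h.labelPos_lt_iff hA ht).2 hη),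
          indicator_of_mem (show η ∈ Iio _ from hη)]
        simp
      · rw [indicator_of_notMem (show x ∉ Ioi _ from
            fun hmem => hη ((h.labelPos_lt_iff hA ht).1 hmem)),
          indicator_of_notMem (show η ∉ Iio _ from hη)]
        simp
    have h2 : Icc (-K) K ∩ Iio (yLeft κ v₀ u₀ x t) = Ico (-K) (yLeft κ v₀ u₀ x t) := by
      ext η
      exact ⟨fun hη => ⟨hη.1.1, hη.2⟩, fun hη => ⟨⟨hη.1, hη.2.le.trans hy.2⟩, hη.2⟩⟩
    simp only [h1]
    rw [integral_const_mul, setIntegral_indicator measurableSet_Iio, h2,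
      integral_Ico_eq_integral_Ioc, ← intervalIntegral.integral_of_le hy.1, h.integral_density]
    simp only [mass, cumMass]
    ring
  have hinner : ∀ η, ∫ x, ρ x * (Ioi (labelPos κ v₀ u₀ η t)).indicator 1 x * v₀ η
      = (∫ x in (labelPos κ v₀ u₀ η t)..R, ρ x) * v₀ η := by
    intro η
    have h1 : ∀ x, ρ x * (Ioi (labelPos κ v₀ u₀ η t)).indicator 1 x * v₀ η
        = (Ioi (labelPos κ v₀ u₀ η t)).indicator ρ x * v₀ η := by
      intro x
      by_cases hx : x ∈ Ioi (labelPos κ v₀ u₀ η t) <;> simp [hx]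
    simp only [h1]
    rw [integral_mul_const, integral_indicator measurableSet_Ioi]
    have h2 := intervalIntegral.integral_interval_add_Ioi (b := R)
      (hint (Ioi (labelPos κ v₀ u₀ η t))) (hint (Ioi R))
    have h3 : ∫ x in Ioi R, ρ x = 0 :=
      setIntegral_eq_zero_of_forall_eq_zero fun x hx =>
        hsupp x ((le_of_lt hx).trans (le_abs_self x))
    rw [← h2, h3, add_zero]
  have hline : ∫ x, ρ x = ∫ x in (-R)..R, ρ x := by
    rw [intervalIntegral.integral_of_le (by linarith),
      setIntegral_eq_integral_of_forall_compl_eq_zero]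
    intro x hx
    refine hsupp x (not_lt.1 fun hlt => hx ?_)
    exact ⟨(abs_lt.1 hlt).1, (abs_lt.1 hlt).2.le⟩
  have hprod : Integrable (Function.uncurry fun x η =>
      ρ x * (Ioi (labelPos κ v₀ u₀ η t)).indicator 1 x * v₀ η)
      (volume.prod (volume.restrict (Icc (-K) K))) := by
    have hv : Integrable v₀ (volume.restrict (Icc (-K) K)) :=
      (h.bounded_density.locallyIntegrable h.measurable_density).integrableOn_isCompact
        isCompact_Icc
    have hbase := (hint univ).mul_prod hv
    rw [Measure.restrict_univ] at hbase
    have hset : MeasurableSet {p : ℝ × ℝ | labelPos κ v₀ u₀ p.2 t < p.1} :=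
      measurableSet_lt (hX.comp measurable_snd) measurable_fst
    refine (hbase.indicator hset).congr (ae_of_all _ fun p => ?_)
    by_cases hp : labelPos κ v₀ u₀ p.2 t < p.1 <;> simp [Function.uncurry, hp]
  have hρint : Integrable fun x => cumMass v₀ (-K) * ρ x := by
    simpa using (hint univ).const_mul (cumMass v₀ (-K))
  simp only [hkey]
  have hout : Integrable fun x => ∫ η in Icc (-K) K,
      ρ x * (Ioi (labelPos κ v₀ u₀ η t)).indicator 1 x * v₀ η := hprod.integral_prod_left
  rw [integral_add hρint hout, integral_const_mul, hline,
    integral_integral_swap hprod]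
  simp only [hinner]

end InitialData

/-! ### Local bounds and measurability in the upper half plane -/

namespace LocallyBoundedUpperHalf

variable {w w' : ℝ → ℝ → ℝ}

theorem add (hw : LocallyBoundedUpperHalf w) (hw' : LocallyBoundedUpperHalf w') :
    LocallyBoundedUpperHalf fun x t => w x t + w' x t := by
  intro R a b ha
  obtain ⟨C, hC⟩ := hw R a b ha
  obtain ⟨D, hD⟩ := hw' R a b ha
  exact ⟨C + D, fun x hx t ht => (abs_add_le _ _).trans (add_le_add (hC x hx t ht) (hD x hx t ht))⟩

theorem sub (hw : LocallyBoundedUpperHalf w) (hw' : LocallyBoundedUpperHalf w') :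
    LocallyBoundedUpperHalf fun x t => w x t - w' x t := by
  intro R a b ha
  obtain ⟨C, hC⟩ := hw R a b ha
  obtain ⟨D, hD⟩ := hw' R a b ha
  exact ⟨C + D, fun x hx t ht => (abs_sub _ _).trans (add_le_add (hC x hx t ht) (hD x hx t ht))⟩

theorem mul (hw : LocallyBoundedUpperHalf w) (hw' : LocallyBoundedUpperHalf w') :
    LocallyBoundedUpperHalf fun x t => w x t * w' x t := by
  intro R a b ha
  obtain ⟨C, hC⟩ := hw R a b ha
  obtain ⟨D, hD⟩ := hw' R a b ha
  refine ⟨C * D, fun x hx t ht => ?_⟩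
  rw [abs_mul]
  exact mul_le_mul (hC x hx t ht) (hD x hx t ht) (abs_nonneg _)
    ((abs_nonneg _).trans (hC x hx t ht))

theorem of_continuousOn (hw : ContinuousOn (Function.uncurry w) (univ ×ˢ Ioi (0 : ℝ))) :
    LocallyBoundedUpperHalf w := by
  intro R a b ha
  obtain ⟨C, hC⟩ := (isCompact_Icc.prod isCompact_Icc).exists_bound_of_continuousOn
    (hw.mono (prod_mono (subset_univ (Icc (-R) R))
      (fun t ht => ha.trans_le ht.1 : Icc a b ⊆ Ioi (0 : ℝ))))
  exact ⟨C, fun x hx t ht => hC (x, t) ⟨hx, ht⟩⟩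

theorem of_continuous (hw : Continuous (Function.uncurry w)) : LocallyBoundedUpperHalf w :=
  of_continuousOn hw.continuousOn

theorem of_time {c : ℝ → ℝ} (hc : ContinuousOn c (Ioi 0)) :
    LocallyBoundedUpperHalf fun _ t => c t :=
  of_continuousOn (hc.comp continuous_snd.continuousOn fun _ hp => hp.2)

theorem of_space {f : ℝ → ℝ} (hf : LocallyBounded f) :
    LocallyBoundedUpperHalf fun x _ => f x := by
  intro R a b _
  obtain ⟨C, hC⟩ := hf R
  exact ⟨C, fun x hx _ _ => hC x hx⟩

end LocallyBoundedUpperHalf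

/-- A function which is measurable on the open upper half plane is almost everywhere strongly
measurable for product measures carried by it. -/
theorem aestronglyMeasurable_of_upperHalf {w : ℝ → ℝ → ℝ}
    (hw : Measurable fun p : ℝ × Ioi (0 : ℝ) => w p.1 p.2) {S T : Set ℝ} (hS : MeasurableSet S)
    (hT : MeasurableSet T) (hTpos : T ⊆ Ioi 0) :
    AEStronglyMeasurable (fun p : ℝ × ℝ => w p.1 p.2)
      ((volume.restrict S).prod (volume.restrict T)) := by
  have hemb : MeasurableEmbedding (Prod.map id Subtype.val : ℝ × Ioi (0 : ℝ) → ℝ × ℝ) :=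
    MeasurableEmbedding.id.prodMap (MeasurableEmbedding.subtype_coe measurableSet_Ioi)
  have hext := hemb.measurable_extend hw (measurable_const (a := (0 : ℝ)))
  refine ⟨_, hext.stronglyMeasurable, ?_⟩
  rw [Measure.prod_restrict]
  filter_upwards [ae_restrict_mem (hS.prod hT)] with p hp
  exact (hemb.injective.extend_apply (fun p : ℝ × Ioi (0 : ℝ) => w p.1 p.2) (fun _ => (0 : ℝ))
    (p.1, ⟨p.2, hTpos hp.2⟩)).symm

theorem measurable_time_slice {w : ℝ → ℝ → ℝ}
    (hw : Measurable fun p : ℝ × Ioi (0 : ℝ) => w p.1 p.2) {t : ℝ} (ht : 0 < t) :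
    Measurable fun x => w x t :=
  Measurable.comp (g := fun p : ℝ × Ioi (0 : ℝ) => w p.1 p.2)
    (f := fun x : ℝ => (x, (⟨t, ht⟩ : Ioi (0 : ℝ)))) hw (measurable_id.prodMk measurable_const)

/-! ### Test functions -/

theorem partialX_eq_fderiv {φ : ℝ × ℝ → ℝ} {x t : ℝ} (hφ : DifferentiableAt ℝ φ (x, t)) :
    partialX φ x t = fderiv ℝ φ (x, t) (1, 0) := by
  have h1 : HasDerivAt (fun z : ℝ => (z, t)) ((1 : ℝ), (0 : ℝ)) x :=
    (hasDerivAt_id x).prodMk (hasDerivAt_const x t)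
  exact (hφ.hasFDerivAt.comp_hasDerivAt x h1).deriv

theorem partialT_eq_fderiv {φ : ℝ × ℝ → ℝ} {x t : ℝ} (hφ : DifferentiableAt ℝ φ (x, t)) :
    partialT φ x t = fderiv ℝ φ (x, t) (0, 1) := by
  have h1 : HasDerivAt (fun s : ℝ => (x, s)) ((0 : ℝ), (1 : ℝ)) t :=
    (hasDerivAt_const t x).prodMk (hasDerivAt_id t)
  exact (hφ.hasFDerivAt.comp_hasDerivAt t h1).deriv

/-- The chain rule along a path which has a one-sided derivative. -/
theorem hasDerivWithinAt_comp_path {G : ℝ × ℝ → ℝ} {X : ℝ → ℝ} {u t : ℝ} {s : Set ℝ}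
    (hG : DifferentiableAt ℝ G (X t, t)) (hX : HasDerivWithinAt X u s t) :
    HasDerivWithinAt (fun r => G (X r, r)) (partialT G (X t) t + partialX G (X t) t * u) s t := by
  have h1 : HasDerivWithinAt (fun r : ℝ => (X r, r)) (u, (1 : ℝ)) s t :=
    hX.prodMk (hasDerivWithinAt_id t s)
  refine (HasFDerivAt.comp_hasDerivWithinAt (f := fun r => (X r, r)) t hG.hasFDerivAt
    h1).congr_deriv ?_
  rw [partialX_eq_fderiv hG, partialT_eq_fderiv hG,
    show ((u, (1 : ℝ)) : ℝ × ℝ) = (0, 1) + u • (1, 0) by simp, map_add, map_smul, smul_eq_mul]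
  ring

namespace IsTestFunction

variable {φ : ℝ × ℝ → ℝ}

theorem differentiable (hφ : IsTestFunction φ) : Differentiable ℝ φ :=
  hφ.1.differentiable (by simp)

theorem continuous (hφ : IsTestFunction φ) :
    Continuous (Function.uncurry fun x t => φ (x, t)) := hφ.1.continuous

theorem continuous_partialX (hφ : IsTestFunction φ) :
    Continuous (Function.uncurry (partialX φ)) := by
  have : Function.uncurry (partialX φ) = fun p => fderiv ℝ φ p (1, 0) :=
    funext fun p => partialX_eq_fderiv (hφ.differentiable p)
  rw [this]
  exact (hφ.1.continuous_fderiv (by simp)).clm_apply continuous_const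

theorem continuous_partialT (hφ : IsTestFunction φ) :
    Continuous (Function.uncurry (partialT φ)) := by
  have : Function.uncurry (partialT φ) = fun p => fderiv ℝ φ p (0, 1) :=
    funext fun p => partialT_eq_fderiv (hφ.differentiable p)
  rw [this]
  exact (hφ.1.continuous_fderiv (by simp)).clm_apply continuous_const

/-- A test function vanishes, with its derivatives, off the interior of a box. -/
theorem exists_box (hφ : IsTestFunction φ) :
    ∃ R α β : ℝ, 0 < R ∧ 0 < α ∧ α < β ∧ ∀ x t, (R ≤ |x| ∨ t ≤ α ∨ β ≤ t) →
      φ (x, t) = 0 ∧ partialX φ x t = 0 ∧ partialT φ x t = 0 := by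
  obtain ⟨-, hc, hsub⟩ := id hφ
  obtain ⟨C, hC⟩ := hc.isCompact.exists_bound_of_continuousOn (f := id) continuousOn_id
  obtain ⟨D, hD⟩ := hc.isCompact.exists_bound_of_continuousOn (f := fun p : ℝ × ℝ => p.2⁻¹)
    (continuous_snd.continuousOn.inv₀ fun p hp => ne_of_gt (hsub hp).2)
  have hD1 : 0 < max D 1 := lt_max_of_lt_right one_pos
  have hC1 : 0 < max C 1 := lt_max_of_lt_right one_pos
  refine ⟨max C 1 + 1, (max D 1 + 1)⁻¹, max C 1 + (max D 1 + 1)⁻¹ + 1, by positivity,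
    by positivity, by linarith, fun x t hxt => ?_⟩
  have hnot : (x, t) ∉ tsupport φ := by
    intro hmem
    have h1 := hC _ hmem
    have h2 := hD _ hmem
    have ht : 0 < t := (hsub hmem).2
    have hx' : |x| ≤ C := (norm_fst_le (x, t)).trans h1
    have ht' : |t| ≤ C := (norm_snd_le (x, t)).trans h1
    have hi : (0 : ℝ) < (max D 1 + 1)⁻¹ := by positivity
    have hCm := le_max_left C 1
    rcases hxt with h | h | h
    · linarith
    · simp only [norm_inv, Real.norm_eq_abs, abs_of_pos ht] at h2
      have h3 : max D 1 + 1 ≤ t⁻¹ := by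
        rw [← inv_inv (max D 1 + 1)]
        exact inv_anti₀ ht h
      linarith [le_max_left D 1]
    · linarith [le_abs_self t]
  have hf : fderiv ℝ φ (x, t) = 0 := fderiv_of_notMem_tsupport ℝ hnot
  refine ⟨image_eq_zero_of_notMem_tsupport hnot, ?_, ?_⟩
  · rw [partialX_eq_fderiv (hφ.differentiable _), hf]; rfl
  · rw [partialT_eq_fderiv (hφ.differentiable _), hf]; rfl

end IsTestFunction

/-- The primitive in `x` of a test function, normalized to vanish at `R`. -/
noncomputable def primitiveX (φ : ℝ × ℝ → ℝ) (R : ℝ) (p : ℝ × ℝ) : ℝ :=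
  ∫ z in p.1..R, φ (z, p.2)

theorem continuous_integral_left {f : ℝ → ℝ → ℝ} (hf : Continuous (Function.uncurry f)) (R : ℝ) :
    Continuous fun p : ℝ × ℝ => ∫ z in p.1..R, f z p.2 := by
  simp only [intervalIntegral.integral_symm R]
  have h1 : Continuous (Function.uncurry fun (p : ℝ × ℝ) (z : ℝ) => f z p.2) :=
    hf.comp (continuous_snd.prodMk (continuous_snd.comp continuous_fst))
  exact (intervalIntegral.continuous_parametric_intervalIntegral_of_continuous (a₀ := R) h1
    continuous_fst).neg

namespace IsTestFunction

variable {φ : ℝ × ℝ → ℝ}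

theorem hasDerivAt_primitiveX_fst (hφ : IsTestFunction φ) (R x t : ℝ) :
    HasDerivAt (fun z => primitiveX φ R (z, t)) (-φ (x, t)) x := by
  have hc : Continuous fun z => φ (z, t) := hφ.1.continuous.comp (by fun_prop)
  exact intervalIntegral.integral_hasDerivAt_left (hc.intervalIntegrable _ _)
    (hc.stronglyMeasurableAtFilter _ _) hc.continuousAt

theorem hasDerivAt_primitiveX_snd (hφ : IsTestFunction φ) (R x t : ℝ) :
    HasDerivAt (fun s => primitiveX φ R (x, s)) (∫ z in x..R, partialT φ z t) t := by
  obtain ⟨C, hC⟩ := (HasCompactSupport.fderiv (𝕜 := ℝ) hφ.2.1).exists_bound_of_continuous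
    (hφ.1.continuous_fderiv (by simp))
  have hcont : ∀ s, Continuous fun z => φ (z, s) := fun s => hφ.1.continuous.comp (by fun_prop)
  have hcontT : ∀ s, Continuous fun z => partialT φ z s := fun s =>
    hφ.continuous_partialT.comp (continuous_id.prodMk continuous_const)
  refine (intervalIntegral.hasDerivAt_integral_of_dominated_loc_of_deriv_le
    (F := fun s z => φ (z, s)) (F' := fun s z => partialT φ z s) (bound := fun _ => C)
    (s := univ) univ_mem (Eventually.of_forall fun s => (hcont s).aestronglyMeasurable)
    ((hcont t).intervalIntegrable _ _) (hcontT t).aestronglyMeasurable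
    (ae_of_all _ fun z _ s _ => ?_) intervalIntegrable_const
    (ae_of_all _ fun z _ s _ => ?_)).2
  · rw [partialT_eq_fderiv (hφ.differentiable _)]
    refine ((fderiv ℝ φ (z, s)).le_opNorm _).trans ?_
    simpa using hC (z, s)
  · have h1 : HasDerivAt (fun s : ℝ => (z, s)) ((0 : ℝ), (1 : ℝ)) s :=
      (hasDerivAt_const s z).prodMk (hasDerivAt_id s)
    rw [partialT_eq_fderiv (hφ.differentiable _)]
    exact ((hφ.differentiable (z, s)).hasFDerivAt.comp_hasDerivAt s h1)

theorem differentiable_primitiveX (hφ : IsTestFunction φ) (R : ℝ) :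
    Differentiable ℝ (primitiveX φ R) := by
  intro p
  have h1 : Continuous fun p : ℝ × ℝ => -φ p := hφ.1.continuous.neg
  have h2 := continuous_integral_left hφ.continuous_partialT R
  have key := hasStrictFDerivAt_uncurry_coprod (𝕜 := ℝ) (u := p)
    (f := fun x t => primitiveX φ R (x, t))
    (f₁ := fun x t => ContinuousLinearMap.toSpanSingleton ℝ (-φ (x, t)))
    (f₂ := fun x t => ContinuousLinearMap.toSpanSingleton ℝ (∫ z in x..R, partialT φ z t))
    (Eventually.of_forall fun v => (hφ.hasDerivAt_primitiveX_fst R v.1 v.2).hasFDerivAt)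
    (Eventually.of_forall fun v => (hφ.hasDerivAt_primitiveX_snd R v.1 v.2).hasFDerivAt)
    (((ContinuousLinearMap.toSpanSingletonCLE (𝕜 := ℝ) (E := ℝ)).continuous.comp h1).continuousAt)
    (((ContinuousLinearMap.toSpanSingletonCLE (𝕜 := ℝ) (E := ℝ)).continuous.comp h2).continuousAt)
  exact key.hasFDerivAt.differentiableAt

end IsTestFunction

namespace InitialData

variable {κ : ℝ} {v₀ u₀ : ℝ → ℝ}

/-! ### Integration along particle paths -/

theorem locallyBounded_comp_labelPos (h : InitialData κ v₀ u₀) (hA : MinimumAttained κ v₀ u₀)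
    {w : ℝ → ℝ → ℝ} (hw : LocallyBoundedUpperHalf w) :
    LocallyBoundedUpperHalf fun η t => w (labelPos κ v₀ u₀ η t) t := by
  intro K a b ha
  obtain ⟨R, hR⟩ := h.exists_abs_labelPos_le hA b K
  obtain ⟨C, hC⟩ := hw R a b ha
  exact ⟨C, fun η hη t ht =>
    hC _ (abs_le.1 (hR t (ha.trans_le ht.1) ht.2 η (abs_le.2 hη))) t ht⟩

theorem measurable_comp_labelPos (h : InitialData κ v₀ u₀) (hA : MinimumAttained κ v₀ u₀)
    {w : ℝ → ℝ → ℝ} (hw : Measurable fun p : ℝ × Ioi (0 : ℝ) => w p.1 p.2) :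
    Measurable fun p : ℝ × Ioi (0 : ℝ) => w (labelPos κ v₀ u₀ p.1 p.2) p.2 :=
  Measurable.comp (g := fun p : ℝ × Ioi (0 : ℝ) => w p.1 p.2)
    (f := fun p : ℝ × Ioi (0 : ℝ) => (labelPos κ v₀ u₀ p.1 p.2, p.2)) hw
    ((h.measurable_labelPos hA).prodMk measurable_snd)

theorem measurable_upperHalf_of_continuous {w : ℝ → ℝ → ℝ}
    (hw : Continuous (Function.uncurry w)) :
    Measurable fun p : ℝ × Ioi (0 : ℝ) => w p.1 p.2 :=
  Measurable.comp (g := Function.uncurry w) (f := fun p : ℝ × Ioi (0 : ℝ) => (p.1, (p.2 : ℝ)))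
    hw.measurable (measurable_fst.prodMk (measurable_subtype_coe.comp measurable_snd))

/-- Fubini's theorem for functions of label and time. -/
theorem fubini_labels (h : InitialData κ v₀ u₀) {H : ℝ → ℝ → ℝ}
    (hH : Measurable fun p : ℝ × Ioi (0 : ℝ) => H p.1 p.2) (hb : LocallyBoundedUpperHalf H)
    {α β : ℝ} (hα : 0 < α) (hαβ : α ≤ β) (K : ℝ) :
    IntegrableOn (fun t => ∫ η in Icc (-K) K, H η t * v₀ η) (Ioc α β) ∧
    (∀ η, IntervalIntegrable (H η) volume α β) ∧
    IntegrableOn (fun η => (∫ t in α..β, H η t) * v₀ η) (Icc (-K) K) ∧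
    ∫ t in Ioc α β, ∫ η in Icc (-K) K, H η t * v₀ η
      = ∫ η in Icc (-K) K, (∫ t in α..β, H η t) * v₀ η := by
  have hpos : Ioc α β ⊆ Ioi 0 := fun t ht => hα.trans ht.1
  have hmeas : Measurable fun p : ℝ × Ioi (0 : ℝ) => H p.1 p.2 * v₀ p.1 :=
    hH.mul (h.measurable_density.comp measurable_fst)
  have hint : Integrable (fun p : ℝ × ℝ => H p.1 p.2 * v₀ p.1)
      ((volume.restrict (Icc (-K) K)).prod (volume.restrict (Ioc α β))) := by
    obtain ⟨C, hC⟩ := (hb.mul (.of_space h.bounded_density)) K α β hα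
    refine Integrable.of_bound (aestronglyMeasurable_of_upperHalf (w := fun η t => H η t * v₀ η)
      hmeas measurableSet_Icc measurableSet_Ioc hpos) C ?_
    rw [Measure.prod_restrict]
    filter_upwards [ae_restrict_mem (measurableSet_Icc.prod measurableSet_Ioc)] with p hp
    exact hC p.1 hp.1 p.2 (Ioc_subset_Icc_self hp.2)
  have hslice : ∀ η, IntervalIntegrable (H η) volume α β := by
    intro η
    obtain ⟨C, hC⟩ := hb |η| α β hα
    have hm : Measurable fun s : Ioi (0 : ℝ) => H η s :=
      Measurable.comp (g := fun p : ℝ × Ioi (0 : ℝ) => H p.1 p.2)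
        (f := fun s : Ioi (0 : ℝ) => (η, s)) hH (measurable_const.prodMk measurable_id)
    have hm' : AEStronglyMeasurable (H η) (volume.restrict (Ioi 0)) := by
      have := (MeasurableEmbedding.subtype_coe (measurableSet_Ioi (a := (0 : ℝ)))).measurable_extend
        hm (measurable_const (a := (0 : ℝ)))
      refine ⟨_, this.stronglyMeasurable, ?_⟩
      filter_upwards [ae_restrict_mem measurableSet_Ioi] with t ht
      exact (Subtype.val_injective.extend_apply (fun s : Ioi (0 : ℝ) => H η s)
        (fun _ => (0 : ℝ)) ⟨t, ht⟩).symm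
    rw [intervalIntegrable_iff, uIoc_of_le hαβ]
    refine Integrable.of_bound (hm'.mono_measure (Measure.restrict_mono hpos le_rfl)) C ?_
    filter_upwards [ae_restrict_mem measurableSet_Ioc] with t ht
    exact hC η (abs_le.1 le_rfl) t (Ioc_subset_Icc_self ht)
  have heq : ∀ η, ∫ t in Ioc α β, H η t * v₀ η = (∫ t in α..β, H η t) * v₀ η := by
    intro η
    rw [integral_mul_const, intervalIntegral.integral_of_le hαβ]
  refine ⟨hint.integral_prod_right, hslice, ?_, ?_⟩
  · have := hint.integral_prod_left
    simp only [heq] at this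
    exact this
  · have := integral_integral_swap (f := fun η t => H η t * v₀ η) hint
    simp only [heq] at this
    exact this.symm

/-- The integral over a time interval of the derivative of a quantity carried by a regular
particle. -/
theorem integral_derivative_along_path (h : InitialData κ v₀ u₀) (hA : MinimumAttained κ v₀ u₀)
    {η α β : ℝ} (hη : IsRegularLabel v₀ u₀ η) (hα : 0 < α) (hαβ : α ≤ β) {f f' : ℝ → ℝ}
    (hf : ContinuousOn f (Icc α β)) (hi : IntervalIntegrable f' volume α β)
    (hd : ∀ t, 0 < t → HasDerivWithinAt (fun s => labelPos κ v₀ u₀ η s)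
      (velocity κ v₀ u₀ (labelPos κ v₀ u₀ η t) t) (Ioi t) t → HasDerivWithinAt f (f' t) (Ioi t) t) :
    ∫ t in α..β, f' t = f β - f α := by
  obtain ⟨τ, hτ⟩ := h.exists_hasDerivWithinAt_labelPos hA hη
  exact integral_eq_sub_of_hasDerivWithinAt_of_ne τ hαβ hf
    (fun t ht hne => hd t (hα.trans ht.1) (hτ t (hα.trans ht.1) hne)) hi

theorem continuousOn_labelPos (h : InitialData κ v₀ u₀) (hA : MinimumAttained κ v₀ u₀)
    {α : ℝ} (hα : 0 < α) (β η : ℝ) :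
    ContinuousOn (fun t => labelPos κ v₀ u₀ η t) (Icc α β) := fun _ ht =>
  (h.continuousAt_labelPos hA (hα.trans_le ht.1) η).continuousWithinAt

theorem integrable_of_vanishing (h : InitialData κ v₀ u₀) (hA : MinimumAttained κ v₀ u₀)
    {t R : ℝ} (ht : 0 < t) {g : ℝ → ℝ} (hg : Measurable g) (hb : LocallyBounded g)
    (hs : ∀ x, R ≤ |x| → g x = 0) :
    Integrable g (stieltjesMeasure fun x => mass κ v₀ u₀ x t) := by
  obtain ⟨K, -, hK⟩ := h.exists_abs_label_le hA t R
  obtain ⟨C, hC⟩ := hb R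
  refine h.integrable_stieltjesMeasure hA ht hg (h.integrable_mul_density
    (hg.comp (h.monotone_labelPos hA ht).measurable) (K := K) (C := |C|) (fun η _ => ?_)
    fun η hη => hs _ ?_)
  · rcases le_or_gt R |labelPos κ v₀ u₀ η t| with hx | hx
    · simp [hs _ hx]
    · exact (hC _ (abs_le.1 hx.le)).trans (le_abs_self C)
  · by_contra hlt
    exact absurd ((hK t ht le_rfl).2 η (not_le.1 hlt).le) (not_le.2 hη)

theorem integral_of_vanishing (h : InitialData κ v₀ u₀) (hA : MinimumAttained κ v₀ u₀)
    {t R K : ℝ} (ht : 0 < t) (hK : ∀ η, |labelPos κ v₀ u₀ η t| ≤ R → |η| ≤ K)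
    {g : ℝ → ℝ} (hg : Measurable g) (hs : ∀ x, R ≤ |x| → g x = 0) :
    ∫ x, g x ∂(stieltjesMeasure fun x => mass κ v₀ u₀ x t)
      = ∫ η in Icc (-K) K, g (labelPos κ v₀ u₀ η t) * v₀ η := by
  rw [h.integral_stieltjesMeasure hA ht hg, setIntegral_eq_integral_of_forall_compl_eq_zero]
  intro η hη
  rw [hs, zero_mul]
  by_contra hlt
  exact hη (abs_le.1 (hK η (not_le.1 hlt).le))

/-- The distributional derivative of `m(·, t)` is its Lebesgue–Stieltjes measure. -/
theorem distributional_derivative (h : InitialData κ v₀ u₀) (hA : MinimumAttained κ v₀ u₀)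
    {t : ℝ} (ht : 0 < t) {ψ : ℝ → ℝ} (hψ : ContDiff ℝ ∞ ψ) (hc : HasCompactSupport ψ) :
    -∫ x, deriv ψ x * mass κ v₀ u₀ x t
      = ∫ x, ψ x ∂(stieltjesMeasure fun x => mass κ v₀ u₀ x t) := by
  obtain ⟨C, hC⟩ := hc.isCompact.exists_bound_of_continuousOn (f := id) continuousOn_id
  set R := max C 0 + 1
  have hR0 : 0 < R := by positivity
  have hnot : ∀ x, R ≤ |x| → x ∉ tsupport ψ := fun x hx hmem => by
    have h1 : |x| ≤ C := hC x hmem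
    linarith [le_max_left C 0]
  have hψ0 : ∀ x, R ≤ |x| → ψ x = 0 := fun x hx => image_eq_zero_of_notMem_tsupport (hnot x hx)
  have hψ'0 : ∀ x, R ≤ |x| → deriv ψ x = 0 := fun x hx =>
    image_eq_zero_of_notMem_tsupport fun hmem => hnot x hx (tsupport_deriv_subset hmem)
  have hcd : Continuous (deriv ψ) := hψ.continuous_deriv (by simp)
  have hftc : ∀ a b : ℝ, ∫ x in a..b, deriv ψ x = ψ b - ψ a := fun a b =>
    intervalIntegral.integral_deriv_eq_sub (fun x _ => hψ.differentiable (by simp) x)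
      (hcd.intervalIntegrable _ _)
  obtain ⟨K, hK0, hK⟩ := h.exists_abs_label_le hA t R
  rw [h.integral_mul_mass hA ht hR0.le hK0.le (hK t ht le_rfl).1 hcd hψ'0,
    h.integral_of_vanishing hA ht (hK t ht le_rfl).2 hψ.continuous.measurable hψ0]
  simp only [hftc, hψ0 R (le_abs_self R), hψ0 (-R) (by simp [abs_of_pos hR0]), sub_self, mul_zero,
    zero_add, zero_sub, neg_mul, integral_neg, neg_neg]

/-! ### Conservation of mass -/

/-- The properties of a test function that enter the weak formulation, together with a bound for
the labels of the particles that it meets. -/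
theorem exists_box_labels (h : InitialData κ v₀ u₀) (hA : MinimumAttained κ v₀ u₀)
    {φ : ℝ × ℝ → ℝ} (hφ : IsTestFunction φ) :
    ∃ R α β K : ℝ, 0 < R ∧ 0 < α ∧ α < β ∧ 0 < K ∧
      (∀ x t, (R ≤ |x| ∨ t ≤ α ∨ β ≤ t) →
        φ (x, t) = 0 ∧ partialX φ x t = 0 ∧ partialT φ x t = 0) ∧
      ∀ t ∈ Ioc α β, 0 < t ∧ (∀ x, |x| ≤ R → ∀ y ∈ minimizers κ v₀ u₀ x t, |y| ≤ K) ∧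
        ∀ η, |labelPos κ v₀ u₀ η t| ≤ R → |η| ≤ K := by
  obtain ⟨R, α, β, hR, hα, hαβ, hbox⟩ := hφ.exists_box
  obtain ⟨K, hK0, hK⟩ := h.exists_abs_label_le hA β R
  exact ⟨R, α, β, K, hR, hα, hαβ, hK0, hbox, fun t ht =>
    ⟨hα.trans ht.1, hK t (hα.trans ht.1) ht.2⟩⟩

theorem Ioc_subset_Ioi_zero {α β : ℝ} (hα : 0 < α) : Ioc α β ⊆ Ioi 0 := fun _ ht => hα.trans ht.1

theorem eq_zero_of_mem_sdiff_Ioc {α β : ℝ} {f : ℝ → ℝ} (hf : ∀ t, t ≤ α ∨ β ≤ t → f t = 0) :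
    ∀ t ∈ Ioi (0 : ℝ) \ Ioc α β, f t = 0 := by
  intro t ht
  refine hf t ?_
  by_contra hcon
  push Not at hcon
  exact ht.2 ⟨hcon.1, hcon.2.le⟩

/-- The flux term of the mass balance, in Lagrangian form. -/
theorem mass_flux (h : InitialData κ v₀ u₀) (hA : MinimumAttained κ v₀ u₀) {φ : ℝ × ℝ → ℝ}
    (hφ : IsTestFunction φ) {t R K : ℝ} (ht : 0 < t)
    (hK : ∀ η, |labelPos κ v₀ u₀ η t| ≤ R → |η| ≤ K) (h0 : ∀ x, R ≤ |x| → φ (x, t) = 0) :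
    ∫ x, φ (x, t) * velocity κ v₀ u₀ x t ∂(stieltjesMeasure fun x => mass κ v₀ u₀ x t)
      = ∫ η in Icc (-K) K, φ (labelPos κ v₀ u₀ η t, t)
          * velocity κ v₀ u₀ (labelPos κ v₀ u₀ η t) t * v₀ η :=
  h.integral_of_vanishing hA ht hK
    (((measurable_time_slice (measurable_upperHalf_of_continuous hφ.continuous) ht)).mul
      (measurable_time_slice (h.measurable_velocityField hA) ht))
    fun x hx => by rw [h0 x hx, zero_mul]

theorem measurable_testFunction_mul_velocity (h : InitialData κ v₀ u₀)
    (hA : MinimumAttained κ v₀ u₀) {φ : ℝ × ℝ → ℝ} (hφ : IsTestFunction φ) :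
    Measurable fun p : ℝ × Ioi (0 : ℝ) => φ (labelPos κ v₀ u₀ p.1 p.2, p.2)
      * velocity κ v₀ u₀ (labelPos κ v₀ u₀ p.1 p.2) p.2 :=
  (h.measurable_comp_labelPos hA (measurable_upperHalf_of_continuous hφ.continuous)).mul
    (h.measurable_comp_labelPos hA (h.measurable_velocityField hA))

theorem locallyBounded_testFunction_mul_velocity (h : InitialData κ v₀ u₀)
    (hA : MinimumAttained κ v₀ u₀) {φ : ℝ × ℝ → ℝ} (hφ : IsTestFunction φ) :
    LocallyBoundedUpperHalf fun η t => φ (labelPos κ v₀ u₀ η t, t)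
      * velocity κ v₀ u₀ (labelPos κ v₀ u₀ η t) t :=
  (h.locallyBounded_comp_labelPos hA (.of_continuous hφ.continuous)).mul
    (h.locallyBounded_comp_labelPos hA (h.locallyBounded_velocity hA))

theorem integrable_mass_outer (h : InitialData κ v₀ u₀) (hA : MinimumAttained κ v₀ u₀)
    {φ : ℝ × ℝ → ℝ} (hφ : IsTestFunction φ) :
    IntegrableOn (fun t => ∫ x, φ (x, t) * velocity κ v₀ u₀ x t
      ∂(stieltjesMeasure fun x => mass κ v₀ u₀ x t)) (Ioi (0 : ℝ)) := by
  obtain ⟨R, α, β, K, hR, hα, hαβ, hK0, hbox, hK⟩ := h.exists_box_labels hA hφ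
  have hF := (h.fubini_labels (h.measurable_testFunction_mul_velocity hA hφ)
    (h.locallyBounded_testFunction_mul_velocity hA hφ) hα hαβ.le K).1
  refine IntegrableOn.of_forall_sdiff_eq_zero (s := Ioc α β) (hF.congr_fun (fun t ht => ?_)
    measurableSet_Ioc) measurableSet_Ioi (eq_zero_of_mem_sdiff_Ioc fun t ht => ?_)
  · exact (h.mass_flux hA hφ (hK t ht).1 (hK t ht).2.2 fun x hx => (hbox x t (.inl hx)).1).symm
  · simp [fun x => (hbox x t (.inr ht)).1]

/-- The mass balance: for each particle the integral of `∫ φ_t dx` over the points to its right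
and the integral of `φ u` along its path cancel. -/
theorem mass_identity (h : InitialData κ v₀ u₀) (hA : MinimumAttained κ v₀ u₀)
    {φ : ℝ × ℝ → ℝ} (hφ : IsTestFunction φ) :
    (∫ t in Ioi (0 : ℝ), ∫ x, partialT φ x t * mass κ v₀ u₀ x t)
      - (∫ t in Ioi (0 : ℝ), ∫ x, φ (x, t) * velocity κ v₀ u₀ x t
          ∂(stieltjesMeasure fun x => mass κ v₀ u₀ x t)) = 0 := by
  obtain ⟨R, α, β, K, hR, hα, hαβ, hK0, hbox, hK⟩ := h.exists_box_labels hA hφ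
  have hsub : Ioc α β ⊆ Ioi 0 := Ioc_subset_Ioi_zero hα
  have hc := continuous_integral_left hφ.continuous_partialT R
  have hc' : Continuous (Function.uncurry fun x t => ∫ z in x..R, partialT φ z t) := hc
  have hG0 : ∀ x t, (t ≤ α ∨ β ≤ t) → primitiveX φ R (x, t) = 0 := fun x t ht => by
    simp [primitiveX, fun z => (hbox z t (.inr ht)).1]
  obtain ⟨hF₁int, hi₁, hi₁', hF₁⟩ := h.fubini_labels
    (H := fun η t => ∫ z in (labelPos κ v₀ u₀ η t)..R, partialT φ z t)
    (h.measurable_comp_labelPos hA (measurable_upperHalf_of_continuous hc'))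
    (h.locallyBounded_comp_labelPos hA (.of_continuous hc')) hα hαβ.le K
  obtain ⟨-, hi₂, hi₂', hF₂⟩ := h.fubini_labels (h.measurable_testFunction_mul_velocity hA hφ)
    (h.locallyBounded_testFunction_mul_velocity hA hφ) hα hαβ.le K
  have hctime : Continuous fun t => ∫ z in (-R)..R, partialT φ z t :=
    hc.comp (continuous_const.prodMk continuous_id)
  -- the part of the mass carried by labels below `-K` contributes a total derivative in time
  have hconst : ∫ t in α..β, ∫ z in (-R)..R, partialT φ z t = 0 := by
    rw [intervalIntegral.integral_eq_sub_of_hasDerivAt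
      (fun t _ => hφ.hasDerivAt_primitiveX_snd R (-R) t) (hctime.intervalIntegrable _ _),
      hG0 _ _ (.inr le_rfl), hG0 _ _ (.inl le_rfl), sub_self]
  have hleft : ∫ t in Ioi (0 : ℝ), ∫ x, partialT φ x t * mass κ v₀ u₀ x t
      = ∫ η in Icc (-K) K,
        (∫ t in α..β, ∫ z in (labelPos κ v₀ u₀ η t)..R, partialT φ z t) * v₀ η := by
    rw [setIntegral_eq_of_subset_of_forall_sdiff_eq_zero measurableSet_Ioi hsub
      (eq_zero_of_mem_sdiff_Ioc fun t ht => by simp [fun x => (hbox x t (.inr ht)).2.2]), ← hF₁]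
    have hrw : ∀ t ∈ Ioc α β, ∫ x, partialT φ x t * mass κ v₀ u₀ x t
        = cumMass v₀ (-K) * (∫ z in (-R)..R, partialT φ z t)
          + ∫ η in Icc (-K) K, (∫ z in (labelPos κ v₀ u₀ η t)..R, partialT φ z t) * v₀ η :=
      fun t ht => h.integral_mul_mass hA (hK t ht).1 hR.le hK0.le (hK t ht).2.1
        (hφ.continuous_partialT.comp (continuous_id.prodMk continuous_const))
        fun x hx => (hbox x t (.inl hx)).2.2
    rw [setIntegral_congr_fun measurableSet_Ioc hrw, integral_add
      ((hctime.integrableOn_Ioc).const_mul _) hF₁int, integral_const_mul,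
      ← intervalIntegral.integral_of_le hαβ.le, hconst, mul_zero, zero_add]
  have hright : ∫ t in Ioi (0 : ℝ), ∫ x, φ (x, t) * velocity κ v₀ u₀ x t
        ∂(stieltjesMeasure fun x => mass κ v₀ u₀ x t)
      = ∫ η in Icc (-K) K, (∫ t in α..β, φ (labelPos κ v₀ u₀ η t, t)
          * velocity κ v₀ u₀ (labelPos κ v₀ u₀ η t) t) * v₀ η := by
    rw [setIntegral_eq_of_subset_of_forall_sdiff_eq_zero measurableSet_Ioi hsub
      (eq_zero_of_mem_sdiff_Ioc fun t ht => by simp [fun x => (hbox x t (.inr ht)).1]), ← hF₂]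
    exact setIntegral_congr_fun measurableSet_Ioc fun t ht =>
      h.mass_flux hA hφ (hK t ht).1 (hK t ht).2.2 fun x hx => (hbox x t (.inl hx)).1
  rw [hleft, hright, ← integral_sub hi₁' hi₂']
  refine integral_eq_zero_of_ae ?_
  filter_upwards [ae_restrict_of_ae h.ae_isRegularLabel] with η hη
  have hpath := h.integral_derivative_along_path hA hη hα hαβ.le
    (f := fun t => primitiveX φ R (labelPos κ v₀ u₀ η t, t))
    ((hφ.differentiable_primitiveX R).continuous.comp_continuousOn
      ((h.continuousOn_labelPos hA hα β η).prodMk continuousOn_id))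
    ((hi₁ η).sub (hi₂ η)) fun t _ hX => by
      refine (hasDerivWithinAt_comp_path (hφ.differentiable_primitiveX R _) hX).congr_deriv ?_
      rw [partialT, partialX, (hφ.hasDerivAt_primitiveX_snd R _ t).deriv,
        (hφ.hasDerivAt_primitiveX_fst R _ t).deriv]
      ring
  rw [hG0 _ _ (.inr le_rfl), hG0 _ _ (.inl le_rfl), sub_self,
    intervalIntegral.integral_sub (hi₁ η) (hi₂ η)] at hpath
  rw [← sub_mul, hpath, zero_mul]
  rfl

end InitialData

/-! ### Balance of momentum -/

/-- The time derivative of `φ(X, t) V` along a particle path, where `V` is the characteristic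
velocity of the label. -/
noncomputable def momentumRate (κ : ℝ) (v₀ u₀ : ℝ → ℝ) (φ : ℝ × ℝ → ℝ)
    (η t : ℝ) : ℝ :=
  (partialT φ (labelPos κ v₀ u₀ η t) t
      + partialX φ (labelPos κ v₀ u₀ η t) t * velocity κ v₀ u₀ (labelPos κ v₀ u₀ η t) t)
    * charVel κ u₀ η t
  + φ (labelPos κ v₀ u₀ η t, t)
    * (1 / (t + κ) * (charPos κ u₀ η t / (t + κ) - charVel κ u₀ η t))

namespace InitialData

variable {κ : ℝ} {v₀ u₀ : ℝ → ℝ}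

theorem hasDerivAt_charVel (h : InitialData κ v₀ u₀) {t : ℝ} (ht : 0 ≤ t) (η : ℝ) :
    HasDerivAt (fun s => charVel κ u₀ η s)
      (1 / (t + κ) * (charPos κ u₀ η t / (t + κ) - charVel κ u₀ η t)) t := by
  simp only [charVel_eq]
  refine (((hasDerivAt_posRate h.kappa_pos ht).mul_const η).add
    ((hasDerivAt_velRate h.kappa_pos ht).mul_const (u₀ η))).congr_deriv ?_
  rw [charPos_eq h.kappa_pos ht]
  ring

theorem continuousOn_inv_time (h : InitialData κ v₀ u₀) :
    ContinuousOn (fun t => 1 / (t + κ)) (Ioi 0) :=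
  continuousOn_const.div (by fun_prop) fun t (ht : 0 < t) => by
    have := h.kappa_pos
    positivity

theorem locallyBounded_charVel (h : InitialData κ v₀ u₀) :
    LocallyBoundedUpperHalf fun η t => charVel κ u₀ η t := by
  have hκ := h.kappa_pos
  simp only [charVel_eq]
  exact ((LocallyBoundedUpperHalf.of_time fun t ht =>
    (hasDerivAt_posRate hκ (le_of_lt ht)).continuousAt.continuousWithinAt).mul
    (.of_space (locallyBounded_of_continuous continuous_id))).add
    ((LocallyBoundedUpperHalf.of_time fun t ht =>
    (hasDerivAt_velRate hκ (le_of_lt ht)).continuousAt.continuousWithinAt).mul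
    (.of_space h.bounded_velocity))

theorem locallyBounded_charPos (h : InitialData κ v₀ u₀) :
    LocallyBoundedUpperHalf fun η t => charPos κ u₀ η t := by
  have hκ := h.kappa_pos
  have hw : LocallyBoundedUpperHalf fun η t => posScale κ t * η + velScale κ t * u₀ η :=
    ((LocallyBoundedUpperHalf.of_time fun t ht =>
    (hasDerivAt_posScale hκ (le_of_lt ht)).continuousAt.continuousWithinAt).mul
    (.of_space (locallyBounded_of_continuous continuous_id))).add
    ((LocallyBoundedUpperHalf.of_time fun t ht =>
    (hasDerivAt_velScale hκ (le_of_lt ht)).continuousAt.continuousWithinAt).mul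
    (.of_space h.bounded_velocity))
  intro R a b ha
  obtain ⟨C, hC⟩ := hw R a b ha
  refine ⟨C, fun x hx t ht => ?_⟩
  have heq := charPos_eq hκ (ha.le.trans ht.1) u₀ x
  exact (congrArg abs heq).le.trans (hC x hx t ht)

theorem measurable_coe_time : Measurable fun p : ℝ × Ioi (0 : ℝ) => (p.2 : ℝ) :=
  measurable_subtype_coe.comp measurable_snd

theorem measurable_charVel (h : InitialData κ v₀ u₀) :
    Measurable fun p : ℝ × Ioi (0 : ℝ) => charVel κ u₀ p.1 p.2 := by
  have h1 := measurable_coe_time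
  have h2 : Measurable fun p : ℝ × Ioi (0 : ℝ) => p.1 := measurable_fst
  have h3 : Measurable fun p : ℝ × Ioi (0 : ℝ) => u₀ p.1 :=
    h.measurable_velocity.comp measurable_fst
  exact ((h2.div_const _).add (h3.div_const _)).sub
    (((h2.div_const _).sub ((h3.mul_const _).div_const _)).mul
      (((h1.add_const κ).pow_const 2).const_div κ))

theorem measurable_charPos (h : InitialData κ v₀ u₀) :
    Measurable fun p : ℝ × Ioi (0 : ℝ) => charPos κ u₀ p.1 p.2 := by
  have h1 := measurable_coe_time
  have h2 : Measurable fun p : ℝ × Ioi (0 : ℝ) => p.1 := measurable_fst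
  have h3 : Measurable fun p : ℝ × Ioi (0 : ℝ) => u₀ p.1 :=
    h.measurable_velocity.comp measurable_fst
  exact (((h2.div_const _).add (h3.div_const _)).mul (h1.add_const κ)).add
    (((h2.div_const _).sub ((h3.mul_const _).div_const _)).mul ((h1.add_const κ).const_div κ))

theorem measurable_inv_time : Measurable fun p : ℝ × Ioi (0 : ℝ) => 1 / ((p.2 : ℝ) + κ) :=
  (measurable_coe_time.add_const κ).const_div 1

theorem locallyBounded_momentumRate (h : InitialData κ v₀ u₀) (hA : MinimumAttained κ v₀ u₀)
    {φ : ℝ × ℝ → ℝ} (hφ : IsTestFunction φ) :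
    LocallyBoundedUpperHalf (momentumRate κ v₀ u₀ φ) := by
  have hT := h.locallyBounded_comp_labelPos hA (.of_continuous hφ.continuous_partialT)
  have hX := h.locallyBounded_comp_labelPos hA (.of_continuous hφ.continuous_partialX)
  have h0 := h.locallyBounded_comp_labelPos hA (.of_continuous hφ.continuous)
  have hu := h.locallyBounded_comp_labelPos hA (h.locallyBounded_velocity hA)
  have ht : LocallyBoundedUpperHalf fun _ t => 1 / (t + κ) := .of_time h.continuousOn_inv_time
  have hmain := ((hT.add (hX.mul hu)).mul h.locallyBounded_charVel).add
    (h0.mul (ht.mul ((h.locallyBounded_charPos.mul ht).sub h.locallyBounded_charVel)))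
  simp only [mul_one_div] at hmain
  exact hmain

theorem measurable_momentumRate (h : InitialData κ v₀ u₀) (hA : MinimumAttained κ v₀ u₀)
    {φ : ℝ × ℝ → ℝ} (hφ : IsTestFunction φ) :
    Measurable fun p : ℝ × Ioi (0 : ℝ) => momentumRate κ v₀ u₀ φ p.1 p.2 := by
  have hT := h.measurable_comp_labelPos hA
    (measurable_upperHalf_of_continuous hφ.continuous_partialT)
  have hX := h.measurable_comp_labelPos hA
    (measurable_upperHalf_of_continuous hφ.continuous_partialX)
  have h0 := h.measurable_comp_labelPos hA (measurable_upperHalf_of_continuous hφ.continuous)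
  have hu := h.measurable_comp_labelPos hA (h.measurable_velocityField hA)
  have ht : Measurable fun p : ℝ × Ioi (0 : ℝ) => 1 / ((p.2 : ℝ) + κ) := measurable_inv_time
  exact ((hT.add (hX.mul hu)).mul h.measurable_charVel).add
    (h0.mul (ht.mul ((h.measurable_charPos.div (measurable_coe_time.add_const κ)).sub
      h.measurable_charVel)))

theorem measurable_momentumIntegrand (h : InitialData κ v₀ u₀) (hA : MinimumAttained κ v₀ u₀)
    {φ : ℝ × ℝ → ℝ} (hφ : IsTestFunction φ) {t : ℝ} (ht : 0 < t) :
    Measurable fun x => momentumIntegrand κ (velocity κ v₀ u₀) φ x t := by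
  have hT := measurable_time_slice (measurable_upperHalf_of_continuous hφ.continuous_partialT) ht
  have hX := measurable_time_slice (measurable_upperHalf_of_continuous hφ.continuous_partialX) ht
  have h0 := measurable_time_slice (measurable_upperHalf_of_continuous hφ.continuous) ht
  have hu := measurable_time_slice (h.measurable_velocityField hA) ht
  exact ((hT.mul hu).add (hX.mul (hu.pow_const 2))).add
    ((((measurable_id.div_const (t + κ)).sub hu).const_mul (1 / (t + κ))).mul h0)

theorem momentumIntegrand_eq_zero {φ : ℝ × ℝ → ℝ} {x t : ℝ}
    (h0 : φ (x, t) = 0 ∧ partialX φ x t = 0 ∧ partialT φ x t = 0) (u : ℝ → ℝ → ℝ) :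
    momentumIntegrand κ u φ x t = 0 := by
  simp [momentumIntegrand, h0.1, h0.2.1, h0.2.2]

theorem integrable_momentum_inner (h : InitialData κ v₀ u₀) (hA : MinimumAttained κ v₀ u₀)
    {φ : ℝ × ℝ → ℝ} (hφ : IsTestFunction φ) {t : ℝ} (ht : 0 < t) :
    Integrable (fun x => momentumIntegrand κ (velocity κ v₀ u₀) φ x t)
      (stieltjesMeasure fun x => mass κ v₀ u₀ x t) := by
  obtain ⟨R, α, β, hR, hα, hαβ, hbox⟩ := hφ.exists_box
  have hu := h.locallyBounded_velocity hA
  have hs : LocallyBoundedUpperHalf fun _ t => 1 / (t + κ) := .of_time h.continuousOn_inv_time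
  have hx : LocallyBoundedUpperHalf fun x _ => x :=
    .of_space (locallyBounded_of_continuous continuous_id)
  have hb := (((LocallyBoundedUpperHalf.of_continuous hφ.continuous_partialT).mul hu).add
    ((LocallyBoundedUpperHalf.of_continuous hφ.continuous_partialX).mul (hu.mul hu))).add
    ((hs.mul ((hx.mul hs).sub hu)).mul (.of_continuous hφ.continuous))
  refine h.integrable_of_vanishing hA ht (h.measurable_momentumIntegrand hA hφ ht) (fun S => ?_)
    (R := R) fun x hx => momentumIntegrand_eq_zero (hbox x t (.inl hx)) _
  obtain ⟨C, hC⟩ := hb S t t ht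
  refine ⟨C, fun x hx => (le_of_eq ?_).trans (hC x hx t ⟨le_rfl, le_rfl⟩)⟩
  congr 1
  unfold momentumIntegrand
  ring

/-- The momentum integrand in Lagrangian form: position and velocity may be replaced by those of
the characteristic, of which they are conditional expectations. -/
theorem integral_momentumIntegrand (h : InitialData κ v₀ u₀) (hA : MinimumAttained κ v₀ u₀)
    {φ : ℝ × ℝ → ℝ} (hφ : IsTestFunction φ) {t R K : ℝ} (ht : 0 < t)
    (hK : ∀ η, |labelPos κ v₀ u₀ η t| ≤ R → |η| ≤ K)
    (h0 : ∀ x, R ≤ |x| → φ (x, t) = 0 ∧ partialX φ x t = 0 ∧ partialT φ x t = 0) :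
    ∫ x, momentumIntegrand κ (velocity κ v₀ u₀) φ x t
        ∂(stieltjesMeasure fun x => mass κ v₀ u₀ x t)
      = ∫ η in Icc (-K) K, momentumRate κ v₀ u₀ φ η t * v₀ η := by
  have hfar : ∀ η, K < |η| → R ≤ |labelPos κ v₀ u₀ η t| := fun η hη => by
    by_contra hlt
    exact absurd (hK η (not_le.1 hlt).le) (not_le.2 hη)
  have hXmeas : Measurable fun η => labelPos κ v₀ u₀ η t := (h.monotone_labelPos hA ht).measurable
  -- a locally bounded weight times a function of the position that vanishes off `[-R, R]`
  have hint : ∀ (g : ℝ → ℝ → ℝ) (w : ℝ → ℝ → ℝ),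
      Measurable (fun p : ℝ × Ioi (0 : ℝ) => g p.1 p.2) →
      Measurable (fun p : ℝ × Ioi (0 : ℝ) => w p.1 p.2) →
      LocallyBoundedUpperHalf g → LocallyBoundedUpperHalf w → (∀ x, R ≤ |x| → g x t = 0) →
      Integrable fun η => g (labelPos κ v₀ u₀ η t) t * w η t * v₀ η := by
    intro g w hg hw hgb hwb hg0
    obtain ⟨C, hC⟩ := ((h.locallyBounded_comp_labelPos hA hgb).mul hwb) K t t ht
    exact h.integrable_mul_density (K := K) (C := C)
      (((measurable_time_slice hg ht).comp hXmeas).mul (measurable_time_slice hw ht))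
      (fun η hη => hC η (abs_le.1 hη) t ⟨le_rfl, le_rfl⟩)
      fun η hη => by rw [hg0 _ (hfar η hη), zero_mul]
  have hTm := measurable_upperHalf_of_continuous hφ.continuous_partialT
  have hXm := measurable_upperHalf_of_continuous hφ.continuous_partialX
  have h0m := measurable_upperHalf_of_continuous hφ.continuous
  have hum := h.measurable_velocityField hA
  have hTb := LocallyBoundedUpperHalf.of_continuous hφ.continuous_partialT
  have hXb := LocallyBoundedUpperHalf.of_continuous hφ.continuous_partialX
  have h0b := LocallyBoundedUpperHalf.of_continuous hφ.continuous
  have hub := h.locallyBounded_velocity hA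
  have hsm : Measurable fun p : ℝ × Ioi (0 : ℝ) => 1 / ((p.2 : ℝ) + κ) := measurable_inv_time
  have hsb : LocallyBoundedUpperHalf fun _ t => 1 / (t + κ) := .of_time h.continuousOn_inv_time
  have hi₁ := hint
    (fun x t => partialT φ x t + partialX φ x t * velocity κ v₀ u₀ x t - φ (x, t) * (1 / (t + κ)))
    (fun η t => charVel κ u₀ η t - velocity κ v₀ u₀ (labelPos κ v₀ u₀ η t) t)
    ((hTm.add (hXm.mul hum)).sub (h0m.mul hsm))
    (h.measurable_charVel.sub (h.measurable_comp_labelPos hA hum))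
    ((hTb.add (hXb.mul hub)).sub (h0b.mul hsb))
    (h.locallyBounded_charVel.sub (h.locallyBounded_comp_labelPos hA hub))
    fun x hx => by simp [(h0 x hx).1, (h0 x hx).2.1, (h0 x hx).2.2]
  have hi₂ := hint (fun x t => φ (x, t) * (1 / (t + κ)) * (1 / (t + κ)))
    (fun η t => charPos κ u₀ η t - labelPos κ v₀ u₀ η t)
    ((h0m.mul hsm).mul hsm) (h.measurable_charPos.sub (h.measurable_labelPos hA))
    ((h0b.mul hsb).mul hsb)
    (h.locallyBounded_charPos.sub (h.locallyBounded_comp_labelPos hA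
      (.of_space (locallyBounded_of_continuous continuous_id))))
    fun x hx => by simp [(h0 x hx).1]
  have hz₁ := h.integral_comp_labelPos_charVel hA ht
    (g := fun x => partialT φ x t + partialX φ x t * velocity κ v₀ u₀ x t
      - φ (x, t) * (1 / (t + κ))) hi₁
  have hz₂ := h.integral_comp_labelPos_charPos hA ht
    (g := fun x => φ (x, t) * (1 / (t + κ)) * (1 / (t + κ))) hi₂
  have hrate : Integrable fun η => momentumRate κ v₀ u₀ φ η t * v₀ η := by
    obtain ⟨C, hC⟩ := h.locallyBounded_momentumRate hA hφ K t t ht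
    refine h.integrable_mul_density (K := K) (C := C)
      (measurable_time_slice (h.measurable_momentumRate hA hφ) ht)
      (fun η hη => hC η (abs_le.1 hη) t ⟨le_rfl, le_rfl⟩) fun η hη => ?_
    simp [momentumRate, (h0 _ (hfar η hη)).1, (h0 _ (hfar η hη)).2.1, (h0 _ (hfar η hη)).2.2]
  have hsplit : ∀ η, momentumIntegrand κ (velocity κ v₀ u₀) φ (labelPos κ v₀ u₀ η t) t * v₀ η
      = momentumRate κ v₀ u₀ φ η t * v₀ η
        - (partialT φ (labelPos κ v₀ u₀ η t) t + partialX φ (labelPos κ v₀ u₀ η t) t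
            * velocity κ v₀ u₀ (labelPos κ v₀ u₀ η t) t
            - φ (labelPos κ v₀ u₀ η t, t) * (1 / (t + κ)))
          * (charVel κ u₀ η t - velocity κ v₀ u₀ (labelPos κ v₀ u₀ η t) t) * v₀ η
        - φ (labelPos κ v₀ u₀ η t, t) * (1 / (t + κ)) * (1 / (t + κ))
          * (charPos κ u₀ η t - labelPos κ v₀ u₀ η t) * v₀ η := by
    intro η
    unfold momentumIntegrand momentumRate
    ring
  rw [h.integral_stieltjesMeasure hA ht (h.measurable_momentumIntegrand hA hφ ht)]
  simp only [hsplit]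
  have hdiff := integral_sub (hrate.sub hi₁) hi₂
  simp only [Pi.sub_apply] at hdiff
  rw [hdiff, integral_sub hrate hi₁, hz₁, hz₂, sub_zero, sub_zero,
    setIntegral_eq_integral_of_forall_compl_eq_zero]
  intro η hη
  have hη' : K < |η| := not_le.1 fun hle => hη (abs_le.1 hle)
  simp [momentumRate, (h0 _ (hfar η hη')).1, (h0 _ (hfar η hη')).2.1, (h0 _ (hfar η hη')).2.2]

theorem integrable_momentum_outer (h : InitialData κ v₀ u₀) (hA : MinimumAttained κ v₀ u₀)
    {φ : ℝ × ℝ → ℝ} (hφ : IsTestFunction φ) :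
    IntegrableOn (fun t => ∫ x, momentumIntegrand κ (velocity κ v₀ u₀) φ x t
      ∂(stieltjesMeasure fun x => mass κ v₀ u₀ x t)) (Ioi (0 : ℝ)) := by
  obtain ⟨R, α, β, K, hR, hα, hαβ, hK0, hbox, hK⟩ := h.exists_box_labels hA hφ
  have hF := (h.fubini_labels (h.measurable_momentumRate hA hφ)
    (h.locallyBounded_momentumRate hA hφ) hα hαβ.le K).1
  refine IntegrableOn.of_forall_sdiff_eq_zero (s := Ioc α β) (hF.congr_fun (fun t ht => ?_)
    measurableSet_Ioc) measurableSet_Ioi (eq_zero_of_mem_sdiff_Ioc fun t ht => ?_)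
  · exact (h.integral_momentumIntegrand hA hφ (hK t ht).1 (hK t ht).2.2
      fun x hx => hbox x t (.inl hx)).symm
  · simp [fun x => momentumIntegrand_eq_zero (κ := κ) (hbox x t (.inr ht)) (velocity κ v₀ u₀)]

theorem momentum_identity (h : InitialData κ v₀ u₀) (hA : MinimumAttained κ v₀ u₀)
    {φ : ℝ × ℝ → ℝ} (hφ : IsTestFunction φ) :
    ∫ t in Ioi (0 : ℝ), ∫ x, momentumIntegrand κ (velocity κ v₀ u₀) φ x t
      ∂(stieltjesMeasure fun x => mass κ v₀ u₀ x t) = 0 := by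
  obtain ⟨R, α, β, K, hR, hα, hαβ, hK0, hbox, hK⟩ := h.exists_box_labels hA hφ
  obtain ⟨-, hi, -, hF⟩ := h.fubini_labels (h.measurable_momentumRate hA hφ)
    (h.locallyBounded_momentumRate hA hφ) hα hαβ.le K
  rw [setIntegral_eq_of_subset_of_forall_sdiff_eq_zero measurableSet_Ioi
    (Ioc_subset_Ioi_zero hα) (eq_zero_of_mem_sdiff_Ioc fun t ht => by
      simp [fun x => momentumIntegrand_eq_zero (κ := κ) (hbox x t (.inr ht)) (velocity κ v₀ u₀)]),
    setIntegral_congr_fun measurableSet_Ioc fun t ht => h.integral_momentumIntegrand hA hφ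
      (hK t ht).1 (hK t ht).2.2 fun x hx => hbox x t (.inl hx), hF]
  refine integral_eq_zero_of_ae ?_
  filter_upwards [ae_restrict_of_ae h.ae_isRegularLabel] with η hη
  have hcharVel : ContinuousOn (fun t => charVel κ u₀ η t) (Icc α β) := fun t ht =>
    (h.hasDerivAt_charVel (hα.le.trans ht.1) η).continuousAt.continuousWithinAt
  have hpath := h.integral_derivative_along_path hA hη hα hαβ.le
    (f := fun t => φ (labelPos κ v₀ u₀ η t, t) * charVel κ u₀ η t)
    ((hφ.1.continuous.comp_continuousOn
      ((h.continuousOn_labelPos hA hα β η).prodMk continuousOn_id)).mul hcharVel)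
    (hi η) fun t ht hX => (hasDerivWithinAt_comp_path (hφ.differentiable _) hX).mul
      (h.hasDerivAt_charVel ht.le η).hasDerivWithinAt
  rw [(hbox _ _ (.inr (.inr le_rfl))).1, (hbox _ _ (.inr (.inl le_rfl))).1, zero_mul, zero_mul,
    sub_zero] at hpath
  rw [hpath, zero_mul]
  rfl

/-! ### The generalized solution -/

theorem isGeneralizedSolution (h : InitialData κ v₀ u₀) (hA : MinimumAttained κ v₀ u₀) :
    IsGeneralizedSolution κ (mass κ v₀ u₀) (velocity κ v₀ u₀) where
  measurable_m := h.measurable_mass hA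
  measurable_u := h.measurable_velocityField hA
  locallyBounded_m := h.locallyBounded_mass hA
  locallyBounded_u := h.locallyBounded_velocity hA
  monotone_m := fun _ ht => h.monotone_mass hA ht
  distributional_derivative := fun _ ht _ hψ hc => h.distributional_derivative hA ht hψ hc
  integrable_mass_left := by
    intro φ hφ
    obtain ⟨R, α, β, hR, hα, hαβ, hbox⟩ := hφ.exists_box
    obtain ⟨C, hC⟩ := ((LocallyBoundedUpperHalf.of_continuous hφ.continuous_partialT).mul
      (h.locallyBounded_mass hA)) R α β hα
    have hmeas : Measurable fun p : ℝ × Ioi (0 : ℝ) => partialT φ p.1 p.2 * mass κ v₀ u₀ p.1 p.2 :=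
      (measurable_upperHalf_of_continuous hφ.continuous_partialT).mul (h.measurable_mass hA)
    refine IntegrableOn.of_forall_sdiff_eq_zero (s := Icc (-R) R ×ˢ Icc α β) ?_
      (MeasurableSet.univ.prod measurableSet_Ioi) fun p hp => ?_
    · rw [IntegrableOn, Measure.volume_eq_prod, ← Measure.prod_restrict]
      refine Integrable.of_bound (aestronglyMeasurable_of_upperHalf
        (w := fun x t => partialT φ x t * mass κ v₀ u₀ x t) hmeas measurableSet_Icc
        measurableSet_Icc fun t ht => hα.trans_le ht.1) C ?_
      rw [Measure.prod_restrict]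
      filter_upwards [ae_restrict_mem (measurableSet_Icc.prod measurableSet_Icc)] with p hp
      exact hC p.1 hp.1 p.2 hp.2
    · rw [(hbox p.1 p.2 ?_).2.2, zero_mul]
      by_contra hcon
      push Not at hcon
      exact hp.2 ⟨abs_le.1 hcon.1.le, hcon.2.1.le, hcon.2.2.le⟩
  integrable_mass_inner := by
    intro φ hφ t ht
    obtain ⟨R, α, β, hR, hα, hαβ, hbox⟩ := hφ.exists_box
    refine h.integrable_of_vanishing hA ht (((measurable_time_slice
      (measurable_upperHalf_of_continuous hφ.continuous) ht)).mul
      (measurable_time_slice (h.measurable_velocityField hA) ht)) (fun S => ?_) (R := R)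
      fun x hx => by rw [(hbox x t (.inl hx)).1, zero_mul]
    obtain ⟨C, hC⟩ := ((LocallyBoundedUpperHalf.of_continuous hφ.continuous).mul
      (h.locallyBounded_velocity hA)) S t t ht
    exact ⟨C, fun x hx => hC x hx t ⟨le_rfl, le_rfl⟩⟩
  integrable_mass_outer := fun _ hφ => h.integrable_mass_outer hA hφ
  mass_identity := fun _ hφ => h.mass_identity hA hφ
  integrable_momentum_inner := fun _ hφ _ ht => h.integrable_momentum_inner hA hφ ht
  integrable_momentum_outer := fun _ hφ => h.integrable_momentum_outer hA hφ
  momentum_identity := fun _ hφ => h.momentum_identity hA hφ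

end InitialData

/-! ### The initial data -/

theorem IsLebesguePoint.eventually_integral_le {f : ℝ → ℝ} {x : ℝ} (hf : IsLebesguePoint f x)
    {θ : ℝ} (hθ : 0 < θ) :
    ∀ᶠ r in 𝓝[>] (0 : ℝ), ∫ y in (x - r)..(x + r), |f y - f x| ≤ θ * r := by
  filter_upwards [hf.eventually_lt_const (half_pos hθ), self_mem_nhdsWithin] with r hr hr0
  have h2 : (0 : ℝ) < 2 * r := by have : (0 : ℝ) < r := hr0; positivity
  rw [inv_mul_lt_iff₀ h2] at hr
  linarith

theorem ae_isLebesguePoint {f : ℝ → ℝ} (hf : LocallyIntegrable f) :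
    ∀ᵐ x, IsLebesguePoint f x := by
  filter_upwards [IsUnifLocDoublingMeasure.ae_tendsto_average_norm_sub volume hf 1] with x hx
  have h1 := hx (l := 𝓝[>] (0 : ℝ)) (fun _ => x) id tendsto_id (by
    filter_upwards [self_mem_nhdsWithin] with r hr
    have hr0 : (0 : ℝ) < r := hr
    exact Metric.mem_closedBall_self (by simpa using hr0.le))
  refine h1.congr' ?_
  filter_upwards [self_mem_nhdsWithin] with r hr
  have hr0 : (0 : ℝ) < r := hr
  rw [setAverage_eq, id, Real.closedBall_eq_Icc, intervalIntegral.integral_of_le (by linarith),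
    ← integral_Icc_eq_integral_Ioc, Measure.real, Real.volume_Icc,
    ENNReal.toReal_ofReal (by linarith), smul_eq_mul]
  congr 2
  ring

namespace InitialData

variable {κ : ℝ} {v₀ u₀ : ℝ → ℝ}

/-- As `t → 0`, minimizers at `(x, t)` stay within a distance `O(velScale κ t)` of `x`. -/
theorem exists_abs_minimizer_sub_le (h : InitialData κ v₀ u₀) (hA : MinimumAttained κ v₀ u₀)
    (x : ℝ) : ∃ L, 0 ≤ L ∧ ∀ t, 0 < t → t ≤ 1 → ∀ y ∈ minimizers κ v₀ u₀ x t,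
      |y - x| ≤ L * velScale κ t := by
  have hκ := h.kappa_pos
  obtain ⟨K, hK⟩ := h.exists_abs_minimizer_le hA 1 |x|
  obtain ⟨C, hC0, hC⟩ := h.exists_abs_cumMomentum_sub_le (K + 1)
  refine ⟨C + |K| / κ, by positivity, fun t ht ht1 y hy => ?_⟩
  have hyK := hK t ht ht1 x le_rfl y hy
  have hyK' := abs_le.1 hyK
  have ha := one_le_posScale hκ ht.le
  have ha0 : 0 < posScale κ t := by linarith
  have hb := velScale_pos hκ ht
  have ha1 := posScale_sub_one_le hκ ht.le
  have hmin := (h.mem_minimizers ht.le).1 hy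
  have hupper : posScale κ t * y ≤ x + velScale κ t * C := by
    by_contra hcon
    push Not at hcon
    have hlt : max (y - 1) ((x + velScale κ t * C) / posScale κ t) < y :=
      max_lt (by linarith) (by rw [div_lt_iff₀ ha0]; linarith)
    have hz1 := le_max_left (y - 1) ((x + velScale κ t * C) / posScale κ t)
    have hz2 := le_max_right (y - 1) ((x + velScale κ t * C) / posScale κ t)
    rw [div_le_iff₀ ha0] at hz2
    set z := max (y - 1) ((x + velScale κ t * C) / posScale κ t)
    have h1 := hmin z
    have hM := h.cumMass_sub_pos hlt
    have h2 := mul_lt_mul_of_pos_left (h.mul_lt_cumMoment_sub hlt) ha0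
    have h3 := mul_le_mul_of_nonneg_left
      (neg_le_of_abs_le (hC z y (by linarith) hlt.le (by linarith))) hb.le
    have h4 := mul_le_mul_of_nonneg_right hz2 hM.le
    linarith
  have hlower : x - velScale κ t * C ≤ posScale κ t * y := by
    by_contra hcon
    push Not at hcon
    have hlt : y < min (y + 1) ((x - velScale κ t * C) / posScale κ t) :=
      lt_min (by linarith) (by rw [lt_div_iff₀ ha0]; linarith)
    have hz1 := min_le_left (y + 1) ((x - velScale κ t * C) / posScale κ t)
    have hz2 := min_le_right (y + 1) ((x - velScale κ t * C) / posScale κ t)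
    rw [le_div_iff₀ ha0] at hz2
    set z := min (y + 1) ((x - velScale κ t * C) / posScale κ t)
    have h1 := hmin z
    have hM := h.cumMass_sub_pos hlt
    have h2 := mul_lt_mul_of_pos_left (h.cumMoment_sub_lt hlt) ha0
    have h3 := mul_le_mul_of_nonneg_left
      (le_of_abs_le (hC y z (by linarith) hlt.le (by linarith))) hb.le
    have h4 := mul_le_mul_of_nonneg_right hz2 hM.le
    linarith
  have h5 : |(posScale κ t - 1) * y| ≤ velScale κ t / κ * |K| := by
    rw [abs_mul, abs_of_nonneg (by linarith)]
    exact mul_le_mul ha1 (hyK.trans (le_abs_self K)) (abs_nonneg _) (by positivity)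
  have h6 := abs_le.1 h5
  have h7 : (C + |K| / κ) * velScale κ t = velScale κ t * C + velScale κ t / κ * |K| := by
    field_simp
  rw [h7, abs_le]
  constructor <;> linarith

theorem tendsto_velScale_zero (h : InitialData κ v₀ u₀) :
    Tendsto (velScale κ) (𝓝[>] 0) (𝓝[>] 0) := by
  refine tendsto_nhdsWithin_iff.2 ⟨?_, ?_⟩
  · have := (hasDerivAt_velScale h.kappa_pos le_rfl).continuousAt.tendsto
    rw [velScale_zero h.kappa_pos] at this
    exact this.mono_left nhdsWithin_le_nhds
  · filter_upwards [self_mem_nhdsWithin] with t ht using velScale_pos h.kappa_pos ht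

theorem tendsto_of_mem_minimizers (h : InitialData κ v₀ u₀) (hA : MinimumAttained κ v₀ u₀)
    (x : ℝ) {y : ℝ → ℝ} (hy : ∀ t, 0 < t → y t ∈ minimizers κ v₀ u₀ x t) :
    Tendsto y (𝓝[>] 0) (𝓝 x) := by
  obtain ⟨L, -, hL⟩ := h.exists_abs_minimizer_sub_le hA x
  rw [tendsto_iff_norm_sub_tendsto_zero]
  have hlim : Tendsto (fun t => L * velScale κ t) (𝓝[>] 0) (𝓝 0) := by
    simpa using (h.tendsto_velScale_zero.mono_right nhdsWithin_le_nhds).const_mul L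
  refine squeeze_zero' (Eventually.of_forall fun _ => norm_nonneg _) ?_ hlim
  filter_upwards [Ioo_mem_nhdsGT one_pos] with t ht
  exact hL t ht.1 ht.2.le _ (hy t ht.1)

/-- At a common Lebesgue point the `v₀`-weighted mean of `u₀` over an interval of length `ε b`
within distance `L b` of the point is, for small `b`, close to the value of `u₀` there. -/
theorem eventually_abs_mean_sub_le (h : InitialData κ v₀ u₀) {x ε L : ℝ}
    (hu : IsLebesguePoint u₀ x) (hv : IsLebesguePoint v₀ x) (hε : 0 < ε) (hL : 0 < L) :
    ∀ᶠ b in 𝓝[>] (0 : ℝ), ∀ p q, x - L * b ≤ p → q ≤ x + L * b → q - p = ε * b →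
      |cumWeighted v₀ u₀ q - cumWeighted v₀ u₀ p - u₀ x * (cumMass v₀ q - cumMass v₀ p)|
        ≤ ε * (cumMass v₀ q - cumMass v₀ p) := by
  obtain ⟨C, hC⟩ := h.bounded_density (|x| + 1)
  have hC0 : 0 < C := (abs_pos.2 (h.density_pos x).ne').trans_le
    (hC x (abs_le.1 (by linarith : |x| ≤ |x| + 1)))
  have hvx := h.density_pos x
  have hscale : Tendsto (fun b => L * b) (𝓝[>] (0 : ℝ)) (𝓝[>] 0) := by
    refine tendsto_nhdsWithin_iff.2 ⟨?_, ?_⟩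
    · have h1 : Tendsto (fun b : ℝ => L * b) (𝓝[>] 0) (𝓝 (L * 0)) :=
        (tendsto_id.mono_left nhdsWithin_le_nhds).const_mul L
      rwa [mul_zero] at h1
    · filter_upwards [self_mem_nhdsWithin] with b hb using mul_pos hL hb
  -- the constants make the error in the mass at most half of it, and the momentum error `ε` times
  -- that half
  have hθ₁ : 0 < ε * (v₀ x * ε / 2) / (C * L) := by positivity
  have hθ₂ : 0 < v₀ x * ε / 2 / L := by positivity
  filter_upwards [hscale.eventually (hu.eventually_integral_le hθ₁),
    hscale.eventually (hv.eventually_integral_le hθ₂),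
    hscale.eventually (Ioo_mem_nhdsGT one_pos), self_mem_nhdsWithin]
    with b hbu hbv hb1 hb0 p q hp hq hpq
  have hb : (0 : ℝ) < b := hb0
  have hεb : 0 < ε * b := by positivity
  have hle : p ≤ q := by linarith
  have hsub : ∀ {f : ℝ → ℝ}, LocallyBounded f → Measurable f →
      ∫ y in p..q, |f y - f x| ≤ ∫ y in (x - L * b)..(x + L * b), |f y - f x| := by
    intro f hf hm
    have hi : ∀ c d, IntervalIntegrable (fun y => |f y - f x|) volume c d := fun c d =>
      ((hf.intervalIntegrable hm c d).sub intervalIntegrable_const).abs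
    exact intervalIntegral.integral_mono_interval hp hle hq
      (ae_of_all _ fun y => abs_nonneg _) (hi _ _)
  have hmass : v₀ x * ε / 2 * b ≤ cumMass v₀ q - cumMass v₀ p := by
    have h1 : ∫ y in p..q, (v₀ x - |v₀ y - v₀ x|) ≤ ∫ y in p..q, v₀ y := by
      refine intervalIntegral.integral_mono_on hle (intervalIntegrable_const.sub
        ((h.intervalIntegrable_density p q).sub intervalIntegrable_const).abs)
        (h.intervalIntegrable_density p q) fun y _ => ?_
      linarith [neg_abs_le (v₀ y - v₀ x)]
    rw [intervalIntegral.integral_sub intervalIntegrable_const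
      ((h.intervalIntegrable_density p q).sub intervalIntegrable_const).abs,
      intervalIntegral.integral_const, smul_eq_mul, hpq, h.integral_density] at h1
    have h2 := (hsub h.bounded_density h.measurable_density).trans hbv
    have h3 : v₀ x * ε / 2 / L * (L * b) = v₀ x * ε / 2 * b := by field_simp
    linarith
  have hmom : |cumWeighted v₀ u₀ q - cumWeighted v₀ u₀ p - u₀ x * (cumMass v₀ q - cumMass v₀ p)|
      ≤ C * ∫ y in p..q, |u₀ y - u₀ x| := by
    rw [← h.integral_momentum, ← h.integral_density, ← intervalIntegral.integral_const_mul,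
      ← intervalIntegral.integral_sub (h.intervalIntegrable_momentum p q)
        ((h.intervalIntegrable_density p q).const_mul _), ← intervalIntegral.integral_const_mul]
    have hi : IntervalIntegrable (fun y => C * |u₀ y - u₀ x|) volume p q :=
      (((h.bounded_velocity.intervalIntegrable h.measurable_velocity p q).sub
        intervalIntegrable_const).abs).const_mul C
    rw [← Real.norm_eq_abs]
    refine intervalIntegral.norm_integral_le_of_norm_le hle (ae_of_all _ fun y hy => ?_) hi
    have hy1 : y ∈ Icc (-(|x| + 1)) (|x| + 1) := by
      have h1 := neg_abs_le x
      have h2 := le_abs_self x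
      constructor <;> linarith [hy.1, hy.2, hb1.2]
    rw [Real.norm_eq_abs, ← sub_mul, abs_mul, mul_comm]
    exact mul_le_mul_of_nonneg_right (hC y hy1) (abs_nonneg _)
  have h2 := mul_le_mul_of_nonneg_left
    ((hsub h.bounded_velocity h.measurable_velocity).trans hbu) hC0.le
  have h3 : C * (ε * (v₀ x * ε / 2) / (C * L) * (L * b)) = ε * (v₀ x * ε / 2 * b) := by
    field_simp
  have h4 := mul_le_mul_of_nonneg_left hmass hε.le
  linarith

/-- The initial velocity is attained at common Lebesgue points: a minimizer `y` is compared with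
the points `y ± ε b`, where `b = velScale κ t`. -/
theorem tendsto_velocity (h : InitialData κ v₀ u₀) (hA : MinimumAttained κ v₀ u₀) {x : ℝ}
    (hu : IsLebesguePoint u₀ x) (hv : IsLebesguePoint v₀ x) :
    Tendsto (fun t => velocity κ v₀ u₀ x t) (𝓝[>] 0) (𝓝 (u₀ x)) := by
  have hκ := h.kappa_pos
  obtain ⟨L, hL0, hL⟩ := h.exists_abs_minimizer_sub_le hA x
  have hslope : Tendsto (fun t => (x - posScale κ t * barycenter κ v₀ u₀ x t) / velScale κ t)
      (𝓝[>] 0) (𝓝 (u₀ x)) := by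
    rw [Metric.tendsto_nhds]
    intro δ hδ
    set ε := min (δ / 4) 1
    have hε : 0 < ε := by positivity
    have hε1 : ε ≤ 1 := min_le_right _ _
    have hεδ : 3 * ε < δ := by linarith [min_le_left (δ / 4) 1]
    have ha2 : ∀ᶠ t in 𝓝[>] (0 : ℝ), posScale κ t < 2 := by
      have := (hasDerivAt_posScale hκ le_rfl).continuousAt.tendsto
      rw [posScale_zero hκ] at this
      exact (this.mono_left nhdsWithin_le_nhds).eventually_lt_const one_lt_two
    filter_upwards [h.tendsto_velScale_zero.eventually
      (h.eventually_abs_mean_sub_le hu hv hε (by positivity : 0 < L + 1)), ha2,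
      Ioo_mem_nhdsGT one_pos] with t hmean ha2 ht
    have hb := velScale_pos hκ ht.1
    have ha := one_le_posScale hκ ht.1.le
    have ha0 : 0 < posScale κ t := by linarith
    have hεb : 0 < ε * velScale κ t := by positivity
    have hεb1 : ε * velScale κ t ≤ velScale κ t := mul_le_of_le_one_left hb.le hε1
    have haε := mul_le_mul_of_nonneg_right ha2.le hεb.le
    have hbar := h.barycenter_mem_Icc hA ht.1 x
    have hl := (h.isLeast_yLeft hA ht.1 x).1
    have hr := (h.isGreatest_yRight hA ht.1 x).1
    have hl' := abs_le.1 (hL t ht.1 ht.2.le _ hl)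
    have hr' := abs_le.1 (hL t ht.1 ht.2.le _ hr)
    set y₁ := yLeft κ v₀ u₀ x t
    set y₂ := yRight κ v₀ u₀ x t
    have hupper : x - posScale κ t * y₁ ≤ (u₀ x + 3 * ε) * velScale κ t := by
      have h1 := hmean y₁ (y₁ + ε * velScale κ t) (by linarith) (by linarith) (by ring)
      have hlt : y₁ < y₁ + ε * velScale κ t := by linarith
      have hM := h.cumMass_sub_pos hlt
      have h2 := (h.mem_minimizers ht.1.le).1 hl (y₁ + ε * velScale κ t)
      have h3 := mul_lt_mul_of_pos_left (h.cumMoment_sub_lt hlt) ha0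
      have h4 := mul_le_mul_of_nonneg_left (le_of_abs_le h1) hb.le
      have h5 := mul_le_mul_of_nonneg_right haε hM.le
      refine le_of_mul_le_mul_right ?_ hM
      linarith
    have hlower : (u₀ x - 3 * ε) * velScale κ t ≤ x - posScale κ t * y₂ := by
      have h1 := hmean (y₂ - ε * velScale κ t) y₂ (by linarith) (by linarith) (by ring)
      have hlt : y₂ - ε * velScale κ t < y₂ := by linarith
      have hM := h.cumMass_sub_pos hlt
      have h2 := (h.mem_minimizers ht.1.le).1 hr (y₂ - ε * velScale κ t)
      have h3 := mul_lt_mul_of_pos_left (h.mul_lt_cumMoment_sub hlt) ha0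
      have h4 := mul_le_mul_of_nonneg_left (neg_le_of_abs_le h1) hb.le
      have h5 := mul_le_mul_of_nonneg_right haε hM.le
      refine le_of_mul_le_mul_right ?_ hM
      linarith
    have hm₁ := mul_le_mul_of_nonneg_left hbar.1 ha0.le
    have hm₂ := mul_le_mul_of_nonneg_left hbar.2 ha0.le
    have hw₁ : (x - posScale κ t * barycenter κ v₀ u₀ x t) / velScale κ t ≤ u₀ x + 3 * ε := by
      rw [div_le_iff₀ hb]; linarith
    have hw₂ : u₀ x - 3 * ε ≤ (x - posScale κ t * barycenter κ v₀ u₀ x t) / velScale κ t := by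
      rw [le_div_iff₀ hb]; linarith
    rw [Real.dist_eq, abs_lt]
    constructor <;> linarith
  have hbar : Tendsto (fun t => barycenter κ v₀ u₀ x t) (𝓝[>] 0) (𝓝 x) := by
    refine tendsto_of_tendsto_of_tendsto_of_le_of_le'
      (h.tendsto_of_mem_minimizers hA x fun t ht => (h.isLeast_yLeft hA ht x).1)
      (h.tendsto_of_mem_minimizers hA x fun t ht => (h.isGreatest_yRight hA ht x).1) ?_ ?_
    · filter_upwards [self_mem_nhdsWithin] with t ht using (h.barycenter_mem_Icc hA ht x).1
    · filter_upwards [self_mem_nhdsWithin] with t ht using (h.barycenter_mem_Icc hA ht x).2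
  have hvr : Tendsto (velRate κ) (𝓝[>] 0) (𝓝 1) := by
    have h1 := (hasDerivAt_velRate hκ le_rfl).continuousAt.tendsto
    rw [show velRate κ 0 = 1 by unfold velRate; field_simp; ring] at h1
    exact h1.mono_left nhdsWithin_le_nhds
  have hpr : Tendsto (posRate κ) (𝓝[>] 0) (𝓝 0) := by
    have h1 := (hasDerivAt_posRate hκ le_rfl).continuousAt.tendsto
    rw [show posRate κ 0 = 0 by unfold posRate; field_simp; ring] at h1
    exact h1.mono_left nhdsWithin_le_nhds
  have hlim := (hvr.mul hslope).add (hpr.mul hbar)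
  rw [one_mul, zero_mul, add_zero] at hlim
  refine hlim.congr' ?_
  filter_upwards [self_mem_nhdsWithin] with t ht using (h.velocity_eq_barycenter hA ht x).symm

theorem attainsInitialData (h : InitialData κ v₀ u₀) (hA : MinimumAttained κ v₀ u₀) :
    AttainsInitialData v₀ u₀ (mass κ v₀ u₀) (velocity κ v₀ u₀) := by
  refine ⟨fun x => ?_, fun x hu hv => h.tendsto_velocity hA hu hv, ?_⟩
  · exact (h.continuous_cumMass.tendsto x).comp
      (h.tendsto_of_mem_minimizers hA x fun t ht => (h.isLeast_yLeft hA ht x).1)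
  · filter_upwards [ae_isLebesguePoint
      (h.bounded_velocity.locallyIntegrable h.measurable_velocity), ae_isLebesguePoint
      (h.bounded_density.locallyIntegrable h.measurable_density)] with x hu hv
    exact h.tendsto_velocity hA hu hv

end InitialData

end Droplet

theorem theorem1p3 (κ : ℝ) (hκ : 0 < κ) (v₀ u₀ : ℝ → ℝ)
    (hv₀_meas : Measurable v₀) (hu₀_meas : Measurable u₀)
    (hv₀_bdd : Droplet.LocallyBounded v₀) (hu₀_bdd : Droplet.LocallyBounded u₀)
    (hv₀_pos : ∀ x, 0 < v₀ x) :
    ((∀ ε > 0, ∀ᶠ y in cocompact ℝ, -(1 / κ) - ε ≤ u₀ y / y) →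
      Droplet.MinimumAttained κ v₀ u₀) ∧
    (Droplet.MinimumAttained κ v₀ u₀ →
      (∀ x t, 0 < t →
        IsLeast (Droplet.minimizers κ v₀ u₀ x t) (Droplet.yLeft κ v₀ u₀ x t) ∧
        IsGreatest (Droplet.minimizers κ v₀ u₀ x t) (Droplet.yRight κ v₀ u₀ x t)) ∧
      Droplet.IsGeneralizedSolution κ (Droplet.mass κ v₀ u₀) (Droplet.velocity κ v₀ u₀) ∧
      Droplet.OleinikEntropy κ (Droplet.velocity κ v₀ u₀) ∧
      Droplet.AttainsInitialData v₀ u₀ (Droplet.mass κ v₀ u₀) (Droplet.velocity κ v₀ u₀)) := by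
  have h : Droplet.InitialData κ v₀ u₀ :=
    ⟨hκ, hv₀_meas, hu₀_meas, hv₀_bdd, hu₀_bdd, hv₀_pos⟩
  exact ⟨h.minimumAttained, fun hA => ⟨fun x _ ht =>
    ⟨h.isLeast_yLeft hA ht x, h.isGreatest_yRight hA ht x⟩,
    h.isGeneralizedSolution hA, h.oleinikEntropy hA, h.attainsInitialData hA⟩⟩
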